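/- Let $A(0)\subset\mathbb{R}^6$ be the configuration of 17 points consisting of the origin $O$ and of the points $a_i^{\pm}$ ($i=1,\dots,8$), where, with $e_1,\dots,e_4$ the standard basis of $\mathbb{R}^4$ and $$(v_1,\dots,v_8)=\big((\sqrt2,0),(1,1),(0,\sqrt2),(-1,1),(-\sqrt2,0),(-1,-1),(0,-\sqrt2),(1,-1)\big),$$ $a_i^{\pm}=(\pm e_i,v_i)$ and $a_{i+4}^{\pm}=(\pm e_i,v_{i+4})$ for $i=1,2,3,4$. The flip graph of $A(0)$ has as vertices all triangulations of $A(0)$ (not necessarily using all the points) and as edges the geometric bistellar flips between them. A triangulation $T$ of $A(0)$ induces on the boundary of $\operatorname{conv}(A(0))$ the triangulation consisting of the facets of cells of $T$ that lie in the boundary. Then there are exactly eight triangulations $K$ of the boundary of $\operatorname{conv}(A(0))$ such that (1) some triangulation of $A(0)$ induces $K$ on the boundary, and (2) no flip in a triangulation of $A(0)$ inducing $K$ on the boundary affects the boundary, i.e. every triangulation obtained by such a flip again induces $K$. Triangulations of $A(0)$ inducing different ones of these eight $K$ lie in different connected components of the flip graph. Moreover, regular triangulations of $A(0)$ exist, all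 of them lie in one and the same connected component of the flip graph, and this component contains no triangulation inducing one of the eight $K$. In particular, the flip graph of $A(0)$ has at least nine connected components. -/

import Mathlib

section PointConfigurations

variable {ι : Type*} [Fintype ι] [DecidableEq ι]
variable {E : Type*} [NormedAddCommGroup E] [NormedSpace ℝ E]

/-- The convex hull of the points of the configuration `a` whose labels lie in `σ`. -/
def cellHull (a : ι → E) (σ : Finset ι) : Set E := convexHull ℝ (a '' (σ : Set ι))

/-- The convex hull of all points of the configuration `a`. -/
def hull (a : ι → E) : Set E := convexHull ℝ (Set.range a)

/-- The points of the configuration `a` whose labels lie in `σ` are affinely independent. -/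
def IsIndep (a : ι → E) (σ : Finset ι) : Prop := AffineIndependent ℝ (fun i : σ => a i)

/-- `T` is a triangulation of the (full-dimensional) point configuration `a`: its cells are
affinely spanning and affinely independent, the convex hulls of any two cells meet in a common
face, and the cells cover the convex hull of `a`. Since the cells are simplices, the common face
can only be the one spanned by the common vertices. -/
structure IsTriangulation (a : ι → E) (T : Finset (Finset ι)) : Prop where
  indep : ∀ σ ∈ T, IsIndep a σ
  spanning : ∀ σ ∈ T, affineSpan ℝ (a '' (σ : Set ι)) = ⊤
  inter : ∀ σ ∈ T, ∀ σ' ∈ T, cellHull a σ ∩ cellHull a σ' = cellHull a (σ ∩ σ')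
  cover : ⋃ σ ∈ T, cellHull a σ = hull a

/-- The type of triangulations of the configuration `a`. -/
abbrev Triangulation (a : ι → E) := {T : Finset (Finset ι) // IsTriangulation a T}

/-- `(P, N)` is a signed circuit: `P ∪ N` is a minimal affinely dependent set, and `P`, `N` are the
sets of elements with positive, respectively negative, coefficient in an affine dependence. -/
structure IsCircuit (a : ι → E) (P N : Finset ι) : Prop where
  disj : Disjoint P N
  dep : ¬ IsIndep a (P ∪ N)
  minimal : ∀ S, S ⊂ P ∪ N → IsIndep a S
  signs : ∃ c : ι → ℝ, ∑ i ∈ P ∪ N, c i = 0 ∧ ∑ i ∈ P ∪ N, c i • a i = 0 ∧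
    (∀ i ∈ P, 0 < c i) ∧ (∀ i ∈ N, c i < 0)

/-- The triangulation `{C \ {i} : i ∈ P}` of a circuit `C = P ∪ N`. The other triangulation of
the circuit is `circuitTriangulation N P`. -/
def circuitTriangulation (P N : Finset ι) : Finset (Finset ι) :=
  P.image fun i => (P ∪ N).erase i

/-- The link of `τ` in `T`: all `ρ` disjoint from `τ` with `ρ ∪ τ ∈ T`. -/
def link (T : Finset (Finset ι)) (τ : Finset ι) : Finset (Finset ι) :=
  Finset.univ.filter fun ρ => Disjoint ρ τ ∧ ρ ∪ τ ∈ T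

/-- All the unions `ρ ∪ τ` with `ρ ∈ L` and `τ ∈ S`. -/
def joinCells (L S : Finset (Finset ι)) : Finset (Finset ι) :=
  Finset.image₂ (fun ρ τ => ρ ∪ τ) L S

/-- `T₂` is obtained from `T₁` by the geometric bistellar flip supported on some circuit `(P, N)`:
all cells of the triangulation `circuitTriangulation P N` are faces of `T₁` (their link is
non-empty) with one and the same link `L`, and their joins with `L` are replaced by the joins of
`L` with the other triangulation of the circuit. -/
def IsFlip (a : ι → E) (T₁ T₂ : Finset (Finset ι)) : Prop :=
  ∃ P N : Finset ι, IsCircuit a P N ∧ ∃ L : Finset (Finset ι), L.Nonempty ∧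
    (∀ τ ∈ circuitTriangulation P N, link T₁ τ = L) ∧
    T₂ = (T₁ \ joinCells L (circuitTriangulation P N)) ∪ joinCells L (circuitTriangulation N P)

/-- The graph of flips: vertices are all triangulations of `a`, and two different
triangulations are adjacent if one of them is obtained from the other one by a flip. -/
def flipGraph (a : ι → E) : SimpleGraph (Triangulation a) :=
  SimpleGraph.fromRel fun T₁ T₂ => IsFlip a T₁.1 T₂.1

/-- The cells of the regular subdivision `T_w` of `a` induced by the lifting function `w`.
A lower facet of the lifted configuration lies on the graph of an affine function `g` that is
nowhere above the lifted points; the corresponding cell consists of all the points whose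
lifting lies on that graph. -/
def regularCells (a : ι → E) (w : ι → ℝ) : Set (Finset ι) :=
  {σ | affineSpan ℝ (a '' (σ : Set ι)) = ⊤ ∧
    ∃ g : E →ᵃ[ℝ] ℝ, (∀ i, g (a i) ≤ w i) ∧ ∀ i, i ∈ σ ↔ g (a i) = w i}

/-- `T` is regular: it is the subdivision induced by some lifting function. -/
def IsRegularTriangulation (a : ι → E) (T : Finset (Finset ι)) : Prop :=
  ∃ w : ι → ℝ, (T : Set (Finset ι)) = regularCells a w

/-- `K` is a triangulation of the boundary of the convex hull of the (full-dimensional)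
configuration `a`: its cells are simplices of codimension one with vertices in `a`, any two of them
meet in the common face spanned by their common vertices, and they cover the boundary. -/
structure IsBoundaryTriangulation (a : ι → E) (K : Finset (Finset ι)) : Prop where
  indep : ∀ τ ∈ K, IsIndep a τ
  card : ∀ τ ∈ K, τ.card = Module.finrank ℝ E
  inter : ∀ τ ∈ K, ∀ τ' ∈ K, cellHull a τ ∩ cellHull a τ' = cellHull a (τ ∩ τ')
  cover : ⋃ τ ∈ K, cellHull a τ = frontier (hull a)

/-- `T` induces `K` on the boundary: `K` consists of those facets of cells of `T` that lie in the
boundary of the convex hull of `a`. -/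
def Induces (a : ι → E) (T K : Finset (Finset ι)) : Prop :=
  ∀ τ : Finset ι, τ ∈ K ↔
    (∃ σ ∈ T, ∃ i ∈ σ, τ = σ.erase i) ∧ cellHull a τ ⊆ frontier (hull a)

/-- `K` is a triangulation of the boundary that is induced by some triangulation of `a` and
such that no flip in a triangulation of `a` inducing `K` affects the boundary. -/
structure IsRigidBoundary (a : ι → E) (K : Finset (Finset ι)) : Prop where
  triang : IsBoundaryTriangulation a K
  extends_inside : ∃ T : Triangulation a, Induces a T.1 K
  no_flip : ∀ T T' : Triangulation a, Induces a T.1 K → (flipGraph a).Adj T T' → Induces a T'.1 K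

end PointConfigurations

/-- The configuration `A(t)` of 17 points in `ℝ⁶`: the label `0` is the origin, the labels
`1, …, 8` are `a₁⁺(t), …, a₈⁺(t)` and the labels `9, …, 16` are `a₁⁻(t), …, a₈⁻(t)`. -/
noncomputable def configA (t : ℝ) : Fin 17 → (Fin 6 → ℝ) :=
  ![![0, 0, 0, 0, 0, 0],
    ![1, t, 0, 0, Real.sqrt 2, 0],
    ![-t, 1, 0, 0, 1, 1],
    ![0, 0, 1, t, 0, Real.sqrt 2],
    ![0, 0, -t, 1, -1, 1],
    ![1, -t, 0, 0, -Real.sqrt 2, 0],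
    ![t, 1, 0, 0, -1, -1],
    ![0, 0, 1, -t, 0, -Real.sqrt 2],
    ![0, 0, t, 1, 1, -1],
    ![-1, -t, 0, 0, Real.sqrt 2, 0],
    ![t, -1, 0, 0, 1, 1],
    ![0, 0, -1, -t, 0, Real.sqrt 2],
    ![0, 0, t, -1, -1, 1],
    ![-1, t, 0, 0, -Real.sqrt 2, 0],
    ![-t, -1, 0, 0, -1, -1],
    ![0, 0, -1, t, 0, -Real.sqrt 2],
    ![0, 0, -t, -1, 1, -1]]

set_option linter.unusedSectionVars false

open Filter Topology

/-! ### Affine dependences, convex representations and their uniqueness in triangulations. -/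

section Dependences

variable {ι : Type*} [Fintype ι]
variable {E : Type*} [NormedAddCommGroup E] [NormedSpace ℝ E]

/-! The boundary of conv A(0) has 16 non-simplicial facets, one for each sign vector s in {±}^4,
with vertices (sᵢeᵢ, ±vᵢ). All its other facets are simplices. An octagonal facet is the Cayley
configuration of the four segments [-vᵢ, vᵢ], so its triangulations are the rhombus tilings of an
octagon. Its affine dependences form a plane, identified by `eq_octDep` with the linear dependences
of v₁, …, v₄. Its circuits are the four hexagons obtained by dropping one index l, and each of them
is shared by exactly two octagonal facets, which differ in the sign at l.

A triangulation cannot have both parts of a circuit as faces, so it selects one forbidden part for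
each of the 32 hexagons (`choiceOf`). In each octagonal facet the four selections form one of eight
good patterns (`isGood_choiceOf`), and these correspond to the eight tilings. Conversely, a family
of selections that agrees on shared hexagons and is good in every facet defines a triangulation of
the boundary, and coning it from the interior point O gives a triangulation of A(0)
(`isTriangulation_coneCells`). The selections and the induced boundary triangulation determine each
other (`induces_boundaryCells`, `boundaryCells_injective`).

If a flip changes a selection, minimality of circuits forces its circuit to be that very hexagon
(`eq_hexTriple_of_choiceOf_ne`). The flip therefore changes one selection only, and the new pattern
must be good in both facets around the hexagon. If it is, the cone triangulation really has such a
flip (`isFlip_coneCells`). Hence the boundary is rigid exactly when every hexagon is blocked in one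
of its two facets (`isRigidBoundary_iff`). This is a finite labelling problem on the edges of the
4-cube, and an exhaustive search finds eight solutions (`ncard_isRigidChoice`).

A rigid boundary is constant on a component of the flip graph, so different ones lie in different
components. Regular triangulations form part of a single component by the usual wall-crossing
argument: along a generic segment of lifting functions the regular triangulation changes by one flip
at a time (`component_eq_of_regular`). A generic lifting and its negative select opposite parts of a
hexagon, so the regular component cannot have a constant rigid boundary. -/

/-- `d` is an affine dependence of the configuration `a`. -/
def IsDep (a : ι → E) (d : ι → ℝ) : Prop := ∑ i, d i = 0 ∧ ∑ i, d i • a i = 0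

theorem IsDep.add {a : ι → E} {d d' : ι → ℝ} (h : IsDep a d) (h' : IsDep a d') :
    IsDep a (d + d') := by
  refine ⟨?_, ?_⟩
  · simp [Finset.sum_add_distrib, h.1, h'.1]
  · simp [Finset.sum_add_distrib, add_smul, h.2, h'.2]

theorem IsDep.smul {a : ι → E} {d : ι → ℝ} (h : IsDep a d) (r : ℝ) : IsDep a (r • d) := by
  refine ⟨?_, ?_⟩
  · simp [← Finset.mul_sum, h.1]
  · simp [← smul_smul, ← Finset.smul_sum, h.2]

theorem IsDep.sub {a : ι → E} {d d' : ι → ℝ} (h : IsDep a d) (h' : IsDep a d') :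
    IsDep a (d - d') := by
  simpa [sub_eq_add_neg] using h.add (h'.smul (-1))

theorem IsDep.neg {a : ι → E} {d : ι → ℝ} (h : IsDep a d) : IsDep a (-d) := by
  simpa using h.smul (-1)

theorem IsDep.sum_affine {a : ι → E} {d : ι → ℝ} (h : IsDep a d) (g : E →ᵃ[ℝ] ℝ) :
    ∑ i, d i * g (a i) = 0 := by
  have e : ∀ x, g x = g.linear x + g 0 := fun x => by
    have := g.linearMap_vsub x 0
    simp at this
    linarith
  have : g.linear (∑ i, d i • a i) = 0 := by rw [h.2, map_zero]
  simp only [map_sum, map_smul, smul_eq_mul] at this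
  simp only [e (a _), mul_add, Finset.sum_add_distrib, ← Finset.sum_mul, h.1, this]
  simp

theorem IsDep.sum_linear {a : ι → E} {d : ι → ℝ} (h : IsDep a d) (g : E →ₗ[ℝ] ℝ) :
    ∑ i, d i * g (a i) = 0 := by
  have : g (∑ i, d i • a i) = 0 := by rw [h.2, map_zero]
  simpa only [map_sum, map_smul, smul_eq_mul] using this

/-- `c` are convex coefficients, supported on `σ`, of the point `x`. -/
structure IsRep (a : ι → E) (σ : Finset ι) (c : ι → ℝ) (x : E) : Prop where
  nonneg : ∀ i, 0 ≤ c i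
  supp : ∀ i, i ∉ σ → c i = 0
  sum_one : ∑ i, c i = 1
  sum_smul : ∑ i, c i • a i = x

theorem IsRep.mem_of_pos {a : ι → E} {σ : Finset ι} {c : ι → ℝ} {x : E} (h : IsRep a σ c x)
    {i : ι} (hi : 0 < c i) : i ∈ σ := by
  by_contra hn
  exact hi.ne' (h.supp i hn)

theorem IsRep.affine {a : ι → E} {σ : Finset ι} {c : ι → ℝ} {x : E} (h : IsRep a σ c x)
    (g : E →ᵃ[ℝ] ℝ) : g x = ∑ i, c i * g (a i) := by
  have e : ∀ x, g x = g.linear x + g 0 := fun x => by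
    have := g.linearMap_vsub x 0
    simp at this
    linarith
  simp only [e (a _), mul_add, Finset.sum_add_distrib, ← Finset.sum_mul, h.sum_one]
  rw [e x, ← h.sum_smul]
  simp

theorem IsRep.linear {a : ι → E} {σ : Finset ι} {c : ι → ℝ} {x : E} (h : IsRep a σ c x)
    (g : E →ₗ[ℝ] ℝ) : g x = ∑ i, c i * g (a i) := by
  rw [← h.sum_smul]
  simp

theorem IsRep.sub {a : ι → E} {σ σ' : Finset ι} {c c' : ι → ℝ} {x : E} (h : IsRep a σ c x)
    (h' : IsRep a σ' c' x) : IsDep a (c - c') := by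
  refine ⟨?_, ?_⟩
  · simp [h.sum_one, h'.sum_one]
  · simp [sub_smul, h.sum_smul, h'.sum_smul]

theorem mem_cellHull_iff {a : ι → E} {σ : Finset ι} {x : E} :
    x ∈ cellHull a σ ↔ ∃ c, IsRep a σ c x := by
  classical
  constructor
  · intro hx
    have hc : Convex ℝ {x | ∃ c, IsRep a σ c x} := by
      rintro x ⟨c, hc⟩ y ⟨c', hc'⟩ s t hs ht hst
      refine ⟨s • c + t • c', ?_, ?_, ?_, ?_⟩
      · intro i
        have := hc.nonneg i
        have := hc'.nonneg i
        simp only [Pi.add_apply, Pi.smul_apply, smul_eq_mul]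
        positivity
      · intro i hi
        simp [hc.supp i hi, hc'.supp i hi]
      · simp [Finset.sum_add_distrib, ← Finset.mul_sum, hc.sum_one, hc'.sum_one, hst]
      · simp [Finset.sum_add_distrib, add_smul, ← smul_smul, ← Finset.smul_sum, hc.sum_smul,
          hc'.sum_smul]
    refine convexHull_min ?_ hc hx
    rintro _ ⟨i, hi, rfl⟩
    refine ⟨Pi.single i 1, ?_, ?_, ?_, ?_⟩
    · intro j
      by_cases h : j = i
      · subst h; simp
      · simp [h]
    · intro j hj
      have : j ≠ i := fun h => hj (h ▸ hi)
      simp [this]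
    · simp
    · rw [Finset.sum_eq_single i] <;> simp +contextual
  · rintro ⟨c, hc⟩
    rw [← hc.sum_smul, ← Finset.sum_subset (Finset.subset_univ σ)
      (fun i _ hi => by simp [hc.supp i hi])]
    refine (convex_convexHull ℝ _).sum_mem (fun i _ => hc.nonneg i) ?_
      (fun i hi => subset_convexHull ℝ _ ⟨i, hi, rfl⟩)
    rw [Finset.sum_subset (Finset.subset_univ σ) (fun i _ hi => hc.supp i hi), hc.sum_one]

theorem hull_eq_cellHull_univ (a : ι → E) : hull a = cellHull a Finset.univ := by
  simp [hull, cellHull]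

theorem mem_hull_iff {a : ι → E} {x : E} : x ∈ hull a ↔ ∃ c, IsRep a Finset.univ c x := by
  rw [hull_eq_cellHull_univ, mem_cellHull_iff]

theorem IsRep.mono {a : ι → E} {σ σ' : Finset ι} {c : ι → ℝ} {x : E} (h : IsRep a σ c x)
    (hs : σ ⊆ σ') : IsRep a σ' c x :=
  ⟨h.nonneg, fun i hi => h.supp i fun h' => hi (hs h'), h.sum_one, h.sum_smul⟩

theorem cellHull_mono {a : ι → E} {σ σ' : Finset ι} (hs : σ ⊆ σ') :
    cellHull a σ ⊆ cellHull a σ' :=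
  convexHull_mono (Set.image_mono (by exact_mod_cast hs))

theorem cellHull_subset_hull (a : ι → E) (σ : Finset ι) : cellHull a σ ⊆ hull a := by
  rw [hull_eq_cellHull_univ]
  exact cellHull_mono (Finset.subset_univ σ)

theorem isIndep_iff [DecidableEq ι] {a : ι → E} {σ : Finset ι} :
    IsIndep a σ ↔ ∀ d, IsDep a d → (∀ i, i ∉ σ → d i = 0) → d = 0 := by
  unfold IsIndep
  rw [affineIndependent_iff]
  constructor
  · intro h d hd hs
    have h1 : ∀ i : σ, d i = 0 := by
      intro i
      refine h Finset.univ (fun i => d i) ?_ ?_ i (Finset.mem_univ i)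
      · rw [Finset.sum_coe_sort σ d, Finset.sum_subset (Finset.subset_univ σ)
          (fun i _ hi => hs i hi), hd.1]
      · rw [Finset.sum_coe_sort σ (fun i => d i • a i), Finset.sum_subset (Finset.subset_univ σ)
          (fun i _ hi => by simp [hs i hi]), hd.2]
    ext i
    by_cases hi : i ∈ σ
    · exact h1 ⟨i, hi⟩
    · exact hs i hi
  · intro h s w hw hw' e he
    let d : ι → ℝ := fun i => if hi : i ∈ σ then (if (⟨i, hi⟩ : σ) ∈ s then w ⟨i, hi⟩ else 0) else 0
    have key : ∀ i : σ, d i = if i ∈ s then w i else 0 := fun i => by simp [d]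
    have hz : ∀ i, i ∉ σ → d i = 0 := fun i hi => by simp [d, hi]
    have hd : d = 0 := by
      refine h d ⟨?_, ?_⟩ hz
      · rw [← Finset.sum_subset (Finset.subset_univ σ) (fun i _ hi => hz i hi),
          ← Finset.sum_coe_sort σ d]
        simp only [key, Finset.sum_ite_mem, Finset.univ_inter, hw]
      · rw [← Finset.sum_subset (Finset.subset_univ σ) (fun i _ hi => by simp [hz i hi]),
          ← Finset.sum_coe_sort σ (fun i => d i • a i)]
        simp only [key, ite_smul, zero_smul, Finset.sum_ite_mem, Finset.univ_inter, hw']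
    have := key e
    rw [hd] at this
    simpa [he] using this.symm

theorem IsIndep.mono [DecidableEq ι] {a : ι → E} {σ σ' : Finset ι} (h : IsIndep a σ')
    (hs : σ ⊆ σ') : IsIndep a σ := by
  rw [isIndep_iff] at h ⊢
  exact fun d hd h0 => h d hd fun i hi => h0 i fun h' => hi (hs h')

theorem IsIndep.rep_unique [DecidableEq ι] {a : ι → E} {σ : Finset ι} (h : IsIndep a σ)
    {c c' : ι → ℝ} {x : E} (hc : IsRep a σ c x) (hc' : IsRep a σ c' x) : c = c' :=
  sub_eq_zero.1 (isIndep_iff.1 h _ (hc.sub hc') fun i hi => by simp [hc.supp i hi, hc'.supp i hi])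

variable [DecidableEq ι]

theorem cellHull_inter_eq {a : ι → E} {σ σ' : Finset ι}
    (h : ∀ c c' x, IsRep a σ c x → IsRep a σ' c' x → c = c') :
    cellHull a σ ∩ cellHull a σ' = cellHull a (σ ∩ σ') := by
  apply subset_antisymm
  · rintro x ⟨hx, hx'⟩
    obtain ⟨c, hc⟩ := mem_cellHull_iff.1 hx
    obtain ⟨c', hc'⟩ := mem_cellHull_iff.1 hx'
    obtain rfl := h c c' x hc hc'
    refine mem_cellHull_iff.2 ⟨c, hc.nonneg, fun i hi => ?_, hc.sum_one, hc.sum_smul⟩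
    by_cases h1 : i ∈ σ
    · exact hc'.supp i fun h2 => hi (Finset.mem_inter.2 ⟨h1, h2⟩)
    · exact hc.supp i h1
  · exact Set.subset_inter (cellHull_mono Finset.inter_subset_left)
      (cellHull_mono Finset.inter_subset_right)

theorem rep_eq_of_inter {a : ι → E} {σ σ' : Finset ι} (hσ : IsIndep a σ) (hσ' : IsIndep a σ')
    (h : cellHull a σ ∩ cellHull a σ' = cellHull a (σ ∩ σ')) {c c' : ι → ℝ} {x : E}
    (hc : IsRep a σ c x) (hc' : IsRep a σ' c' x) : c = c' := by
  have : x ∈ cellHull a (σ ∩ σ') := by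
    rw [← h]
    exact ⟨mem_cellHull_iff.2 ⟨c, hc⟩, mem_cellHull_iff.2 ⟨c', hc'⟩⟩
  obtain ⟨e, he⟩ := mem_cellHull_iff.1 this
  rw [hσ.rep_unique hc (he.mono Finset.inter_subset_left),
    hσ'.rep_unique hc' (he.mono Finset.inter_subset_right)]

/-- The positive and negative parts of a non-zero dependence, scaled to total weight one, represent
the same Radon point, once in each cell. Representations in cells that meet in their common face are
equal, while the two parts have disjoint supports. -/
theorem IsDep.eq_zero_of_inter {a : ι → E} {σ σ' : Finset ι} (hσ : IsIndep a σ)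
    (hσ' : IsIndep a σ') (h : cellHull a σ ∩ cellHull a σ' = cellHull a (σ ∩ σ')) {d : ι → ℝ}
    (hd : IsDep a d) (hp : ∀ i, 0 < d i → i ∈ σ) (hn : ∀ i, d i < 0 → i ∈ σ') : d = 0 := by
  by_contra hd0
  set S := ∑ i, max (d i) 0 with hS
  have hsplit : ∀ i, max (d i) 0 - max (-d i) 0 = d i := fun i => by
    rcases le_total 0 (d i) with h | h
    · rw [max_eq_left h, max_eq_right (by linarith)]; ring
    · rw [max_eq_right h, max_eq_left (by linarith)]; ring
  have hS' : ∑ i, max (-d i) 0 = S := by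
    have := hd.1
    rw [← Finset.sum_congr rfl (fun i _ => hsplit i), Finset.sum_sub_distrib] at this
    linarith
  have hSpos : 0 < S := by
    obtain ⟨i, hi⟩ := Function.ne_iff.1 hd0
    rcases lt_or_gt_of_ne hi with h | h
    · rw [← hS']
      exact Finset.sum_pos' (fun i _ => le_max_right _ _)
        ⟨i, Finset.mem_univ i, lt_max_of_lt_left (by simpa using h)⟩
    · exact Finset.sum_pos' (fun i _ => le_max_right _ _)
        ⟨i, Finset.mem_univ i, lt_max_of_lt_left (by simpa using h)⟩
  have hc : IsRep a σ (fun i => max (d i) 0 / S) (∑ i, (max (d i) 0 / S) • a i) := by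
    refine ⟨fun i => by positivity, fun i hi => ?_, ?_, rfl⟩
    · have : d i ≤ 0 := not_lt.1 fun h => hi (hp i h)
      simp [max_eq_right this]
    · rw [← Finset.sum_div, div_self hSpos.ne']
  have hc' : IsRep a σ' (fun i => max (-d i) 0 / S) (∑ i, (max (d i) 0 / S) • a i) := by
    refine ⟨fun i => by positivity, fun i hi => ?_, ?_, ?_⟩
    · have : -d i ≤ 0 := not_lt.1 fun h => hi (hn i (by linarith))
      simp [max_eq_right this]
    · rw [← Finset.sum_div, hS', div_self hSpos.ne']
    · rw [eq_comm, ← sub_eq_zero, ← Finset.sum_sub_distrib]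
      simp only [← sub_smul, ← sub_div, hsplit]
      simp only [div_eq_inv_mul, ← smul_smul, ← Finset.smul_sum, hd.2, smul_zero]
  have e := rep_eq_of_inter hσ hσ' h hc hc'
  apply hd0
  ext i
  have := congrFun e i
  rw [div_left_inj' hSpos.ne'] at this
  have h2 := hsplit i
  simp only [Pi.zero_apply]
  linarith

theorem IsTriangulation.dep_eq_zero {a : ι → E} {T : Finset (Finset ι)} (hT : IsTriangulation a T)
    {σ σ' : Finset ι} (hσ : σ ∈ T) (hσ' : σ' ∈ T) {d : ι → ℝ} (hd : IsDep a d)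
    (hp : ∀ i, 0 < d i → i ∈ σ) (hn : ∀ i, d i < 0 → i ∈ σ') : d = 0 :=
  hd.eq_zero_of_inter (hT.indep σ hσ) (hT.indep σ' hσ') (hT.inter σ hσ σ' hσ') hp hn

theorem IsTriangulation.exists_rep {a : ι → E} {T : Finset (Finset ι)} (hT : IsTriangulation a T)
    {x : E} (hx : x ∈ hull a) : ∃ σ ∈ T, ∃ c, IsRep a σ c x := by
  rw [← hT.cover] at hx
  simp only [Set.mem_iUnion] at hx
  obtain ⟨σ, hσ, hx⟩ := hx
  exact ⟨σ, hσ, mem_cellHull_iff.1 hx⟩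

theorem range_coe_finset (a : ι → E) (σ : Finset ι) :
    Set.range (fun i : σ => a i) = a '' (σ : Set ι) :=
  (Set.image_eq_range a σ).symm

theorem card_eq_of_indep_of_spanning [FiniteDimensional ℝ E] {a : ι → E} {σ : Finset ι}
    (hi : IsIndep a σ) (hs : affineSpan ℝ (a '' (σ : Set ι)) = ⊤) :
    σ.card = Module.finrank ℝ E + 1 := by
  rw [← range_coe_finset] at hs
  simpa using (AffineIndependent.affineSpan_eq_top_iff_card_eq_finrank_add_one hi).1 hs

theorem spanning_of_indep_of_card [FiniteDimensional ℝ E] {a : ι → E} {σ : Finset ι}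
    (hi : IsIndep a σ) (hs : σ.card = Module.finrank ℝ E + 1) :
    affineSpan ℝ (a '' (σ : Set ι)) = ⊤ := by
  rw [← range_coe_finset]
  exact (AffineIndependent.affineSpan_eq_top_iff_card_eq_finrank_add_one hi).2 (by simpa using hs)

theorem indep_of_spanning_of_card [FiniteDimensional ℝ E] {a : ι → E} {σ : Finset ι}
    (hs : affineSpan ℝ (a '' (σ : Set ι)) = ⊤) (hc : σ.card = Module.finrank ℝ E + 1) :
    IsIndep a σ := by
  unfold IsIndep
  rw [affineIndependent_iff_finrank_vectorSpan_eq ℝ _ (n := Module.finrank ℝ E) (by simpa using hc),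
    range_coe_finset, ← direction_affineSpan, hs, AffineSubspace.direction_top, finrank_top]

theorem card_le_of_spanning [FiniteDimensional ℝ E] {a : ι → E} {σ : Finset ι}
    (hs : affineSpan ℝ (a '' (σ : Set ι)) = ⊤) : Module.finrank ℝ E + 1 ≤ σ.card := by
  have hne : σ.Nonempty := by
    rw [Finset.nonempty_iff_ne_empty]
    rintro rfl
    simp at hs
  obtain ⟨n, hn⟩ := Nat.exists_eq_add_of_le' (Finset.card_pos.2 hne)
  have := finrank_vectorSpan_range_le ℝ (fun i : σ => a i) (n := n) (by simpa using hn)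
  rw [range_coe_finset, ← direction_affineSpan, hs, AffineSubspace.direction_top,
    finrank_top] at this
  omega

end Dependences

/-! ### Flips: symmetry, and the faces that a flip removes or creates. -/

section Flips

variable {ι : Type*} [Fintype ι] [DecidableEq ι]
variable {E : Type*} [NormedAddCommGroup E] [NormedSpace ℝ E]

theorem IsCircuit.symm {a : ι → E} {P N : Finset ι} (h : IsCircuit a P N) : IsCircuit a N P := by
  obtain ⟨c, h1, h2, h3, h4⟩ := h.signs
  refine ⟨h.disj.symm, by rw [Finset.union_comm]; exact h.dep,
    fun S hS => h.minimal S (by rwa [Finset.union_comm]), -c, ?_, ?_, ?_, ?_⟩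
  · rw [Finset.union_comm]; simp [h1]
  · rw [Finset.union_comm]; simp [h2]
  · intro i hi; simpa using h4 i hi
  · intro i hi; simpa using h3 i hi

theorem IsCircuit.exists_dep {a : ι → E} {P N : Finset ι} (h : IsCircuit a P N) :
    ∃ d, IsDep a d ∧ (∀ i, 0 < d i ↔ i ∈ P) ∧ (∀ i, d i < 0 ↔ i ∈ N) ∧ d ≠ 0 := by
  obtain ⟨c, h1, h2, h3, h4⟩ := h.signs
  have hz : ∀ i, i ∉ P ∪ N → (if i ∈ P ∪ N then c i else 0) = 0 := fun i hi => by simp [hi]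
  refine ⟨fun i => if i ∈ P ∪ N then c i else 0, ⟨?_, ?_⟩, ?_, ?_, ?_⟩
  · simpa only [Finset.sum_ite_mem, Finset.univ_inter] using h1
  · simpa only [ite_smul, zero_smul, Finset.sum_ite_mem, Finset.univ_inter] using h2
  · intro i
    by_cases hP : i ∈ P
    · simp [hP, h3 i hP]
    · by_cases hN : i ∈ N
      · simp [hP, hN, (h4 i hN).le]
      · simp [hP, hN]
  · intro i
    by_cases hN : i ∈ N
    · simp [hN, h4 i hN]
    · by_cases hP : i ∈ P
      · simp [hP, hN, (h3 i hP).le]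
      · simp [hP, hN]
  · intro h0
    apply h.dep
    have hempty : P ∪ N = ∅ := by
      rw [Finset.eq_empty_iff_forall_notMem]
      intro i hi
      have := congrFun h0 i
      simp only [hi, if_true, Pi.zero_apply] at this
      rcases Finset.mem_union.1 hi with h | h
      · exact (h3 i h).ne' this
      · exact (h4 i h).ne this
    rw [hempty, isIndep_iff]
    intro d _ hd
    ext i
    exact hd i (by simp)

theorem IsDep.exists_pos {a : ι → E} {d : ι → ℝ} (h : IsDep a d) (h0 : d ≠ 0) : ∃ i, 0 < d i := by
  by_contra! hn
  have := (Finset.sum_eq_zero_iff_of_nonpos (fun i _ => hn i)).1 h.1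
  exact h0 (funext fun i => this i (Finset.mem_univ i))

theorem IsCircuit.nonempty_left {a : ι → E} {P N : Finset ι} (h : IsCircuit a P N) :
    P.Nonempty := by
  obtain ⟨d, hd, hP, -, h0⟩ := h.exists_dep
  obtain ⟨i, hi⟩ := hd.exists_pos h0
  exact ⟨i, (hP i).1 hi⟩

theorem IsTriangulation.not_subset_circuit {a : ι → E} {T : Finset (Finset ι)}
    (hT : IsTriangulation a T) {P N : Finset ι} (h : IsCircuit a P N) {σ σ' : Finset ι}
    (hσ : σ ∈ T) (hσ' : σ' ∈ T) (hP : P ⊆ σ) : ¬ N ⊆ σ' := by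
  obtain ⟨d, hd, hP', hN', h0⟩ := h.exists_dep
  exact fun hN => h0 (hT.dep_eq_zero hσ hσ' hd (fun i hi => hP ((hP' i).1 hi))
    fun i hi => hN ((hN' i).1 hi))

theorem mem_link {T : Finset (Finset ι)} {τ ρ : Finset ι} :
    ρ ∈ link T τ ↔ Disjoint ρ τ ∧ ρ ∪ τ ∈ T := by
  simp [link]

theorem mem_joinCells_circuit {P N : Finset ι} {L : Finset (Finset ι)} {σ : Finset ι} :
    σ ∈ joinCells L (circuitTriangulation P N) ↔
      ∃ ρ ∈ L, ∃ i ∈ P, σ = ρ ∪ (P ∪ N).erase i := by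
  simp [joinCells, circuitTriangulation, Finset.mem_image₂, eq_comm]

/-- The definition of a link gives disjointness only from the circuit without `i`. If a link element
contained `i` as well, an independent cell would contain the whole circuit. -/
theorem link_disjoint_circuit {a : ι → E} {T : Finset (Finset ι)}
    (hT : IsTriangulation a T) {P N : Finset ι} (h : IsCircuit a P N) {L : Finset (Finset ι)}
    (hL : ∀ τ ∈ circuitTriangulation P N, link T τ = L) {ρ : Finset ι} (hρ : ρ ∈ L) :
    Disjoint ρ (P ∪ N) := by
  obtain ⟨i, hi⟩ := h.nonempty_left
  rw [← hL ((P ∪ N).erase i) (Finset.mem_image_of_mem _ hi), mem_link] at hρ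
  by_cases hiρ : i ∈ ρ
  · exfalso
    refine h.dep ((hT.indep _ hρ.2).mono fun k hk => ?_)
    by_cases hki : k = i
    · exact Finset.mem_union_left _ (hki ▸ hiρ)
    · exact Finset.mem_union_right _ (Finset.mem_erase.2 ⟨hki, hk⟩)
  · rw [Finset.disjoint_left] at hρ ⊢
    intro k hk hk'
    exact hρ.1 hk (Finset.mem_erase.2 ⟨fun e => hiρ (e ▸ hk), hk'⟩)

/-- The missing element is the only element of the circuit that the union lacks, so the union
determines both it and the link element. -/
theorem join_erase_inj {C ρ ρ' : Finset ι} {i j : ι} (hj : j ∈ C)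
    (hρ : Disjoint ρ (C.erase i)) (hρ' : Disjoint ρ' C) (h : ρ ∪ C.erase i = ρ' ∪ C.erase j) :
    i = j ∧ ρ = ρ' := by
  have hij : i = j := by
    by_contra hne
    have : j ∈ ρ' ∪ C.erase j := by
      rw [← h]
      exact Finset.mem_union_right _ (Finset.mem_erase.2 ⟨fun e => hne e.symm, hj⟩)
    rcases Finset.mem_union.1 this with h1 | h1
    · exact Finset.disjoint_left.1 hρ' h1 hj
    · exact (Finset.mem_erase.1 h1).1 rfl
  subst hij
  refine ⟨rfl, ?_⟩
  have e1 := Finset.union_sdiff_cancel_right hρ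
  rw [h, Finset.union_sdiff_cancel_right
    (hρ'.mono_right (Finset.erase_subset _ _))] at e1
  exact e1.symm

/-- Every removed cell contains `N`, so no cell of `T` contains `P`, whereas every inserted cell
does. Inserted cells are thus recognised by containing `P`, and the links of the new faces see no
old cell. -/
theorem IsFlip.symm {a : ι → E} {T T' : Finset (Finset ι)} (hT : IsTriangulation a T)
    (hT' : IsTriangulation a T') (h : IsFlip a T T') : IsFlip a T' T := by
  obtain ⟨P, N, hC, L, hLne, hL, rfl⟩ := h
  set T' := T \ joinCells L (circuitTriangulation P N) ∪ joinCells L (circuitTriangulation N P)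
    with hT'def
  have hdisj : ∀ ρ ∈ L, Disjoint ρ (P ∪ N) := fun ρ hρ => link_disjoint_circuit hT hC hL hρ
  have hmem : ∀ ρ ∈ L, ∀ i ∈ P, ρ ∪ (P ∪ N).erase i ∈ T := by
    intro ρ hρ i hi
    rw [← hL ((P ∪ N).erase i) (Finset.mem_image_of_mem _ hi), mem_link] at hρ
    exact hρ.2
  have hmem' : ∀ ρ ∈ L, ∀ j ∈ N, ρ ∪ (N ∪ P).erase j ∈ T' := fun ρ hρ j hj =>
    Finset.mem_union_right _ (mem_joinCells_circuit.2 ⟨ρ, hρ, j, hj, rfl⟩)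
  have hPsub : ∀ ρ : Finset ι, ∀ j ∈ N, P ⊆ ρ ∪ (N ∪ P).erase j := by
    intro ρ j hj k hk
    refine Finset.mem_union_right _ (Finset.mem_erase.2 ⟨?_, Finset.mem_union_right _ hk⟩)
    rintro rfl
    exact Finset.disjoint_left.1 hC.disj hk hj
  have hnoP : ∀ σ ∈ T, ¬ P ⊆ σ := by
    obtain ⟨ρ, hρ⟩ := hLne
    obtain ⟨i, hi⟩ := hC.nonempty_left
    refine fun σ hσ hPσ => hT.not_subset_circuit hC hσ (hmem ρ hρ i hi) hPσ fun k hk => ?_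
    refine Finset.mem_union_right _ (Finset.mem_erase.2 ⟨?_, Finset.mem_union_right _ hk⟩)
    rintro rfl
    exact Finset.disjoint_left.1 hC.disj hi hk
  refine ⟨N, P, hC.symm, L, hLne, ?_, ?_⟩
  · intro τ hτ
    obtain ⟨j, hj, rfl⟩ := Finset.mem_image.1 hτ
    ext ρ
    rw [mem_link]
    constructor
    · rintro ⟨h1, h2⟩
      rcases Finset.mem_union.1 h2 with h2 | h2
      · exact absurd (hPsub ρ j hj) (hnoP _ (Finset.mem_sdiff.1 h2).1)
      · obtain ⟨ρ', hρ', j', hj', e⟩ := mem_joinCells_circuit.1 h2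
        rw [(join_erase_inj (Finset.mem_union_left _ hj') h1
          (by rw [Finset.union_comm]; exact hdisj ρ' hρ') e).2]
        exact hρ'
    · intro hρ
      refine ⟨?_, hmem' ρ hρ j hj⟩
      have := hdisj ρ hρ
      rw [Finset.union_comm] at this
      exact this.mono_right (Finset.erase_subset _ _)
  · ext σ
    rw [Finset.mem_union, Finset.mem_sdiff, hT'def, Finset.mem_union, Finset.mem_sdiff]
    constructor
    · intro hσ
      by_cases h1 : σ ∈ joinCells L (circuitTriangulation P N)
      · exact Or.inr h1
      · refine Or.inl ⟨Or.inl ⟨hσ, h1⟩, fun h2 => ?_⟩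
        obtain ⟨ρ, hρ, j, hj, rfl⟩ := mem_joinCells_circuit.1 h2
        exact hnoP _ hσ (hPsub ρ j hj)
    · rintro (⟨h1 | h1, h2⟩ | h1)
      · exact h1.1
      · exact absurd h1 h2
      · obtain ⟨ρ, hρ, i, hi, rfl⟩ := mem_joinCells_circuit.1 h1
        exact hmem ρ hρ i hi

theorem flipGraph_adj_iff {a : ι → E} {T T' : Triangulation a} :
    (flipGraph a).Adj T T' ↔ T ≠ T' ∧ IsFlip a T.1 T'.1 := by
  rw [flipGraph, SimpleGraph.fromRel_adj]
  constructor
  · rintro ⟨h, h1 | h1⟩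
    · exact ⟨h, h1⟩
    · exact ⟨h, h1.symm T'.2 T.2⟩
  · exact fun h => ⟨h.1, Or.inl h.2⟩

/-- If some `n ∈ N` were not in `S`, the lost cell around `S` would have a replacement omitting only
`n` from the circuit, and `S` would survive in it. -/
theorem subset_of_face_removed {T T' : Finset (Finset ι)} {P N : Finset ι}
    {L : Finset (Finset ι)}
    (hT' : T' = T \ joinCells L (circuitTriangulation P N) ∪ joinCells L (circuitTriangulation N P))
    {S σ : Finset ι} (hσ : σ ∈ T) (hS : S ⊆ σ) (hS' : ∀ σ' ∈ T', ¬ S ⊆ σ') : N ⊆ S := by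
  intro n hn
  by_contra hnS
  have h1 : σ ∈ joinCells L (circuitTriangulation P N) := by
    by_contra h1
    exact hS' σ (hT' ▸ Finset.mem_union_left _ (Finset.mem_sdiff.2 ⟨hσ, h1⟩)) hS
  obtain ⟨ρ, hρ, i, hi, rfl⟩ := mem_joinCells_circuit.1 h1
  refine hS' (ρ ∪ (N ∪ P).erase n)
    (hT' ▸ Finset.mem_union_right _ (mem_joinCells_circuit.2 ⟨ρ, hρ, n, hn, rfl⟩)) fun k hk => ?_
  rcases Finset.mem_union.1 (hS hk) with h | h
  · exact Finset.mem_union_left _ h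
  · refine Finset.mem_union_right _ (Finset.mem_erase.2 ⟨fun e => hnS (e ▸ hk), ?_⟩)
    rw [Finset.union_comm]
    exact (Finset.mem_erase.1 h).2

/-- If some `n ∈ P` were not in `S`, the old cell omitting `n` from the circuit would already
contain `S`. -/
theorem subset_of_face_added {T T' : Finset (Finset ι)} {P N : Finset ι}
    {L : Finset (Finset ι)}
    (hL : ∀ τ ∈ circuitTriangulation P N, link T τ = L)
    (hT' : T' = T \ joinCells L (circuitTriangulation P N) ∪ joinCells L (circuitTriangulation N P))
    {S σ : Finset ι} (hσ : σ ∈ T') (hS : S ⊆ σ) (hS' : ∀ σ' ∈ T, ¬ S ⊆ σ') : P ⊆ S := by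
  intro n hn
  by_contra hnS
  rw [hT', Finset.mem_union] at hσ
  rcases hσ with hσ | hσ
  · exact hS' σ (Finset.mem_sdiff.1 hσ).1 hS
  obtain ⟨ρ, hρ, i, hi, rfl⟩ := mem_joinCells_circuit.1 hσ
  rw [← hL _ (Finset.mem_image_of_mem _ hn), mem_link] at hρ
  refine hS' _ hρ.2 fun k hk => ?_
  rcases Finset.mem_union.1 (hS hk) with h | h
  · exact Finset.mem_union_left _ h
  · refine Finset.mem_union_right _ (Finset.mem_erase.2 ⟨fun e => hnS (e ▸ hk), ?_⟩)
    rw [Finset.union_comm]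
    exact (Finset.mem_erase.1 h).2

end Flips

/-! ### Regular subdivisions: covering and intersections of cells. -/

section Regular

variable {ι : Type*} [Fintype ι] [DecidableEq ι]
variable {E : Type*} [NormedAddCommGroup E] [NormedSpace ℝ E]

theorem AffineSubspace.exists_affineMap_eq_zero {S : AffineSubspace ℝ E} (hS : S ≠ ⊤) :
    ∃ h : E →ᵃ[ℝ] ℝ, (∀ x ∈ S, h x = 0) ∧ ∃ x, h x ≠ 0 := by
  rcases S.eq_bot_or_nonempty with rfl | ⟨p, hp⟩
  · exact ⟨AffineMap.const ℝ E 1, fun x hx => absurd hx (AffineSubspace.notMem_bot ℝ E x), 0,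
      by simp⟩
  · have hd : S.direction ≠ ⊤ := fun h => hS ((AffineSubspace.direction_eq_top_iff_of_nonempty
      ⟨p, hp⟩).1 h)
    obtain ⟨f, hf0, hf⟩ := Submodule.exists_le_ker_of_lt_top _ hd.lt_top
    refine ⟨f.toAffineMap - AffineMap.const ℝ E (f p), fun x hx => ?_, ?_⟩
    · have := hf (AffineSubspace.vsub_mem_direction hx hp)
      simpa using this
    · obtain ⟨y, hy⟩ : ∃ y, f y ≠ 0 := by
        by_contra! h
        exact hf0 (LinearMap.ext h)
      exact ⟨p + y, by simpa using hy⟩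

theorem affineMap_eq_zero_of_span {s : Set E} (hs : affineSpan ℝ s = ⊤) {h : E →ᵃ[ℝ] ℝ}
    (h0 : ∀ x ∈ s, h x = 0) (x : E) : h x = 0 := by
  have : affineSpan ℝ s ≤ (affineSpan ℝ {(0 : ℝ)}).comap h := by
    rw [affineSpan_le]
    intro y hy
    simp [h0 y hy]
  have h1 : x ∈ affineSpan ℝ s := by rw [hs]; trivial
  simpa using this h1

theorem affineMap_eq_of_span {s : Set E} (hs : affineSpan ℝ s = ⊤) {g g' : E →ᵃ[ℝ] ℝ}
    (h0 : ∀ x ∈ s, g x = g' x) (x : E) : g x = g' x := by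
  have := affineMap_eq_zero_of_span hs (h := g - g') (fun y hy => by simp [h0 y hy]) x
  simpa [sub_eq_zero] using this

/-- While the contact set of `g` does not span, `g` can be tilted around it without decreasing at
`x` until a new lifted point is touched. -/
theorem exists_regularCell_ge {a : ι → E} (ha : affineSpan ℝ (Set.range a) = ⊤) (w : ι → ℝ)
    {x : E} (hx : x ∈ hull a) (g : E →ᵃ[ℝ] ℝ) (hg : ∀ i, g (a i) ≤ w i) :
    ∃ g' : E →ᵃ[ℝ] ℝ, (∀ i, g' (a i) ≤ w i) ∧ g x ≤ g' x ∧
      affineSpan ℝ (a '' {i | g' (a i) = w i}) = ⊤ := by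
  classical
  induction hn : (Finset.univ.filter fun i => g (a i) ≠ w i).card using Nat.strong_induction_on
    generalizing g with
  | _ n ih =>
  by_cases hZ : affineSpan ℝ (a '' {i | g (a i) = w i}) = ⊤
  · exact ⟨g, hg, le_rfl, hZ⟩
  obtain ⟨h, hh0, y, hy⟩ := AffineSubspace.exists_affineMap_eq_zero hZ
  have hne : ∃ j, h (a j) ≠ 0 := by
    by_contra! hall
    exact hy (affineMap_eq_zero_of_span ha (by rintro _ ⟨i, rfl⟩; exact hall i) y)
  obtain ⟨c, hc⟩ := mem_hull_iff.1 hx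
  -- The sign of the tilt is chosen so that it does not decrease at `x` and is positive at some
  -- point of the configuration, so the tilting must stop.
  have hdir : ∃ h : E →ᵃ[ℝ] ℝ, (∀ i, g (a i) = w i → h (a i) = 0) ∧ 0 ≤ h x ∧
      ∃ j, 0 < h (a j) := by
    have hz : ∀ i, g (a i) = w i → h (a i) = 0 := fun i hi =>
      hh0 _ (subset_affineSpan ℝ _ ⟨i, hi, rfl⟩)
    have hpos : ∀ h : E →ᵃ[ℝ] ℝ, 0 < h x → ∃ j, 0 < h (a j) := by
      intro h hx0
      by_contra! hle
      rw [hc.affine h] at hx0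
      exact absurd hx0 (not_lt.2 (Finset.sum_nonpos fun i _ =>
        mul_nonpos_of_nonneg_of_nonpos (hc.nonneg i) (hle i)))
    rcases lt_trichotomy (h x) 0 with h1 | h1 | h1
    · have : 0 < (-h) x := by simpa using h1
      exact ⟨-h, fun i hi => by simp [hz i hi], this.le, hpos _ this⟩
    · obtain ⟨j, hj⟩ := hne
      rcases lt_or_gt_of_ne hj with hj | hj
      · exact ⟨-h, fun i hi => by simp [hz i hi], by simp [h1], j, by simpa using hj⟩
      · exact ⟨h, hz, h1.ge, j, hj⟩
    · exact ⟨h, hz, h1.le, hpos _ h1⟩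
  obtain ⟨h, hz, hx0, hj⟩ := hdir
  -- Ratio test: the minimal quotient is the largest step that keeps the function below the lifting,
  -- and it is attained at the new contact point.
  obtain ⟨j, hj, hmin⟩ := Finset.exists_min_image (Finset.univ.filter fun i => 0 < h (a i))
    (fun i => (w i - g (a i)) / h (a i)) (by obtain ⟨j, hj⟩ := hj; exact ⟨j, by simpa using hj⟩)
  simp only [Finset.mem_filter, Finset.mem_univ, true_and] at hj hmin
  set ε := (w j - g (a j)) / h (a j)
  have hε : 0 ≤ ε := div_nonneg (by linarith [hg j]) hj.le
  have hg' : ∀ i, (g + ε • h) (a i) ≤ w i := by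
    intro i
    simp only [AffineMap.coe_add, AffineMap.coe_smul, Pi.add_apply, Pi.smul_apply, smul_eq_mul]
    rcases le_or_gt (h (a i)) 0 with hi | hi
    · nlinarith [hg i, mul_nonneg hε (neg_nonneg.2 hi)]
    · have := hmin i hi
      rw [le_div_iff₀ hi] at this
      linarith
  have hcard : (Finset.univ.filter fun i => (g + ε • h) (a i) ≠ w i).card < n := by
    rw [← hn]
    apply Finset.card_lt_card
    rw [Finset.ssubset_iff_of_subset]
    · refine ⟨j, ?_, ?_⟩
      · simp only [Finset.mem_filter, Finset.mem_univ, true_and]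
        exact fun e => hj.ne' (hz j e)
      · simp only [Finset.mem_filter, Finset.mem_univ, true_and, not_not]
        simp only [AffineMap.coe_add, AffineMap.coe_smul, Pi.add_apply, Pi.smul_apply, smul_eq_mul,
          ε, div_mul_cancel₀ _ hj.ne']
        ring
    · intro i
      simp only [Finset.mem_filter, Finset.mem_univ, true_and]
      intro hi e
      exact hi (by simp [hz i e, e])
  obtain ⟨g', h1, h2, h3⟩ := ih _ hcard (g + ε • h) hg' rfl
  refine ⟨g', h1, le_trans ?_ h2, h3⟩
  simp only [AffineMap.coe_add, AffineMap.coe_smul, Pi.add_apply, Pi.smul_apply, smul_eq_mul]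
  nlinarith [mul_nonneg hε hx0]

theorem isClosed_cellHull (a : ι → E) (σ : Finset ι) : IsClosed (cellHull a σ) :=
  ((σ.finite_toSet.image a).isCompact_convexHull ℝ).isClosed

/-- The cell over `x` is the one whose supporting function is highest at `x`. If `x` were outside
it, tilting along a separating functional would give a higher one. -/
theorem exists_rep_regularCells {a : ι → E} (ha : affineSpan ℝ (Set.range a) = ⊤) (w : ι → ℝ)
    {x : E} (hx : x ∈ hull a) : ∃ σ ∈ regularCells a w, ∃ c, IsRep a σ c x := by
  classical
  have hreg : ∀ g : E →ᵃ[ℝ] ℝ, (∀ i, g (a i) ≤ w i) →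
      affineSpan ℝ (a '' {i | g (a i) = w i}) = ⊤ →
      (Finset.univ.filter fun i => g (a i) = w i) ∈ regularCells a w := by
    intro g h1 h2
    refine ⟨?_, g, h1, by simp⟩
    simpa using h2
  obtain ⟨m, hm⟩ := (Set.finite_range w).bddBelow
  obtain ⟨g₀, hg₀, -, hg₀'⟩ := exists_regularCell_ge ha w hx (AffineMap.const ℝ E m)
    (fun i => by simpa using hm ⟨i, rfl⟩)
  have hch : ∀ σ : Finset ι, ∃ g : E →ᵃ[ℝ] ℝ, σ ∈ regularCells a w →
      (∀ i, g (a i) ≤ w i) ∧ ∀ i, i ∈ σ ↔ g (a i) = w i := by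
    intro σ
    by_cases h : σ ∈ regularCells a w
    · obtain ⟨g, hg⟩ := h.2
      exact ⟨g, fun _ => hg⟩
    · exact ⟨0, fun h' => absurd h' h⟩
  choose G hG using hch
  obtain ⟨σ, hσ, hmax⟩ := Finset.exists_max_image
    (Finset.univ.filter fun σ => σ ∈ regularCells a w) (fun σ => G σ x)
    ⟨_, by simpa using hreg g₀ hg₀ hg₀'⟩
  simp only [Finset.mem_filter, Finset.mem_univ, true_and] at hσ hmax
  refine ⟨σ, hσ, ?_⟩
  rw [← mem_cellHull_iff]
  by_contra hxσ
  obtain ⟨f, u, hf, hu⟩ := geometric_hahn_banach_closed_point (convex_convexHull ℝ _)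
    (isClosed_cellHull a σ) hxσ
  -- A small tilt is admissible: on the cell the separating functional is below `u`, and off the
  -- cell there is slack.
  have hev : ∀ᶠ ε : ℝ in 𝓝[>] 0, ∀ i, G σ (a i) + ε * (f (a i) - u) ≤ w i := by
    rw [eventually_all]
    intro i
    by_cases hi : i ∈ σ
    · filter_upwards [self_mem_nhdsWithin] with ε hε
      have h1 := hf (a i) (subset_convexHull ℝ _ ⟨i, hi, rfl⟩)
      have h2 := (hG σ hσ).1 i
      have h3 : (0 : ℝ) < ε := hε
      nlinarith [mul_pos h3 (sub_pos.2 h1)]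
    · have h2 : G σ (a i) < w i :=
        lt_of_le_of_ne ((hG σ hσ).1 i) fun e => hi (((hG σ hσ).2 i).2 e)
      have hc : Tendsto (fun ε : ℝ => G σ (a i) + ε * (f (a i) - u)) (𝓝[>] 0)
          (𝓝 (G σ (a i) + 0 * (f (a i) - u))) :=
        (Continuous.tendsto (by fun_prop) _).mono_left nhdsWithin_le_nhds
      rw [zero_mul, add_zero] at hc
      exact (hc.eventually (gt_mem_nhds h2)).mono fun ε hε => hε.le
  obtain ⟨ε, hε, hε0⟩ := (hev.and self_mem_nhdsWithin).exists
  obtain ⟨g', h1, h2, h3⟩ := exists_regularCell_ge ha w hx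
    (G σ + ε • ((f : E →ₗ[ℝ] ℝ).toAffineMap - AffineMap.const ℝ E u))
    (fun i => by simpa using hε i)
  have h4 := hmax _ (hreg g' h1 h3)
  have h5 : G (Finset.univ.filter fun i => g' (a i) = w i) x = g' x := by
    refine affineMap_eq_of_span h3 ?_ x
    rintro _ ⟨i, hi, rfl⟩
    rw [hi]
    exact ((hG _ (hreg g' h1 h3)).2 i).1 (by simpa using hi)
  rw [h5] at h4
  have h6 : (0 : ℝ) < ε := hε0
  have h7 : ε * (f x - u) ≤ 0 := by
    have := h2.trans h4
    simp at this
    simpa using this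
  nlinarith [mul_pos h6 (sub_pos.2 hu)]

/-- The cells of a regular subdivision meet in common faces: representations are compatible. -/
theorem regularCells_rep_mem {a : ι → E} {w : ι → ℝ} {σ σ' : Finset ι}
    (hσ : σ ∈ regularCells a w) (hσ' : σ' ∈ regularCells a w) {c c' : ι → ℝ} {x : E}
    (hc : IsRep a σ c x) (hc' : IsRep a σ' c' x) : IsRep a (σ ∩ σ') c x := by
  obtain ⟨-, g, hg, hgσ⟩ := hσ
  obtain ⟨-, g', hg', hgσ'⟩ := hσ'
  have e1 : g x = ∑ i, c i * w i := by
    rw [hc.affine g]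
    refine Finset.sum_congr rfl fun i _ => ?_
    by_cases hi : i ∈ σ
    · rw [(hgσ i).1 hi]
    · simp [hc.supp i hi]
  have e2 : g' x = ∑ i, c' i * w i := by
    rw [hc'.affine g']
    refine Finset.sum_congr rfl fun i _ => ?_
    by_cases hi : i ∈ σ'
    · rw [(hgσ' i).1 hi]
    · simp [hc'.supp i hi]
  have e3 : g x ≤ g' x := by
    rw [hc'.affine g, e2]
    exact Finset.sum_le_sum fun i _ => mul_le_mul_of_nonneg_left (hg i) (hc'.nonneg i)
  have e4 : ∑ i, c i * (w i - g' (a i)) = 0 := by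
    have h1 : 0 ≤ ∑ i, c i * (w i - g' (a i)) := Finset.sum_nonneg fun i _ =>
      mul_nonneg (hc.nonneg i) (sub_nonneg.2 (hg' i))
    have h2 : ∑ i, c i * (w i - g' (a i)) = g x - g' x := by
      rw [e1, hc.affine g', ← Finset.sum_sub_distrib]
      simp [mul_sub]
    linarith
  rw [Finset.sum_eq_zero_iff_of_nonneg fun i _ =>
    mul_nonneg (hc.nonneg i) (sub_nonneg.2 (hg' i))] at e4
  refine ⟨hc.nonneg, fun i hi => ?_, hc.sum_one, hc.sum_smul⟩
  by_cases h1 : i ∈ σ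
  · have h2 : i ∉ σ' := fun h2 => hi (Finset.mem_inter.2 ⟨h1, h2⟩)
    rcases mul_eq_zero.1 (e4 i (Finset.mem_univ i)) with h | h
    · exact h
    · exact absurd ((hgσ' i).2 (by linarith)) h2
  · exact hc.supp i h1

theorem isTriangulation_of_regularCells {a : ι → E} (ha : affineSpan ℝ (Set.range a) = ⊤)
    {w : ι → ℝ} {T : Finset (Finset ι)} (hT : (T : Set (Finset ι)) = regularCells a w)
    (hi : ∀ σ ∈ T, IsIndep a σ) : IsTriangulation a T := by
  have hmem : ∀ σ, σ ∈ T ↔ σ ∈ regularCells a w := fun σ => by rw [← hT]; simp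
  refine ⟨hi, fun σ hσ => ((hmem σ).1 hσ).1, fun σ hσ σ' hσ' => ?_, ?_⟩
  · refine cellHull_inter_eq fun c c' x hc hc' => ?_
    have h1 := regularCells_rep_mem ((hmem σ).1 hσ) ((hmem σ').1 hσ') hc hc'
    exact (hi σ' hσ').rep_unique (h1.mono Finset.inter_subset_right) hc'
  · apply subset_antisymm
    · exact Set.iUnion₂_subset fun σ _ => cellHull_subset_hull a σ
    · intro x hx
      obtain ⟨σ, hσ, c, hc⟩ := exists_rep_regularCells ha w hx
      exact Set.mem_iUnion₂.2 ⟨σ, (hmem σ).2 hσ, mem_cellHull_iff.2 ⟨c, hc⟩⟩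

end Regular

/-! ### Wall crossing: regular subdivisions near a lifting with one flat dependence. -/

section RegularFlips

variable {ι : Type*} [Fintype ι] [DecidableEq ι]
variable {E : Type*} [NormedAddCommGroup E] [NormedSpace ℝ E]

/-- The points of `a` with labels in `ρ` form an affine basis. -/
structure IsAffBasis (a : ι → E) (ρ : Finset ι) : Prop where
  indep : IsIndep a ρ
  spanning : affineSpan ℝ (a '' (ρ : Set ι)) = ⊤

theorem span_erase {a : ι → E} {ρ : Finset ι} (hs : affineSpan ℝ (a '' (ρ : Set ι)) = ⊤)
    {d : ι → ℝ} (hd : IsDep a d) (hρ : ∀ i, i ∉ ρ → d i = 0) {k : ι} (hk : d k ≠ 0) :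
    affineSpan ℝ (a '' (ρ.erase k : Set ι)) = ⊤ := by
  by_contra hne
  obtain ⟨h, h0, y, hy⟩ := AffineSubspace.exists_affineMap_eq_zero hne
  have hz : ∀ i ∈ ρ, i ≠ k → h (a i) = 0 := fun i hi hik =>
    h0 _ (subset_affineSpan ℝ _ ⟨i, by simp [hi, hik], rfl⟩)
  have hs' := hd.sum_affine h
  rw [Finset.sum_eq_single k] at hs'
  · have hk0 : h (a k) = 0 := (mul_eq_zero.1 hs').resolve_left hk
    refine hy (affineMap_eq_zero_of_span hs ?_ y)
    rintro _ ⟨i, hi, rfl⟩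
    by_cases hik : i = k
    · exact hik ▸ hk0
    · exact hz i hi hik
  · intro i _ hik
    by_cases hi : i ∈ ρ
    · rw [hz i hi hik, mul_zero]
    · rw [hρ i hi, zero_mul]
  · simp

theorem exists_isAffBasis_subset {a : ι → E} {Z : Finset ι}
    (hs : affineSpan ℝ (a '' (Z : Set ι)) = ⊤) : ∃ ρ ⊆ Z, IsAffBasis a ρ := by
  classical
  obtain ⟨ρ, hρ, hmin⟩ := Finset.exists_min_image
    (Z.powerset.filter fun ρ : Finset ι => affineSpan ℝ (a '' (ρ : Set ι)) = ⊤) Finset.card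
    ⟨Z, by simpa using hs⟩
  simp only [Finset.mem_filter, Finset.mem_powerset] at hρ hmin
  refine ⟨ρ, hρ.1, isIndep_iff.2 fun d hd h0 => ?_, hρ.2⟩
  by_contra hne
  obtain ⟨k, hk⟩ := Function.ne_iff.1 hne
  have hk' : k ∈ ρ := by
    by_contra h
    exact hk (h0 k h)
  have := hmin (ρ.erase k) ⟨(Finset.erase_subset _ _).trans hρ.1, span_erase hρ.2 hd h0 hk⟩
  exact absurd (Finset.card_erase_lt_of_mem hk') (not_lt.2 this)

theorem IsAffBasis.exists_dep {a : ι → E} {ρ : Finset ι} (h : IsAffBasis a ρ) {k : ι}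
    (hk : k ∉ ρ) : ∃ d, IsDep a d ∧ d k = 1 ∧ ∀ i, i ∉ insert k ρ → d i = 0 := by
  have hmem : a k ∈ affineSpan ℝ (Set.range fun i : ρ => a i) := by
    rw [range_coe_finset, h.spanning]
    trivial
  obtain ⟨w, hw, he⟩ := eq_affineCombination_of_mem_affineSpan_of_fintype hmem
  rw [Finset.affineCombination_eq_linear_combination _ _ _ hw] at he
  let e : ι → ℝ := fun i => if hi : i ∈ ρ then w ⟨i, hi⟩ else 0
  have hek : e k = 0 := by simp [e, hk]
  have hes : ∑ i, e i = 1 := by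
    rw [← Finset.sum_subset (Finset.subset_univ ρ) (fun i _ hi => by simp [e, hi]),
      ← Finset.sum_coe_sort ρ e, ← hw]
    exact Finset.sum_congr rfl fun i _ => by simp [e]
  have hea : ∑ i, e i • a i = a k := by
    rw [← Finset.sum_subset (Finset.subset_univ ρ) (fun i _ hi => by simp [e, hi]),
      ← Finset.sum_coe_sort ρ (fun i => e i • a i), he]
    exact Finset.sum_congr rfl fun i _ => by simp [e]
  refine ⟨Pi.single k 1 - e, ⟨?_, ?_⟩, by simp [hek], ?_⟩
  · simp [hes]
  · simp only [Pi.sub_apply, sub_smul, Finset.sum_sub_distrib, hea]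
    rw [Finset.sum_eq_single k] <;> simp +contextual
  · intro i hi
    simp only [Finset.mem_insert, not_or] at hi
    simp [e, hi.1, hi.2]

open Classical in
/-- The dependence supported on `insert k ρ` with coefficient `1` at `k`. -/
noncomputable def fundDep (a : ι → E) (ρ : Finset ι) (k : ι) : ι → ℝ :=
  if h : ∃ d, IsDep a d ∧ d k = 1 ∧ ∀ i, i ∉ insert k ρ → d i = 0 then h.choose else 0

theorem IsAffBasis.fundDep_spec {a : ι → E} {ρ : Finset ι} (h : IsAffBasis a ρ) {k : ι}
    (hk : k ∉ ρ) : IsDep a (fundDep a ρ k) ∧ fundDep a ρ k k = 1 ∧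
      ∀ i, i ∉ insert k ρ → fundDep a ρ k i = 0 := by
  have := h.exists_dep hk
  rw [fundDep, dif_pos this]
  exact this.choose_spec

theorem IsAffBasis.eq_smul_fundDep {a : ι → E} {ρ : Finset ι} (h : IsAffBasis a ρ) {k : ι}
    (hk : k ∉ ρ) {d : ι → ℝ} (hd : IsDep a d) (h0 : ∀ i, i ∉ insert k ρ → d i = 0) :
    d = d k • fundDep a ρ k := by
  obtain ⟨h1, h2, h3⟩ := h.fundDep_spec hk
  rw [← sub_eq_zero]
  refine isIndep_iff.1 h.indep _ (hd.sub (h1.smul _)) fun i hi => ?_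
  by_cases hik : i = k
  · subst hik; simp [h2]
  · have : i ∉ insert k ρ := by simp [hi, hik]
    simp [h0 i this, h3 i this]

theorem IsAffBasis.exists_interpolation {a : ι → E} {ρ : Finset ι} (h : IsAffBasis a ρ)
    (w : ι → ℝ) : ∃ g : E →ᵃ[ℝ] ℝ, ∀ i ∈ ρ, g (a i) = w i := by
  let b : AffineBasis ρ ℝ E := ⟨fun i => a i, h.indep, by rw [range_coe_finset]; exact h.spanning⟩
  refine ⟨∑ i : ρ, w i • b.coord i, fun i hi => ?_⟩
  have hb : a i = b ⟨i, hi⟩ := rfl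
  have : ∀ (s : Finset ρ) (x : E), (∑ i ∈ s, w i • b.coord i) x = ∑ i ∈ s, w i * b.coord i x := by
    intro s x
    induction s using Finset.induction_on with
    | empty => simp
    | insert j s hj ih => rw [Finset.sum_insert hj, Finset.sum_insert hj]; simp [ih]
  rw [hb, this, Finset.sum_eq_single ⟨i, hi⟩]
  · simp
  · intro j _ hj
    rw [AffineBasis.coord_apply_ne b hj, mul_zero]
  · simp

/-- The height of the lifted point `k` above the hyperplane spanned by the lifting of `ρ`. -/
noncomputable def excess (a : ι → E) (ρ : Finset ι) (k : ι) (w : ι → ℝ) : ℝ :=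
  ∑ i, fundDep a ρ k i * w i

theorem IsAffBasis.excess_eq {a : ι → E} {ρ : Finset ι} (h : IsAffBasis a ρ) {k : ι}
    (hk : k ∉ ρ) {w : ι → ℝ} {g : E →ᵃ[ℝ] ℝ} (hg : ∀ i ∈ ρ, g (a i) = w i) :
    excess a ρ k w = w k - g (a k) := by
  obtain ⟨h1, h2, h3⟩ := h.fundDep_spec hk
  have h4 := h1.sum_affine g
  have : excess a ρ k w = ∑ i, fundDep a ρ k i * (w i - g (a i)) := by
    simp only [mul_sub, Finset.sum_sub_distrib, h4, sub_zero, excess]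
  rw [this, Finset.sum_eq_single k]
  · rw [h2, one_mul]
  · intro i _ hik
    by_cases hi : i ∈ ρ
    · rw [hg i hi, sub_self, mul_zero]
    · rw [h3 i (by simp [hik, hi]), zero_mul]
  · simp

theorem excess_of_regular {a : ι → E} {w : ι → ℝ} {Z : Finset ι} (hZ : Z ∈ regularCells a w)
    {ρ : Finset ι} (hρ : IsAffBasis a ρ) (hρZ : ρ ⊆ Z) {k : ι} (hk : k ∉ ρ) :
    0 ≤ excess a ρ k w ∧ (k ∈ Z ↔ excess a ρ k w = 0) := by
  obtain ⟨-, g, hg, hgZ⟩ := hZ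
  rw [hρ.excess_eq hk (fun i hi => (hgZ i).1 (hρZ hi)), hgZ]
  exact ⟨sub_nonneg.2 (hg k), by rw [sub_eq_zero, eq_comm]⟩

theorem exists_regular_of_excess {a : ι → E} {w : ι → ℝ} {ρ : Finset ι} (hρ : IsAffBasis a ρ)
    (h : ∀ k, k ∉ ρ → 0 ≤ excess a ρ k w) :
    ∃ Z ∈ regularCells a w, ρ ⊆ Z ∧ ∀ k, k ∉ ρ → (k ∈ Z ↔ excess a ρ k w = 0) := by
  classical
  obtain ⟨g, hg⟩ := hρ.exists_interpolation w
  have hle : ∀ i, g (a i) ≤ w i := by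
    intro i
    by_cases hi : i ∈ ρ
    · exact (hg i hi).le
    · have := h i hi
      rw [hρ.excess_eq hi hg] at this
      linarith
  have hsub : ρ ⊆ Finset.univ.filter fun i => g (a i) = w i := fun i hi => by simp [hg i hi]
  refine ⟨Finset.univ.filter fun i => g (a i) = w i, ⟨?_, g, hle, by simp⟩, hsub, ?_⟩
  · rw [eq_top_iff, ← hρ.spanning]
    exact affineSpan_mono ℝ (Set.image_mono (by exact_mod_cast hsub))
  · intro k hk
    rw [hρ.excess_eq hk hg, sub_eq_zero]
    simp [eq_comm]

/-- No lifted point lies on a hyperplane spanned by other ones in an unexpected way. -/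
def IsGenericLift (a : ι → E) (w : ι → ℝ) : Prop :=
  ∀ ρ, IsAffBasis a ρ → ∀ k, k ∉ ρ → excess a ρ k w ≠ 0

/-- All strict sides of the lifted points at `w₀` persist at `w`. -/
def IsNearLift (a : ι → E) (w₀ w : ι → ℝ) : Prop :=
  ∀ ρ, IsAffBasis a ρ → ∀ k, k ∉ ρ →
    (0 < excess a ρ k w₀ → 0 < excess a ρ k w) ∧ (excess a ρ k w₀ < 0 → excess a ρ k w < 0)

theorem continuous_excess (a : ι → E) (ρ : Finset ι) (k : ι) : Continuous (excess a ρ k) := by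
  unfold excess
  fun_prop

theorem eventually_isNearLift (a : ι → E) (w₀ : ι → ℝ) : ∀ᶠ w in 𝓝 w₀, IsNearLift a w₀ w := by
  unfold IsNearLift
  rw [eventually_all]
  intro ρ
  by_cases hρ : IsAffBasis a ρ
  · have : ∀ᶠ w in 𝓝 w₀, ∀ k, k ∉ ρ → (0 < excess a ρ k w₀ → 0 < excess a ρ k w) ∧
        (excess a ρ k w₀ < 0 → excess a ρ k w < 0) := by
      rw [eventually_all]
      intro k
      have hc := (continuous_excess a ρ k).tendsto w₀
      rcases lt_trichotomy (excess a ρ k w₀) 0 with h | h | h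
      · filter_upwards [hc.eventually (gt_mem_nhds h)] with w hw _
        exact ⟨fun h' => absurd h' h.not_gt, fun _ => hw⟩
      · filter_upwards with w _
        simp [h]
      · filter_upwards [hc.eventually (lt_mem_nhds h)] with w hw _
        exact ⟨fun _ => hw, fun h' => absurd h' h.not_gt⟩
    exact this.mono fun w hw _ => hw
  · exact Eventually.of_forall fun w h => absurd h hρ

theorem IsGenericLift.isAffBasis {a : ι → E} {w : ι → ℝ} (hw : IsGenericLift a w) {σ : Finset ι}
    (hσ : σ ∈ regularCells a w) : IsAffBasis a σ := by
  obtain ⟨ρ, hρσ, hρ⟩ := exists_isAffBasis_subset hσ.1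
  have : ρ = σ := by
    refine hρσ.antisymm fun k hk => ?_
    by_contra hk'
    exact hw ρ hρ k hk' ((excess_of_regular hσ hρ hρσ hk').2.1 hk)
  exact this ▸ hρ

theorem exists_regular_superset_of_near {a : ι → E} {w₀ w : ι → ℝ} (hw : IsGenericLift a w)
    (hn : IsNearLift a w₀ w) {σ : Finset ι} (hσ : σ ∈ regularCells a w) :
    ∃ Z ∈ regularCells a w₀, σ ⊆ Z ∧ ∀ k, k ∉ σ → (k ∈ Z ↔ excess a σ k w₀ = 0) := by
  have hb := hw.isAffBasis hσ
  refine exists_regular_of_excess hb fun k hk => ?_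
  by_contra! h
  exact absurd (excess_of_regular hσ hb subset_rfl hk).1 (not_le.2 ((hn σ hb k hk).2 h))

theorem mem_regularCells_of_excess_pos {a : ι → E} {w : ι → ℝ} {σ : Finset ι}
    (hσ : IsAffBasis a σ) (h : ∀ k, k ∉ σ → 0 < excess a σ k w) : σ ∈ regularCells a w := by
  obtain ⟨Z, hZ, hσZ, hk⟩ := exists_regular_of_excess hσ fun k hk => (h k hk).le
  have : σ = Z := by
    refine hσZ.antisymm fun k hkZ => ?_
    by_contra hkσ
    exact (h k hkσ).ne' ((hk k hkσ).1 hkZ)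
  exact this ▸ hZ

theorem mem_regularCells_of_near {a : ι → E} {w₀ w : ι → ℝ} (hn : IsNearLift a w₀ w)
    {σ : Finset ι} (hσ : σ ∈ regularCells a w₀) (hi : IsIndep a σ) : σ ∈ regularCells a w := by
  have hb : IsAffBasis a σ := ⟨hi, hσ.1⟩
  refine mem_regularCells_of_excess_pos hb fun k hk => (hn σ hb k hk).1 ?_
  obtain ⟨h1, h2⟩ := excess_of_regular hσ hb subset_rfl hk
  exact lt_of_le_of_ne h1 fun h => hk (h2.2 h.symm)

/-- A cell after perturbation lies in a cell before it. If the latter were larger, an affine basis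
and one more point would be independent, which is impossible. -/
theorem regularCells_eq_of_near {a : ι → E} {w₀ w : ι → ℝ} (hw : IsGenericLift a w)
    (hn : IsNearLift a w₀ w) (h0 : ∀ σ ∈ regularCells a w₀, IsIndep a σ) :
    regularCells a w = regularCells a w₀ := by
  ext σ
  constructor
  · intro hσ
    obtain ⟨Z, hZ, hσZ, -⟩ := exists_regular_superset_of_near hw hn hσ
    have hZw := mem_regularCells_of_near hn hZ (h0 Z hZ)
    have : σ = Z := by
      refine hσZ.antisymm fun k hkZ => ?_
      by_contra hkσ
      have hb := hw.isAffBasis hσ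
      obtain ⟨d, hd, hd1, hd2⟩ := hb.exists_dep hkσ
      have := isIndep_iff.1 (h0 Z hZ) d hd fun i hi => hd2 i fun h => hi (by
        rcases Finset.mem_insert.1 h with rfl | h
        · exact hkZ
        · exact hσZ h)
      rw [this] at hd1
      simp at hd1
    exact this ▸ hZ
  · exact fun hσ => mem_regularCells_of_near hn hσ (h0 σ hσ)

/-- The structure of the regular triangulations close to a lifting for which only the dependence
`d` (up to multiples) is flat. -/
theorem mem_regularCells_near_iff [FiniteDimensional ℝ E] {a : ι → E} {w₀ w : ι → ℝ} {d : ι → ℝ}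
    (hd : IsDep a d)
    (hs : ∀ ρ, IsAffBasis a ρ → ∀ k, k ∉ ρ → excess a ρ k w₀ = 0 → ∃ r : ℝ, fundDep a ρ k = r • d)
    (hw : IsGenericLift a w) (hn : IsNearLift a w₀ w) (hpos : 0 < ∑ i, d i * w i) (σ : Finset ι) :
    σ ∈ regularCells a w ↔ (σ ∈ regularCells a w₀ ∧ IsIndep a σ) ∨
      ∃ ρ, Disjoint ρ (Finset.univ.filter fun i => d i ≠ 0) ∧
        ρ ∪ (Finset.univ.filter fun i => d i ≠ 0) ∈ regularCells a w₀ ∧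
        ∃ i, 0 < d i ∧ σ = ρ ∪ (Finset.univ.filter fun i => d i ≠ 0).erase i := by
  set C := Finset.univ.filter fun i => d i ≠ 0 with hC
  have hmemC : ∀ i, i ∈ C ↔ d i ≠ 0 := fun i => by simp [hC]
  have hexc : ∀ ρ k (r : ℝ) v, fundDep a ρ k = r • d → excess a ρ k v = r * ∑ i, d i * v i := by
    intro ρ k r v h
    simp [excess, h, Finset.mul_sum, mul_assoc]
  -- Two different flat labels over one basis would have proportional fundamental dependences, but
  -- each of these is one at its own label and zero at the other.
  have huniq : ∀ ρ, IsAffBasis a ρ → ∀ k k', k ∉ ρ → k' ∉ ρ → excess a ρ k w₀ = 0 →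
      excess a ρ k' w₀ = 0 → k = k' := by
    intro ρ hρ k k' hk hk' h h'
    by_contra hne
    obtain ⟨r, hr⟩ := hs ρ hρ k hk h
    obtain ⟨r', hr'⟩ := hs ρ hρ k' hk' h'
    have e1 := (hρ.fundDep_spec hk).2.2 k' (by simp [hk', Ne.symm hne])
    have e2 := (hρ.fundDep_spec hk').2.1
    have e3 := (hρ.fundDep_spec hk).2.1
    rw [hr] at e1 e3
    rw [hr'] at e2
    simp only [Pi.smul_apply, smul_eq_mul] at e1 e2 e3
    rcases mul_eq_zero.1 e1 with h | h
    · simp [h] at e3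
    · simp [h] at e2
  constructor
  · intro hσ
    have hb := hw.isAffBasis hσ
    obtain ⟨Z, hZ, hσZ, hk⟩ := exists_regular_superset_of_near hw hn hσ
    by_cases hZσ : Z ⊆ σ
    · obtain rfl := hσZ.antisymm hZσ
      exact Or.inl ⟨hZ, hb.indep⟩
    right
    obtain ⟨k, hkZ, hkσ⟩ := Finset.not_subset.1 hZσ
    have hk0 := (hk k hkσ).1 hkZ
    obtain ⟨r, hr⟩ := hs σ hb k hkσ hk0
    obtain ⟨f1, f2, f3⟩ := hb.fundDep_spec hkσ
    have hZeq : Z = insert k σ := by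
      ext j
      constructor
      · intro hj
        by_cases hjσ : j ∈ σ
        · exact Finset.mem_insert_of_mem hjσ
        · rw [huniq σ hb j k hjσ hkσ ((hk j hjσ).1 hj) hk0]
          exact Finset.mem_insert_self _ _
      · intro hj
        rcases Finset.mem_insert.1 hj with rfl | hj
        · exact hkZ
        · exact hσZ hj
    have hrk : r * d k = 1 := by rw [← f2, hr]; simp
    have hr0 : r ≠ 0 := by rintro rfl; simp at hrk
    have hCZ : C ⊆ Z := by
      intro j hj
      rw [hZeq]
      by_contra hj'
      have := f3 j hj'
      rw [hr] at this
      simp [hr0, (hmemC j).1 hj] at this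
    have hkC : k ∈ C := (hmemC k).2 fun h => by simp [h] at hrk
    -- The excess of `k` over the cell is `r` times the positive value of `d` on the lifting. It is
    -- non-negative by regularity and non-zero by genericity.
    have hrpos : 0 < r := by
      have h1 := (excess_of_regular hσ hb subset_rfl hkσ).1
      have h2 := hw σ hb k hkσ
      rw [hexc σ k r w hr] at h1 h2
      rcases lt_or_ge 0 r with h | h
      · exact h
      · exact absurd (le_antisymm (mul_nonpos_of_nonpos_of_nonneg h hpos.le) h1) h2
    refine ⟨Z \ C, Finset.sdiff_disjoint, ?_, k, ?_, ?_⟩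
    · rwa [Finset.sdiff_union_of_subset hCZ]
    · by_contra! h
      nlinarith [mul_nonneg hrpos.le (neg_nonneg.2 h)]
    · have e : σ = Z.erase k := by rw [hZeq, Finset.erase_insert hkσ]
      rw [e]
      ext j
      simp only [Finset.mem_erase, Finset.mem_union, Finset.mem_sdiff]
      constructor
      · rintro ⟨h1, h2⟩
        by_cases hj : j ∈ C
        · exact Or.inr ⟨h1, hj⟩
        · exact Or.inl ⟨h2, hj⟩
      · rintro (⟨h1, h2⟩ | ⟨h1, h2⟩)
        · exact ⟨fun e => h2 (e ▸ hkC), h1⟩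
        · exact ⟨h1, hCZ h2⟩
  · rintro (⟨hσ, hi⟩ | ⟨ρ, hdisj, hZ, i, hi, rfl⟩)
    · exact mem_regularCells_of_near hn hσ hi
    have hiC : i ∈ C := (hmemC i).2 hi.ne'
    have hiρ : i ∉ ρ := fun h => Finset.disjoint_left.1 hdisj h hiC
    have hσe : ρ ∪ C.erase i = (ρ ∪ C).erase i := by
      rw [Finset.erase_union_distrib, Finset.erase_eq_of_notMem hiρ]
    have hdZ : ∀ j, j ∉ ρ ∪ C → d j = 0 := by
      intro j hj
      by_contra h
      exact hj (Finset.mem_union_right _ ((hmemC j).2 h))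
    have hspan : affineSpan ℝ (a '' ((ρ ∪ C).erase i : Set ι)) = ⊤ :=
      span_erase hZ.1 hd hdZ hi.ne'
    obtain ⟨β, hβZ, hβ⟩ := exists_isAffBasis_subset hZ.1
    -- A flat cell of `w₀` exceeds an affine basis by exactly one label, since it contains the
    -- support of `d` and the flat label is unique.
    have hcard : ((ρ ∪ C).erase i).card = Module.finrank ℝ E + 1 := by
      have h1 := card_eq_of_indep_of_spanning hβ.indep hβ.spanning
      have h2 : ∃ k ∈ ρ ∪ C, k ∉ β := by
        by_contra! h
        have : β = ρ ∪ C := hβZ.antisymm h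
        have h0 := isIndep_iff.1 hβ.indep d hd fun j hj => hdZ j (this ▸ hj)
        simp [h0] at hi
      obtain ⟨k, hk, hkβ⟩ := h2
      have h3 : ρ ∪ C = insert k β := by
        refine Finset.Subset.antisymm (fun j hj => ?_) (Finset.insert_subset hk hβZ)
        by_cases hjβ : j ∈ β
        · exact Finset.mem_insert_of_mem hjβ
        · rw [huniq β hβ j k hjβ hkβ ((excess_of_regular hZ hβ hβZ hjβ).2.1 hj)
            ((excess_of_regular hZ hβ hβZ hkβ).2.1 hk)]
          exact Finset.mem_insert_self _ _
      rw [Finset.card_erase_of_mem (Finset.mem_union_right _ hiC), h3,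
        Finset.card_insert_of_notMem hkβ, h1, Nat.add_sub_cancel]
    have hb : IsAffBasis a (ρ ∪ C.erase i) := by
      rw [hσe]
      refine ⟨indep_of_spanning_of_card ?_ hcard, ?_⟩ <;> simpa using hspan
    have hsub : ρ ∪ C.erase i ⊆ ρ ∪ C := by rw [hσe]; exact Finset.erase_subset _ _
    refine mem_regularCells_of_excess_pos hb fun k hk => ?_
    by_cases hki : k = i
    · subst hki
      have e := hb.eq_smul_fundDep hk hd fun j hj => hdZ j fun h => hj (by
        rw [hσe, Finset.insert_erase (Finset.mem_union_right _ hiC)]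
        exact h)
      have e' : fundDep a (ρ ∪ C.erase k) k = (d k)⁻¹ • d := by
        rw [eq_inv_smul_iff₀ hi.ne']
        exact e.symm
      rw [hexc _ _ _ _ e']
      positivity
    · refine (hn _ hb k hk).1 ?_
      obtain ⟨h1, h2⟩ := excess_of_regular hZ hb hsub hk
      refine lt_of_le_of_ne h1 fun h => hk ?_
      have := h2.2 h.symm
      rw [hσe]
      exact Finset.mem_erase.2 ⟨hki, this⟩

end RegularFlips

/-! ### Connectedness of the regular triangulations under flips. -/

section RegularConnected

variable {ι : Type*} [Fintype ι] [DecidableEq ι]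
variable {E : Type*} [NormedAddCommGroup E] [NormedSpace ℝ E]

theorem filter_pos_union_neg (d : ι → ℝ) :
    (Finset.univ.filter fun i => 0 < d i) ∪ (Finset.univ.filter fun i => d i < 0) =
      Finset.univ.filter fun i => d i ≠ 0 := by
  ext i
  simp only [Finset.mem_union, Finset.mem_filter, Finset.mem_univ, true_and]
  rw [or_comm, ← lt_or_lt_iff_ne]

theorem isCircuit_of_dep {a : ι → E} {d : ι → ℝ} (hd : IsDep a d) (h0 : d ≠ 0)
    (hmin : ∀ d', IsDep a d' → (∀ i, d i = 0 → d' i = 0) → ∃ r : ℝ, d' = r • d) :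
    IsCircuit a (Finset.univ.filter fun i => 0 < d i) (Finset.univ.filter fun i => d i < 0) := by
  refine ⟨?_, ?_, ?_, d, ?_, ?_, ?_, ?_⟩
  · rw [Finset.disjoint_filter]
    exact fun i _ h => h.not_gt
  · rw [filter_pos_union_neg, isIndep_iff]
    intro h
    exact h0 (h d hd fun i hi => by simpa using hi)
  · intro S hS
    rw [filter_pos_union_neg] at hS
    rw [isIndep_iff]
    intro d' hd' hs
    obtain ⟨i, hi, hiS⟩ := Finset.exists_of_ssubset hS
    obtain ⟨r, rfl⟩ := hmin d' hd' fun j hj => hs j fun hjS => by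
      simpa [hj] using hS.1 hjS
    have h1 := hs i hiS
    simp only [Finset.mem_filter, Finset.mem_univ, true_and] at hi
    rcases mul_eq_zero.1 h1 with h | h
    · simp [h]
    · exact absurd h hi
  · rw [filter_pos_union_neg, Finset.sum_filter_of_ne (fun i _ h => h), hd.1]
  · rw [filter_pos_union_neg, Finset.sum_filter_of_ne (fun i _ h => ?_), hd.2]
    exact fun h' => h (by rw [h', zero_smul])
  · intro i hi; simpa using hi
  · intro i hi; simpa using hi

variable [FiniteDimensional ℝ E]

/-- At the wall, the flat cells are those containing the circuit `C`, and the sets completing `C` to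
such a cell form the common link. On the two sides of the wall `C` is triangulated in its two ways,
and all other cells persist. Without flat cells nothing changes. -/
theorem isFlip_of_near {a : ι → E} {w₀ w₁ w₂ : ι → ℝ} {d : ι → ℝ}
    (hd : IsDep a d) (hdw₀ : ∑ i, d i * w₀ i = 0)
    (hmin : ∀ d', IsDep a d' → (∀ i, d i = 0 → d' i = 0) → ∃ r : ℝ, d' = r • d)
    (hs : ∀ ρ, IsAffBasis a ρ → ∀ k, k ∉ ρ → excess a ρ k w₀ = 0 → ∃ r : ℝ, fundDep a ρ k = r • d)
    (hw₁ : IsGenericLift a w₁) (hn₁ : IsNearLift a w₀ w₁) (hpos : 0 < ∑ i, d i * w₁ i)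
    (hw₂ : IsGenericLift a w₂) (hn₂ : IsNearLift a w₀ w₂) (hneg : ∑ i, d i * w₂ i < 0)
    {T₁ T₂ : Finset (Finset ι)} (hT₁ : (T₁ : Set (Finset ι)) = regularCells a w₁)
    (hT₂ : (T₂ : Set (Finset ι)) = regularCells a w₂) : T₁ = T₂ ∨ IsFlip a T₁ T₂ := by
  classical
  have h0 : d ≠ 0 := by rintro rfl; simp at hpos
  have hcirc := isCircuit_of_dep hd h0 hmin
  set P := Finset.univ.filter fun i => 0 < d i with hP
  set N := Finset.univ.filter fun i => d i < 0 with hN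
  have hPN : P ∪ N = Finset.univ.filter fun i => d i ≠ 0 := filter_pos_union_neg d
  have hNP : N ∪ P = Finset.univ.filter fun i => d i ≠ 0 := by rw [Finset.union_comm, hPN]
  set C := Finset.univ.filter fun i => d i ≠ 0 with hC
  let L : Finset (Finset ι) :=
    Finset.univ.filter fun ρ => Disjoint ρ C ∧ ρ ∪ C ∈ regularCells a w₀
  have hmemL : ∀ ρ, ρ ∈ L ↔ Disjoint ρ C ∧ ρ ∪ C ∈ regularCells a w₀ := fun ρ => by simp [L]
  have hm₁ : ∀ σ, σ ∈ T₁ ↔ (σ ∈ regularCells a w₀ ∧ IsIndep a σ) ∨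
      ∃ ρ ∈ L, ∃ i ∈ P, σ = ρ ∪ C.erase i := by
    intro σ
    rw [← Finset.mem_coe, hT₁, mem_regularCells_near_iff hd hs hw₁ hn₁ hpos σ]
    refine or_congr Iff.rfl ?_
    simp only [hmemL, hP, Finset.mem_filter, Finset.mem_univ, true_and, and_assoc]
    exact Iff.rfl
  have hm₂ : ∀ σ, σ ∈ T₂ ↔ (σ ∈ regularCells a w₀ ∧ IsIndep a σ) ∨
      ∃ ρ ∈ L, ∃ i ∈ N, σ = ρ ∪ C.erase i := by
    intro σ
    have hs' : ∀ ρ, IsAffBasis a ρ → ∀ k, k ∉ ρ → excess a ρ k w₀ = 0 →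
        ∃ r : ℝ, fundDep a ρ k = r • (-d) := by
      intro ρ hρ k hk h
      obtain ⟨r, hr⟩ := hs ρ hρ k hk h
      exact ⟨-r, by simpa using hr⟩
    rw [← Finset.mem_coe, hT₂, mem_regularCells_near_iff hd.neg hs' hw₂ hn₂ (by simpa using hneg) σ]
    refine or_congr Iff.rfl ?_
    have hC' : (Finset.univ.filter fun i => (-d) i ≠ 0) = C := by simp [hC]
    rw [hC']
    simp only [hmemL, hN, Finset.mem_filter, Finset.mem_univ, true_and, and_assoc,
      Pi.neg_apply, neg_pos]
  have hdep : ∀ Z : Finset ι, C ⊆ Z → ¬ IsIndep a Z := fun Z hZ hi => h0 (isIndep_iff.1 hi d hd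
    fun i hi' => by
      by_contra h
      exact hi' (hZ (by simpa [hC] using h)))
  -- An independent cell at the wall cannot contain the circuit minus `i`, since `i` would then have
  -- zero excess and belong to the cell too.
  have hnoflat : ∀ ρ i, i ∈ C → C.erase i ⊆ ρ → ρ ∈ regularCells a w₀ → ¬ IsIndep a ρ := by
    intro ρ i hi hsub hρ hind
    have hiρ : i ∉ ρ := fun h => hdep ρ (fun j hj => by
      by_cases e : j = i
      · exact e ▸ h
      · exact hsub (Finset.mem_erase.2 ⟨e, hj⟩)) hind
    have hb : IsAffBasis a ρ := ⟨hind, hρ.1⟩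
    have e := hb.eq_smul_fundDep hiρ hd fun j hj => by
      by_contra h
      refine hj (Finset.mem_insert.2 ?_)
      by_cases e : j = i
      · exact Or.inl e
      · exact Or.inr (hsub (Finset.mem_erase.2 ⟨e, by simpa [hC] using h⟩))
    have hdi : d i ≠ 0 := by simpa [hC] using hi
    have hexc : d i * excess a ρ i w₀ = 0 := by
      rw [excess, Finset.mul_sum, ← hdw₀]
      refine Finset.sum_congr rfl fun j _ => ?_
      conv_rhs => rw [e]
      simp [mul_assoc]
    exact hiρ ((excess_of_regular hρ hb subset_rfl hiρ).2.2
      ((mul_eq_zero.1 hexc).resolve_left hdi))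
  have hPC : P ⊆ C := hPN ▸ Finset.subset_union_left
  have hNC : N ⊆ C := hPN ▸ Finset.subset_union_right
  by_cases hL : L = ∅
  · left
    ext σ
    simp [hm₁, hm₂, hL]
  right
  refine ⟨P, N, hcirc, L, Finset.nonempty_iff_ne_empty.2 hL, ?_, ?_⟩
  · intro τ hτ
    obtain ⟨i, hi, rfl⟩ := Finset.mem_image.1 hτ
    ext ρ
    rw [mem_link, hPN]
    constructor
    · rintro ⟨h1, h2⟩
      rcases (hm₁ _).1 h2 with ⟨h3, h4⟩ | ⟨ρ', hρ', j, hj, e⟩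
      · exact absurd h4 (hnoflat _ i (hPC hi) Finset.subset_union_right h3)
      · rw [(join_erase_inj (hPC hj) h1 ((hmemL ρ').1 hρ').1 e).2]
        exact hρ'
    · intro hρ
      exact ⟨((hmemL ρ).1 hρ).1.mono_right (Finset.erase_subset _ _),
        (hm₁ _).2 (Or.inr ⟨ρ, hρ, i, hi, rfl⟩)⟩
  · ext σ
    rw [Finset.mem_union, Finset.mem_sdiff, mem_joinCells_circuit, mem_joinCells_circuit, hPN, hNP,
      hm₁, hm₂]
    constructor
    · rintro (h | h)
      · refine Or.inl ⟨Or.inl h, ?_⟩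
        rintro ⟨ρ, -, i, hi, rfl⟩
        exact hnoflat _ i (hPC hi) Finset.subset_union_right h.1 h.2
      · exact Or.inr h
    · rintro (⟨h | h, h'⟩ | h)
      · exact Or.inl h
      · exact absurd h h'
      · exact Or.inr h

theorem regularCells_subset_of_near {a : ι → E} {w₀ w₁ w₂ : ι → ℝ} {d : ι → ℝ}
    (hd : IsDep a d)
    (hs : ∀ ρ, IsAffBasis a ρ → ∀ k, k ∉ ρ → excess a ρ k w₀ = 0 → ∃ r : ℝ, fundDep a ρ k = r • d)
    (hw₁ : IsGenericLift a w₁) (hn₁ : IsNearLift a w₀ w₁) (hpos₁ : 0 < ∑ i, d i * w₁ i)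
    (hw₂ : IsGenericLift a w₂) (hn₂ : IsNearLift a w₀ w₂) (hpos₂ : 0 < ∑ i, d i * w₂ i) :
    regularCells a w₁ = regularCells a w₂ := by
  ext σ
  rw [mem_regularCells_near_iff hd hs hw₁ hn₁ hpos₁, mem_regularCells_near_iff hd hs hw₂ hn₂ hpos₂]

theorem IsGenericLift.indep {a : ι → E} {w : ι → ℝ} (hw : IsGenericLift a w) {σ : Finset ι}
    (hσ : σ ∈ regularCells a w) : IsIndep a σ :=
  (hw.isAffBasis hσ).indep

/-- All the dependences that are flat at `w` are proportional. -/
def IsSimpleLift (a : ι → E) (w : ι → ℝ) : Prop :=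
  ∀ ρ, IsAffBasis a ρ → ∀ k, k ∉ ρ → excess a ρ k w = 0 →
    ∀ ρ', IsAffBasis a ρ' → ∀ k', k' ∉ ρ' → excess a ρ' k' w = 0 →
      ∃ r : ℝ, fundDep a ρ' k' = r • fundDep a ρ k

/-- Either no dependence is flat at `w₀`, and both perturbations give the same triangulation, or
there is one flat dependence up to scaling, and its signs at `w₁` and `w₂` decide between equality
and a flip. -/
theorem component_eq_of_near {a : ι → E} {w₀ w₁ w₂ : ι → ℝ} (hs : IsSimpleLift a w₀)
    (hw₁ : IsGenericLift a w₁) (hn₁ : IsNearLift a w₀ w₁)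
    (hw₂ : IsGenericLift a w₂) (hn₂ : IsNearLift a w₀ w₂) (T₁ T₂ : Triangulation a)
    (hT₁ : (T₁.1 : Set (Finset ι)) = regularCells a w₁)
    (hT₂ : (T₂.1 : Set (Finset ι)) = regularCells a w₂) :
    (flipGraph a).connectedComponentMk T₁ = (flipGraph a).connectedComponentMk T₂ := by
  have heq : regularCells a w₁ = regularCells a w₂ →
      (flipGraph a).connectedComponentMk T₁ = (flipGraph a).connectedComponentMk T₂ := by
    intro h
    rw [← hT₁, ← hT₂, Finset.coe_inj] at h
    rw [Subtype.ext h]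
  have hor : ∀ T T' : Triangulation a, T.1 = T'.1 ∨ IsFlip a T.1 T'.1 →
      (flipGraph a).connectedComponentMk T = (flipGraph a).connectedComponentMk T' := by
    intro T T' h
    by_cases he : T = T'
    · rw [he]
    · rcases h with h | h
      · exact absurd (Subtype.ext h) he
      · exact SimpleGraph.ConnectedComponent.sound (flipGraph_adj_iff.2 ⟨he, h⟩).reachable
  by_cases hg : IsGenericLift a w₀
  · exact heq ((regularCells_eq_of_near hw₁ hn₁ fun σ hσ => hg.indep hσ).trans
      (regularCells_eq_of_near hw₂ hn₂ fun σ hσ => hg.indep hσ).symm)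
  simp only [IsGenericLift, not_forall, not_not] at hg
  obtain ⟨ρ, hρ, k, hk, h0⟩ := hg
  obtain ⟨hd, hdk, hd0⟩ := hρ.fundDep_spec hk
  have hs₀ := hs ρ hρ k hk h0
  have hs₀' : ∀ ρ', IsAffBasis a ρ' → ∀ k', k' ∉ ρ' → excess a ρ' k' w₀ = 0 →
      ∃ r : ℝ, fundDep a ρ' k' = r • (-fundDep a ρ k) := by
    intro ρ' hρ' k' hk' h
    obtain ⟨r, hr⟩ := hs₀ ρ' hρ' k' hk' h
    exact ⟨-r, by simpa using hr⟩
  have hmin : ∀ d', IsDep a d' → (∀ i, fundDep a ρ k i = 0 → d' i = 0) →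
      ∃ r : ℝ, d' = r • fundDep a ρ k := fun d' hd' h =>
    ⟨d' k, hρ.eq_smul_fundDep hk hd' fun i hi => h i (hd0 i hi)⟩
  have g₁ := hw₁ ρ hρ k hk
  have g₂ := hw₂ ρ hρ k hk
  unfold excess at h0 g₁ g₂
  rcases lt_or_gt_of_ne g₁ with g₁ | g₁ <;> rcases lt_or_gt_of_ne g₂ with g₂ | g₂
  · exact heq (regularCells_subset_of_near hd.neg hs₀' hw₁ hn₁ (by simpa using g₁) hw₂ hn₂
      (by simpa using g₂))
  · exact (hor _ _ (isFlip_of_near hd h0 hmin hs₀ hw₂ hn₂ g₂ hw₁ hn₁ g₁ hT₂ hT₁)).symm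
  · exact hor _ _ (isFlip_of_near hd h0 hmin hs₀ hw₁ hn₁ g₁ hw₂ hn₂ g₂ hT₁ hT₂)
  · exact heq (regularCells_subset_of_near hd hs₀ hw₁ hn₁ g₁ hw₂ hn₂ g₂)

theorem IsGenericLift.exists_triangulation {a : ι → E} (ha : affineSpan ℝ (Set.range a) = ⊤)
    {w : ι → ℝ} (hw : IsGenericLift a w) :
    ∃ T : Triangulation a, (T.1 : Set (Finset ι)) = regularCells a w := by
  classical
  have h : ((Finset.univ.filter fun σ => σ ∈ regularCells a w : Finset (Finset ι)) :
      Set (Finset ι)) = regularCells a w := by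
    ext σ; simp
  exact ⟨⟨_, isTriangulation_of_regularCells ha h fun σ hσ => hw.indep (by simpa using hσ)⟩, h⟩

/-- The linear functional `excess`. -/
noncomputable def excessFunctional (a : ι → E) (ρ : Finset ι) (k : ι) : (ι → ℝ) →ₗ[ℝ] ℝ :=
  ∑ i, fundDep a ρ k i • LinearMap.proj i

theorem excessFunctional_apply (a : ι → E) (ρ : Finset ι) (k : ι) (w : ι → ℝ) :
    excessFunctional a ρ k w = excess a ρ k w := by
  simp [excessFunctional, excess]

theorem excess_add_smul (a : ι → E) (ρ : Finset ι) (k : ι) (w v : ι → ℝ) (t : ℝ) :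
    excess a ρ k (w + t • v) = excess a ρ k w + t * excess a ρ k v := by
  simp [← excessFunctional_apply]

theorem excess_single (a : ι → E) (ρ : Finset ι) (k i : ι) :
    excess a ρ k (Pi.single i 1) = fundDep a ρ k i := by
  rw [excess, Finset.sum_eq_single i] <;> simp +contextual

/-- Finitely many non-zero functionals have a common vector `u` outside all their kernels, and
almost every small step along `u` leaves every kernel. -/
theorem frequently_forall_ne_zero {J : Type*} [Finite J] (f : J → (ι → ℝ) →ₗ[ℝ] ℝ)
    (hf : ∀ j, f j ≠ 0) (w : ι → ℝ) : ∃ᶠ v in 𝓝 w, ∀ j, f j v ≠ 0 := by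
  obtain ⟨u, hu⟩ := Module.Dual.exists_forall_ne_zero_of_forall_exists f fun j => by
    by_contra! h
    exact hf j (LinearMap.ext h)
  have h1 : ∀ᶠ ε : ℝ in 𝓝[≠] 0, ∀ j, f j (w + ε • u) ≠ 0 := by
    rw [eventually_all]
    intro j
    by_cases h : f j w = 0
    · filter_upwards [self_mem_nhdsWithin] with ε hε
      simpa [h, hu j] using hε
    · have hc : Tendsto (fun ε : ℝ => f j w + ε * f j u) (𝓝[≠] 0) (𝓝 (f j w + 0 * f j u)) :=
        (Continuous.tendsto (by fun_prop) _).mono_left nhdsWithin_le_nhds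
      rw [zero_mul, add_zero] at hc
      filter_upwards [hc.eventually_ne h] with ε hε
      simpa using hε
  have h2 : Tendsto (fun ε : ℝ => w + ε • u) (𝓝[≠] 0) (𝓝 w) := by
    have : Tendsto (fun ε : ℝ => w + ε • u) (𝓝[≠] 0) (𝓝 (w + (0 : ℝ) • u)) :=
      (Continuous.tendsto (by fun_prop) _).mono_left nhdsWithin_le_nhds
    simpa using this
  exact h2.frequently h1.frequently

/-- The pairs of an affine basis and a label outside of it. -/
abbrev BasisPair (a : ι → E) := {p : Finset ι × ι // IsAffBasis a p.1 ∧ p.2 ∉ p.1}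

theorem BasisPair.excessFunctional_ne_zero {a : ι → E} (p : BasisPair a) :
    excessFunctional a p.1.1 p.1.2 ≠ 0 := by
  intro h
  have := LinearMap.congr_fun h (Pi.single p.1.2 1)
  rw [excessFunctional_apply, excess_single, (p.2.1.fundDep_spec p.2.2).2.1] at this
  simp at this

theorem frequently_isGenericLift (a : ι → E) (w : ι → ℝ) : ∃ᶠ v in 𝓝 w, IsGenericLift a v :=
  (frequently_forall_ne_zero (fun p : BasisPair a => excessFunctional a p.1.1 p.1.2)
    (fun p => p.excessFunctional_ne_zero) w).mono fun v hv ρ hρ k hk => by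
      simpa [excessFunctional_apply] using hv ⟨(ρ, k), hρ, hk⟩

/-- Close to every lifting there is a generic one that is joined to the generic lifting `w₁` by a
line of simple liftings. -/
theorem frequently_isSimpleLift_line (a : ι → E) {w₁ : ι → ℝ} (hw₁ : IsGenericLift a w₁)
    (w : ι → ℝ) : ∃ᶠ v in 𝓝 w, IsGenericLift a v ∧ ∀ t : ℝ, IsSimpleLift a (w₁ + t • (v - w₁)) := by
  let J := {q : BasisPair a × BasisPair a //
    ¬ ∃ r : ℝ, fundDep a q.2.1.1 q.2.1.2 = r • fundDep a q.1.1.1 q.1.1.2}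
  -- This is the linear condition on `v` for two excesses to vanish at the same time on the line
  -- from `w₁` to `v`. It is not identically zero unless the two dependences are proportional.
  let F : J → (ι → ℝ) →ₗ[ℝ] ℝ := fun q =>
    excess a q.1.2.1.1 q.1.2.1.2 w₁ • excessFunctional a q.1.1.1.1 q.1.1.1.2 -
      excess a q.1.1.1.1 q.1.1.1.2 w₁ • excessFunctional a q.1.2.1.1 q.1.2.1.2
  have hF : ∀ q, F q ≠ 0 := by
    rintro ⟨⟨p, p'⟩, hq⟩ h
    refine hq ⟨excess a p'.1.1 p'.1.2 w₁ / excess a p.1.1 p.1.2 w₁, funext fun i => ?_⟩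
    have h1 := LinearMap.congr_fun h (Pi.single i 1)
    have h2 := hw₁ _ p.2.1 _ p.2.2
    simp only [F, LinearMap.sub_apply, LinearMap.smul_apply, excessFunctional_apply] at h1
    rw [excess_single, excess_single] at h1
    simp only [smul_eq_mul, LinearMap.zero_apply] at h1
    simp only [Pi.smul_apply, smul_eq_mul]
    field_simp
    linarith
  refine (frequently_forall_ne_zero (Sum.elim
    (fun p : BasisPair a => excessFunctional a p.1.1 p.1.2) F) ?_ w).mono fun v hv => ⟨?_, ?_⟩
  · rintro (p | q)
    · exact p.excessFunctional_ne_zero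
    · exact hF q
  · intro ρ hρ k hk
    simpa [excessFunctional_apply] using hv (Sum.inl ⟨(ρ, k), hρ, hk⟩)
  · intro t ρ hρ k hk h ρ' hρ' k' hk' h'
    by_contra hn
    have h1 := hv (Sum.inr ⟨(⟨(ρ, k), hρ, hk⟩, ⟨(ρ', k'), hρ', hk'⟩), hn⟩)
    apply h1
    have hsub : ∀ ρ k, excess a ρ k (v - w₁) = excess a ρ k v - excess a ρ k w₁ := by
      intro ρ k
      simp [← excessFunctional_apply]
    simp only [Sum.elim_inr, F, LinearMap.sub_apply, LinearMap.smul_apply, excessFunctional_apply,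
      smul_eq_mul]
    rw [excess_add_smul, hsub] at h h'
    have g := hw₁ ρ hρ k hk
    have ht : t ≠ 0 := by
      rintro rfl
      simp [g] at h
    have : t * (excess a ρ' k' w₁ * excess a ρ k v - excess a ρ k w₁ * excess a ρ' k' v) = 0 := by
      linear_combination excess a ρ' k' w₁ * h - excess a ρ k w₁ * h'
    exact (mul_eq_zero.1 this).resolve_left ht

/-- Each time `t` has a well-defined component, that of the triangulations at nearby times other
than `t`. It is locally constant, hence constant on the real line. -/
theorem component_eq_of_line {a : ι → E} (ha : affineSpan ℝ (Set.range a) = ⊤) {w₁ w₂ : ι → ℝ}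
    (hw₁ : IsGenericLift a w₁) (hw₂ : IsGenericLift a w₂)
    (hline : ∀ t : ℝ, IsSimpleLift a (w₁ + t • (w₂ - w₁))) (T₁ T₂ : Triangulation a)
    (hT₁ : (T₁.1 : Set (Finset ι)) = regularCells a w₁)
    (hT₂ : (T₂.1 : Set (Finset ι)) = regularCells a w₂) :
    (flipGraph a).connectedComponentMk T₁ = (flipGraph a).connectedComponentMk T₂ := by
  set W : ℝ → ι → ℝ := fun t => w₁ + t • (w₂ - w₁) with hW
  have hWc : Continuous W := by fun_prop
  -- The punctured neighbourhood avoids the wall that may sit at `t` itself, where there may be no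
  -- triangulation.
  let Q : ℝ → (flipGraph a).ConnectedComponent → Prop := fun t c => ∀ᶠ s in 𝓝[≠] t,
    IsGenericLift a (W s) ∧ ∀ T : Triangulation a, (T.1 : Set (Finset ι)) = regularCells a (W s) →
      (flipGraph a).connectedComponentMk T = c
  have hgen : ∀ t, ∀ᶠ s in 𝓝[≠] t, IsGenericLift a (W s) := by
    intro t
    have : ∀ᶠ s in 𝓝[≠] t, ∀ p : BasisPair a, excess a p.1.1 p.1.2 (W s) ≠ 0 := by
      rw [eventually_all]
      intro p
      have e : ∀ s, excess a p.1.1 p.1.2 (W s) =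
          excess a p.1.1 p.1.2 w₁ + s * excess a p.1.1 p.1.2 (w₂ - w₁) := fun s =>
        excess_add_smul _ _ _ _ _ _
      have g := hw₁ _ p.2.1 _ p.2.2
      -- Each excess is affine along the line and non-zero at its start, so its zeros are isolated.
      by_cases h : excess a p.1.1 p.1.2 (W t) = 0
      · filter_upwards [self_mem_nhdsWithin] with s hs h'
        rw [e] at h h'
        have h3 : (s - t) * excess a p.1.1 p.1.2 (w₂ - w₁) = 0 := by linear_combination h' - h
        rcases mul_eq_zero.1 h3 with h4 | h4
        · exact hs (sub_eq_zero.1 h4)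
        · rw [h4, mul_zero, add_zero] at h
          exact g h
      · exact (((continuous_excess a p.1.1 p.1.2).comp hWc).tendsto t).mono_left
          nhdsWithin_le_nhds |>.eventually_ne h
    exact this.mono fun s hs ρ hρ k hk => hs ⟨(ρ, k), hρ, hk⟩
  have hnear : ∀ t, ∀ᶠ s in 𝓝 t, IsNearLift a (W t) (W s) := fun t =>
    (hWc.tendsto t).eventually (eventually_isNearLift a (W t))
  have hex : ∀ t, ∃ c, Q t c := by
    intro t
    have hev := (hgen t).and ((hnear t).filter_mono nhdsWithin_le_nhds)
    obtain ⟨s, hs⟩ := hev.exists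
    obtain ⟨T, hT⟩ := hs.1.exists_triangulation ha
    refine ⟨(flipGraph a).connectedComponentMk T, hev.mono fun s' hs' => ⟨hs'.1, fun T' hT' => ?_⟩⟩
    exact component_eq_of_near (hline t) hs'.1 hs'.2 hs.1 hs.2 T' T hT' hT
  have huniq : ∀ t c c', Q t c → Q t c' → c = c' := by
    intro t c c' h h'
    obtain ⟨s, hs, hs'⟩ := (h.and h').exists
    obtain ⟨T, hT⟩ := hs.1.exists_triangulation ha
    rw [← hs.2 T hT, ← hs'.2 T hT]
  have hgood : ∀ t, IsGenericLift a (W t) → ∀ T : Triangulation a,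
      (T.1 : Set (Finset ι)) = regularCells a (W t) →
      Q t ((flipGraph a).connectedComponentMk T) := by
    intro t ht T hT
    filter_upwards [hgen t, (hnear t).filter_mono nhdsWithin_le_nhds] with s hs hs'
    refine ⟨hs, fun T' hT' => ?_⟩
    rw [regularCells_eq_of_near hs hs' fun σ hσ => ht.indep hσ, ← hT, Finset.coe_inj] at hT'
    rw [Subtype.ext hT']
  have hconn : ∃ c, Q 0 c ∧ Q 1 c := by
    refine isPreconnected_univ.induction₂ (fun t t' => ∃ c, Q t c ∧ Q t' c) ?_ ?_ ?_
      (Set.mem_univ (0 : ℝ)) (Set.mem_univ (1 : ℝ))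
    · intro t _
      obtain ⟨c, hc⟩ := hex t
      rw [nhdsWithin_univ]
      have h1 : ∀ᶠ s in 𝓝[≠] t, Q s c := by
        filter_upwards [eventually_eventually_nhdsWithin.2 hc, self_mem_nhdsWithin] with s hs hst
        rw [isOpen_compl_singleton.nhdsWithin_eq hst] at hs
        exact hs.filter_mono nhdsWithin_le_nhds
      rw [eventually_nhdsWithin_iff] at h1
      filter_upwards [h1] with s hs
      by_cases hst : s = t
      · exact ⟨c, hc, hst ▸ hc⟩
      · exact ⟨c, hc, hs hst⟩
    · rintro x y z - - - ⟨c, h1, h2⟩ ⟨c', h3, h4⟩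
      exact ⟨c, h1, huniq y c c' h2 h3 ▸ h4⟩
    · rintro x y - - ⟨c, h1, h2⟩
      exact ⟨c, h2, h1⟩
  obtain ⟨c, h0, h1⟩ := hconn
  have hW0 : W 0 = w₁ := by simp [hW]
  have hW1 : W 1 = w₂ := by simp [hW]
  rw [huniq 0 _ _ (hgood 0 (hW0 ▸ hw₁) T₁ (hW0 ▸ hT₁)) h0,
    huniq 1 _ _ (hgood 1 (hW1 ▸ hw₂) T₂ (hW1 ▸ hT₂)) h1]

/-- All regular triangulations lie in the same component of the flip graph. -/
theorem component_eq_of_regular {a : ι → E} (ha : affineSpan ℝ (Set.range a) = ⊤)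
    (T T' : Triangulation a) (hT : IsRegularTriangulation a T.1)
    (hT' : IsRegularTriangulation a T'.1) :
    (flipGraph a).connectedComponentMk T = (flipGraph a).connectedComponentMk T' := by
  obtain ⟨w, hw⟩ := hT
  obtain ⟨w', hw'⟩ := hT'
  obtain ⟨w₁, hg₁, hn₁⟩ := ((frequently_isGenericLift a w).and_eventually
    (eventually_isNearLift a w)).exists
  obtain ⟨w₂, ⟨hg₂, hline⟩, hn₂⟩ := ((frequently_isSimpleLift_line a hg₁ w').and_eventually
    (eventually_isNearLift a w')).exists
  refine component_eq_of_line ha hg₁ hg₂ hline T T' ?_ ?_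
  · rw [hw, regularCells_eq_of_near hg₁ hn₁ fun σ hσ => T.2.indep σ ?_]
    rw [← hw] at hσ
    exact hσ
  · rw [hw', regularCells_eq_of_near hg₂ hn₂ fun σ hσ => T'.2.indep σ ?_]
    rw [← hw'] at hσ
    exact hσ

end RegularConnected

/-! ### Labels and coordinates of A(0). -/

/-- The label of the point `(± eᵢ, ± vᵢ)`, with the signs given by `s` and `ε`. -/
def lab (i : Fin 4) (s ε : Bool) : Fin 17 :=
  ⟨1 + i + cond ε 0 4 + cond s 0 8, by rcases s <;> rcases ε <;> simp <;> omega⟩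

theorem lab_cases (k : Fin 17) : k = 0 ∨ ∃ i s ε, k = lab i s ε := by
  revert k; decide

theorem lab_ne_zero (i : Fin 4) (s ε : Bool) : lab i s ε ≠ 0 := by
  revert i s ε; decide

theorem lab_inj {i j : Fin 4} {s s' ε ε' : Bool} :
    lab i s ε = lab j s' ε' ↔ i = j ∧ s = s' ∧ ε = ε' := by
  revert i j s s' ε ε'; decide

theorem sum_lab {M : Type*} [AddCommMonoid M] (f : Fin 17 → M) :
    ∑ k, f k = f 0 + ∑ i, ∑ s, ∑ ε, f (lab i s ε) := by
  have h : (Finset.univ : Finset (Fin 17)) = insert 0 ((Finset.univ : Finset (Fin 4 × Bool × Bool)).image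
      fun p => lab p.1 p.2.1 p.2.2) := by
    ext k
    simp only [Finset.mem_univ, Finset.mem_insert, Finset.mem_image, true_and, true_iff]
    rcases lab_cases k with h | ⟨i, s, ε, h⟩
    · exact Or.inl h
    · exact Or.inr ⟨(i, s, ε), h.symm⟩
  rw [h, Finset.sum_insert, Finset.sum_image]
  · simp only [Fintype.sum_prod_type]
  · rintro ⟨i, s, ε⟩ - ⟨j, s', ε'⟩ - h
    obtain ⟨rfl, rfl, rfl⟩ := lab_inj.1 h
    rfl
  · simp only [Finset.mem_image, not_exists, not_and]
    exact fun p _ => lab_ne_zero _ _ _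

/-- The sign encoded by a Boolean. -/
def sg (b : Bool) : ℝ := if b then 1 else -1

@[simp] theorem sg_true : sg true = 1 := rfl
@[simp] theorem sg_false : sg false = -1 := rfl

theorem sg_not (b : Bool) : sg (!b) = -sg b := by cases b <;> simp

theorem configA_zero : configA 0 0 = 0 := by
  ext j
  fin_cases j <;> simp [configA]

/-- The values of a linear functional of `ℝ²` at the vectors `v₁, …, v₄`. -/
noncomputable def vval (y₁ y₂ : ℝ) : Fin 4 → ℝ := ![√2 * y₁, y₁ + y₂, √2 * y₂, y₂ - y₁]

theorem linear_configA (ℓ : (Fin 6 → ℝ) →ₗ[ℝ] ℝ) (i : Fin 4) (s ε : Bool) :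
    ℓ (configA 0 (lab i s ε)) = sg s * ℓ (Pi.single (i.castLE (by norm_num)) 1) +
      sg ε * vval (ℓ (Pi.single 4 1)) (ℓ (Pi.single 5 1)) i := by
  rw [LinearMap.pi_apply_eq_sum_univ ℓ]
  have e : ∀ j : Fin 6, (fun i => if j = i then (1 : ℝ) else 0) = Pi.single j 1 := by
    intro j; ext i; simp [Pi.single_apply, eq_comm]
  simp only [e, Fin.sum_univ_six]
  fin_cases i <;> rcases s <;> rcases ε <;> simp [configA, lab, vval] <;> ring

/-- The linear functional with the given coordinates. -/
noncomputable def mkLinear (X : Fin 4 → ℝ) (y₁ y₂ : ℝ) : (Fin 6 → ℝ) →ₗ[ℝ] ℝ :=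
  X 0 • LinearMap.proj 0 + X 1 • LinearMap.proj 1 + X 2 • LinearMap.proj 2 +
    X 3 • LinearMap.proj 3 + y₁ • LinearMap.proj 4 + y₂ • LinearMap.proj 5

theorem mkLinear_configA (X : Fin 4 → ℝ) (y₁ y₂ : ℝ) (i : Fin 4) (s ε : Bool) :
    mkLinear X y₁ y₂ (configA 0 (lab i s ε)) = sg s * X i + sg ε * vval y₁ y₂ i := by
  rw [linear_configA]
  have h4 : mkLinear X y₁ y₂ (Pi.single 4 1) = y₁ := by simp [mkLinear]
  have h5 : mkLinear X y₁ y₂ (Pi.single 5 1) = y₂ := by simp [mkLinear]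
  rw [h4, h5]
  congr 2
  fin_cases i <;> simp [mkLinear]

theorem linear_eq_mkLinear (ℓ : (Fin 6 → ℝ) →ₗ[ℝ] ℝ) :
    ℓ = mkLinear (fun i => ℓ (Pi.single (i.castLE (by norm_num)) 1)) (ℓ (Pi.single 4 1))
      (ℓ (Pi.single 5 1)) := by
  refine LinearMap.pi_ext' fun j => LinearMap.ext_ring ?_
  fin_cases j <;> simp [mkLinear]

/-! ### Octagonal facets and their dependences. -/

/-- The labels of the octagonal facet with the signs `s`. -/
def octFacet (s : Fin 4 → Bool) : Finset (Fin 17) :=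
  Finset.univ.filter fun k => ∃ i ε, k = lab i (s i) ε

theorem mem_octFacet {s : Fin 4 → Bool} {k : Fin 17} :
    k ∈ octFacet s ↔ ∃ i ε, k = lab i (s i) ε := by
  simp [octFacet]

theorem lab_mem_octFacet {s : Fin 4 → Bool} {i : Fin 4} {b ε : Bool} :
    lab i b ε ∈ octFacet s ↔ b = s i := by
  rw [mem_octFacet]
  constructor
  · rintro ⟨j, ε', h⟩
    obtain ⟨rfl, rfl, -⟩ := lab_inj.1 h
    rfl
  · rintro rfl
    exact ⟨i, ε, rfl⟩

/-- The coefficients of the dependences of `v₁, …, v₄`. -/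
def IsVDep (μ : Fin 4 → ℝ) : Prop := √2 * μ 0 + μ 1 - μ 3 = 0 ∧ μ 1 + √2 * μ 2 + μ 3 = 0

/-- The dependence of the points of an octagonal facet given by a dependence of `v₁, …, v₄`. -/
noncomputable def octDep (s : Fin 4 → Bool) (μ : Fin 4 → ℝ) (k : Fin 17) : ℝ :=
  ∑ i, ∑ ε, if k = lab i (s i) ε then sg ε * μ i else 0

theorem octDep_lab (s : Fin 4 → Bool) (μ : Fin 4 → ℝ) (i : Fin 4) (ε : Bool) :
    octDep s μ (lab i (s i) ε) = sg ε * μ i := by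
  rw [octDep, Finset.sum_eq_single i, Finset.sum_eq_single ε]
  · simp
  · intro ε' _ h
    rw [if_neg]
    exact fun h' => h (lab_inj.1 h').2.2.symm
  · simp
  · intro j _ h
    refine Finset.sum_eq_zero fun ε' _ => if_neg fun h' => h (lab_inj.1 h').1.symm
  · simp

theorem octDep_notMem (s : Fin 4 → Bool) (μ : Fin 4 → ℝ) {k : Fin 17} (hk : k ∉ octFacet s) :
    octDep s μ k = 0 :=
  Finset.sum_eq_zero fun i _ => Finset.sum_eq_zero fun ε _ => if_neg fun h =>
    hk (mem_octFacet.2 ⟨i, ε, h⟩)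

theorem octDep_smul (s : Fin 4 → Bool) (μ : Fin 4 → ℝ) (r : ℝ) :
    octDep s (r • μ) = r • octDep s μ := by
  ext k
  by_cases hk : k ∈ octFacet s
  · obtain ⟨i, ε, rfl⟩ := mem_octFacet.1 hk
    simp only [octDep_lab, Pi.smul_apply, smul_eq_mul]
    ring
  · simp [octDep_notMem s _ hk]

theorem isDep_octDep (s : Fin 4 → Bool) {μ : Fin 4 → ℝ} (h : IsVDep μ) :
    IsDep (configA 0) (octDep s μ) := by
  have hsum : ∀ {M : Type} [AddCommGroup M] [Module ℝ M] (x : Fin 17 → M),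
      ∑ k, octDep s μ k • x k = ∑ i, ∑ ε, (sg ε * μ i) • x (lab i (s i) ε) := by
    intro M _ _ x
    simp only [octDep, Finset.sum_smul]
    rw [Finset.sum_comm]
    refine Finset.sum_congr rfl fun i _ => ?_
    rw [Finset.sum_comm]
    refine Finset.sum_congr rfl fun ε _ => ?_
    rw [Finset.sum_eq_single (lab i (s i) ε)] <;> simp +contextual
  constructor
  · have := hsum (fun _ => (1 : ℝ))
    simpa using this
  · rw [hsum]
    ext j
    have key : ∀ ℓ : (Fin 6 → ℝ) →ₗ[ℝ] ℝ,
        ℓ (∑ i, ∑ ε, (sg ε * μ i) • configA 0 (lab i (s i) ε)) = 0 := by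
      intro ℓ
      obtain ⟨h1, h2⟩ := h
      simp only [map_add, map_smul, linear_configA, Fintype.sum_bool, sg_true, sg_false, smul_eq_mul,
        Fin.sum_univ_four, vval]
      simp
      linear_combination 2 * ℓ (Pi.single 4 1) * h1 + 2 * ℓ (Pi.single 5 1) * h2
    exact key (LinearMap.proj j)

/-- The coordinate at eᵢ forces opposite coefficients on the pair (sᵢeᵢ, ±vᵢ), and the last two
coordinates then give a dependence of the vᵢ. The coefficients of the facet cancel in pairs, so the
origin has coefficient zero although it is allowed in the support. -/
theorem eq_octDep {s : Fin 4 → Bool} {d : Fin 17 → ℝ} (hd : IsDep (configA 0) d)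
    (hs : ∀ k, k ∉ octFacet s → k ≠ 0 → d k = 0) : ∃ μ, IsVDep μ ∧ d = octDep s μ := by
  have hoff : ∀ i b ε, b ≠ s i → d (lab i b ε) = 0 := fun i b ε hb =>
    hs _ (fun h => hb (lab_mem_octFacet.1 h)) (lab_ne_zero _ _ _)
  have hsum : ∀ {g : Bool → ℝ} (i : Fin 4), (∀ b, b ≠ s i → g b = 0) → ∑ b, g b = g (s i) := by
    intro g i h
    exact Finset.sum_eq_single (s i) (fun b _ hb => h b hb) (by simp)
  have hlin : ∀ (X : Fin 4 → ℝ) (y₁ y₂ : ℝ),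
      ∑ i, ∑ ε, d (lab i (s i) ε) * (sg (s i) * X i + sg ε * vval y₁ y₂ i) = 0 := by
    intro X y₁ y₂
    have := hd.sum_linear (mkLinear X y₁ y₂)
    rw [sum_lab, configA_zero, map_zero, mul_zero, zero_add] at this
    rw [← this]
    refine Finset.sum_congr rfl fun i _ => ?_
    symm
    rw [hsum i]
    · simp only [mkLinear_configA]
    · intro b hb
      simp [hoff i b _ hb]
  have hpm : ∀ i, d (lab i (s i) false) = -d (lab i (s i) true) := by
    intro i
    have := hlin (Pi.single i 1) 0 0
    rw [Finset.sum_eq_single i] at this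
    · have hv : vval 0 0 i = 0 := by fin_cases i <;> simp [vval]
      simp only [Pi.single_eq_same, mul_one, hv, mul_zero, add_zero, Fintype.sum_bool] at this
      have hsg : sg (s i) ≠ 0 := by cases s i <;> simp
      have : (d (lab i (s i) true) + d (lab i (s i) false)) * sg (s i) = 0 := by linarith
      have := (mul_eq_zero.1 this).resolve_right hsg
      linarith
    · intro j _ hj
      have hv : vval 0 0 j = 0 := by fin_cases j <;> simp [vval]
      simp [hj, hv]
    · simp
  refine ⟨fun i => d (lab i (s i) true), ⟨?_, ?_⟩, ?_⟩
  · have := hlin 0 1 0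
    simp only [Fintype.sum_bool, hpm, Fin.sum_univ_four, vval] at this
    simp at this
    linarith
  · have := hlin 0 0 1
    simp only [Fintype.sum_bool, hpm, Fin.sum_univ_four, vval] at this
    simp at this
    linarith
  · ext k
    rcases lab_cases k with rfl | ⟨i, b, ε, rfl⟩
    · rw [octDep_notMem]
      · have := hd.1
        rw [sum_lab] at this
        rw [← this, eq_comm, add_eq_left]
        refine Finset.sum_eq_zero fun i _ => ?_
        rw [hsum i]
        · simp [hpm]
        · intro b hb
          simp [hoff i b _ hb]
      · intro h
        obtain ⟨i, ε, h⟩ := mem_octFacet.1 h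
        exact lab_ne_zero _ _ _ h.symm
    · by_cases hb : b = s i
      · subst hb
        rw [octDep_lab]
        cases ε
        · simp [hpm]
        · simp
      · rw [hoff i b ε hb, octDep_notMem]
        exact fun h => hb (lab_mem_octFacet.1 h)

/-! ### Hexagons: the circuits of the octagonal facets. -/

/-- The signs of the circuits of `v₁, …, v₄`, where the `l`-th circuit avoids `vₗ`. -/
def rsgn : Fin 4 → Fin 4 → Bool :=
  ![![false, false, true, false], ![true, false, false, true], ![true, false, false, true],
    ![true, false, true, false]]

/-- The circuits of `v₁, …, v₄`. -/
noncomputable def ray : Fin 4 → Fin 4 → ℝ :=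
  ![![0, -1, √2, -1], ![1, 0, -1, √2], ![√2, -1, 0, 1], ![1, -√2, 1, 0]]

theorem sqrt_two_mul_self : √2 * √2 = (2 : ℝ) := Real.mul_self_sqrt (by norm_num)

theorem sqrt_two_gt : (1.4 : ℝ) < √2 := by
  rw [Real.lt_sqrt] <;> norm_num

theorem sqrt_two_lt : √2 < (1.5 : ℝ) := by
  rw [Real.sqrt_lt'] <;> norm_num

theorem isVDep_ray (l : Fin 4) : IsVDep (ray l) := by
  have := sqrt_two_mul_self
  fin_cases l <;> constructor <;> simp [ray] <;> linarith

theorem ray_self (l : Fin 4) : ray l l = 0 := by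
  fin_cases l <;> simp [ray]

theorem ray_sign {l i : Fin 4} (h : i ≠ l) : 0 < sg (rsgn l i) * ray l i := by
  fin_cases l <;> fin_cases i <;> simp_all [ray, rsgn, sg]

theorem IsVDep.relations {μ : Fin 4 → ℝ} (h : IsVDep μ) :
    √2 * μ 1 = -(μ 0 + μ 2) ∧ √2 * μ 3 = μ 0 - μ 2 := by
  obtain ⟨h1, h2⟩ := h
  have := sqrt_two_mul_self
  constructor
  · linear_combination (√2 / 2) * h1 + (√2 / 2) * h2 - (μ 0 + μ 2) / 2 * this
  · linear_combination (-√2 / 2) * h1 + (√2 / 2) * h2 + (μ 0 - μ 2) / 2 * this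

theorem IsVDep.eq_zero_of_two {μ : Fin 4 → ℝ} (h : IsVDep μ) (h0 : μ 0 = 0) (h2 : μ 2 = 0) :
    μ = 0 := by
  obtain ⟨h3, h4⟩ := h.relations
  have := sqrt_two_gt
  rw [h0, h2] at h3 h4
  have h1 : μ 1 = 0 := by
    have : √2 * μ 1 = 0 := by linarith
    exact (mul_eq_zero.1 this).resolve_left (by linarith)
  have h3 : μ 3 = 0 := by
    have : √2 * μ 3 = 0 := by linarith
    exact (mul_eq_zero.1 this).resolve_left (by linarith)
  ext i
  fin_cases i <;> assumption

/-- The dependences form a plane with coordinates μ 0 and μ 2, in which each condition μ l = 0 cuts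
out a line. -/
theorem IsVDep.eq_smul_ray {μ : Fin 4 → ℝ} (h : IsVDep μ) {l : Fin 4} (hl : μ l = 0) :
    ∃ r : ℝ, μ = r • ray l := by
  obtain ⟨h3, h4⟩ := h.relations
  have hq := sqrt_two_mul_self
  have hq0 := sqrt_two_gt
  have key : ∀ r : ℝ, μ 0 = r * ray l 0 → μ 2 = r * ray l 2 → μ = r • ray l := by
    intro r e1 e2
    have hv := isVDep_ray l
    rw [← sub_eq_zero]
    refine IsVDep.eq_zero_of_two (μ := μ - r • ray l) ?_ (by simp [e1]) (by simp [e2])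
    obtain ⟨h1, h2⟩ := h
    obtain ⟨g1, g2⟩ := hv
    constructor
    · simp only [Pi.sub_apply, Pi.smul_apply, smul_eq_mul]
      linear_combination h1 - r * g1
    · simp only [Pi.sub_apply, Pi.smul_apply, smul_eq_mul]
      linear_combination h2 - r * g2
  fin_cases l <;> simp only [Fin.isValue, Fin.zero_eta, Fin.mk_one, Fin.reduceFinMk] at hl ⊢ key
  · exact ⟨μ 2 / √2, key _ (by simp [ray, hl]) (by simp [ray])⟩
  · exact ⟨μ 0, key _ (by simp [ray]) (by simp [ray]; rw [hl] at h3; linarith)⟩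
  · exact ⟨μ 0 / √2, key _ (by simp [ray]) (by simp [ray, hl])⟩
  · exact ⟨μ 0, key _ (by simp [ray]) (by simp [ray]; rw [hl] at h4; linarith)⟩

theorem pos_of_sqrt_mul_pos {x : ℝ} (h : 0 < √2 * x) : 0 < x :=
  pos_of_mul_pos_right h (Real.sqrt_nonneg 2)

/-- The signs of μ 0 and μ 2 determine the sign of their sum or of their difference, and hence of μ
1 or μ 3. In each of the eight cases three signs are known, and they agree with those of some
circuit up to a global sign. This makes the four circuits sufficient to test all dependences of a
facet. -/
theorem IsVDep.exists_ray {μ : Fin 4 → ℝ} (h : IsVDep μ) (h0 : μ ≠ 0) :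
    ∃ l b, ∀ i, i ≠ l → 0 < sg (xor (rsgn l i) b) * μ i := by
  obtain ⟨h3, h4⟩ := h.relations
  have h1 : 0 < -(μ 0 + μ 2) → 0 < μ 1 := fun h => pos_of_sqrt_mul_pos (h3 ▸ h)
  have h1' : 0 < μ 0 + μ 2 → 0 < -μ 1 := fun h => pos_of_sqrt_mul_pos (by linarith)
  have h2 : 0 < μ 0 - μ 2 → 0 < μ 3 := fun h => pos_of_sqrt_mul_pos (h4 ▸ h)
  have h2' : 0 < μ 2 - μ 0 → 0 < -μ 3 := fun h => pos_of_sqrt_mul_pos (by linarith)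
  rcases lt_trichotomy (μ 0) 0 with h5 | h5 | h5 <;> rcases lt_trichotomy (μ 2) 0 with h6 | h6 | h6
  · have := h1 (by linarith)
    refine ⟨3, true, fun i hi => ?_⟩
    fin_cases i <;> first | exact absurd rfl hi | (simp [rsgn, sg]; linarith)
  · have := h1 (by linarith)
    have := h2' (by linarith)
    refine ⟨2, true, fun i hi => ?_⟩
    fin_cases i <;> first | exact absurd rfl hi | (simp [rsgn, sg]; linarith)
  · have := h2' (by linarith)
    refine ⟨1, true, fun i hi => ?_⟩
    fin_cases i <;> first | exact absurd rfl hi | (simp [rsgn, sg]; linarith)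
  · have := h1 (by linarith)
    have := h2 (by linarith)
    refine ⟨0, true, fun i hi => ?_⟩
    fin_cases i <;> first | exact absurd rfl hi | (simp [rsgn, sg]; linarith)
  · exact absurd (h.eq_zero_of_two h5 h6) h0
  · have := h1' (by linarith)
    have := h2' (by linarith)
    refine ⟨0, false, fun i hi => ?_⟩
    fin_cases i <;> first | exact absurd rfl hi | (simp [rsgn, sg]; linarith)
  · have := h2 (by linarith)
    refine ⟨1, false, fun i hi => ?_⟩
    fin_cases i <;> first | exact absurd rfl hi | (simp [rsgn, sg]; linarith)
  · have := h1' (by linarith)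
    have := h2 (by linarith)
    refine ⟨2, false, fun i hi => ?_⟩
    fin_cases i <;> first | exact absurd rfl hi | (simp [rsgn, sg]; linarith)
  · have := h1' (by linarith)
    refine ⟨3, false, fun i hi => ?_⟩
    fin_cases i <;> first | exact absurd rfl hi | (simp [rsgn, sg]; linarith)

theorem IsVDep.relations' {μ : Fin 4 → ℝ} (h : IsVDep μ) :
    √2 * μ 0 = μ 3 - μ 1 ∧ √2 * μ 2 = -(μ 1 + μ 3) :=
  ⟨by linarith [h.1], by linarith [h.2]⟩

/-- The labels of the positive part of a circuit of the facet `s` that avoids the index `l`. -/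
def hexTriple (l : Fin 4) (s : Fin 4 → Bool) (b : Bool) : Finset (Fin 17) :=
  Finset.univ.filter fun k => ∃ i, i ≠ l ∧ k = lab i (s i) (xor (rsgn l i) b)

theorem mem_hexTriple {l : Fin 4} {s : Fin 4 → Bool} {b : Bool} {k : Fin 17} :
    k ∈ hexTriple l s b ↔ ∃ i, i ≠ l ∧ k = lab i (s i) (xor (rsgn l i) b) := by
  simp [hexTriple]

theorem hexTriple_subset_iff {l : Fin 4} {s : Fin 4 → Bool} {b : Bool} {κ : Finset (Fin 17)} :
    hexTriple l s b ⊆ κ ↔ ∀ i, i ≠ l → lab i (s i) (xor (rsgn l i) b) ∈ κ := by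
  constructor
  · exact fun h i hi => h (mem_hexTriple.2 ⟨i, hi, rfl⟩)
  · intro h k hk
    obtain ⟨i, hi, rfl⟩ := mem_hexTriple.1 hk
    exact h i hi

theorem hexTriple_subset_octFacet (l : Fin 4) (s : Fin 4 → Bool) (b : Bool) :
    hexTriple l s b ⊆ octFacet s :=
  hexTriple_subset_iff.2 fun _ _ => lab_mem_octFacet.2 rfl

theorem hexTriple_congr {l : Fin 4} {s s' : Fin 4 → Bool} (h : ∀ i, i ≠ l → s i = s' i) (b : Bool) :
    hexTriple l s b = hexTriple l s' b := by
  ext k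
  rw [mem_hexTriple, mem_hexTriple]
  constructor
  · rintro ⟨i, hi, rfl⟩
    exact ⟨i, hi, by rw [h i hi]⟩
  · rintro ⟨i, hi, rfl⟩
    exact ⟨i, hi, by rw [h i hi]⟩

theorem congr_of_hexTriple_subset {l : Fin 4} {s s' : Fin 4 → Bool} {b : Bool}
    (h : hexTriple l s b ⊆ octFacet s') : ∀ i, i ≠ l → s i = s' i :=
  fun i hi => lab_mem_octFacet.1 (hexTriple_subset_iff.1 h i hi)

theorem exists_hexTriple {s : Fin 4 → Bool} {d : Fin 17 → ℝ} (hd : IsDep (configA 0) d)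
    (hs : ∀ k, k ∉ octFacet s → k ≠ 0 → d k = 0) (h0 : d ≠ 0) :
    ∃ l b, (∀ k ∈ hexTriple l s b, 0 < d k) ∧ ∀ k ∈ hexTriple l s (!b), d k < 0 := by
  obtain ⟨μ, hμ, rfl⟩ := eq_octDep hd hs
  have hμ0 : μ ≠ 0 := by
    rintro rfl
    apply h0
    simpa using octDep_smul s 0 0
  obtain ⟨l, b, h⟩ := hμ.exists_ray hμ0
  refine ⟨l, b, fun k hk => ?_, fun k hk => ?_⟩
  · obtain ⟨i, hi, rfl⟩ := mem_hexTriple.1 hk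
    rw [octDep_lab]
    exact h i hi
  · obtain ⟨i, hi, rfl⟩ := mem_hexTriple.1 hk
    rw [octDep_lab, Bool.xor_not, sg_not]
    linarith [h i hi]

/-- The dependence supported on a hexagon, positive on `hexTriple l s b`. -/
noncomputable def hexDep (l : Fin 4) (s : Fin 4 → Bool) (b : Bool) : Fin 17 → ℝ :=
  octDep s (-sg b • ray l)

theorem isDep_hexDep (l : Fin 4) (s : Fin 4 → Bool) (b : Bool) :
    IsDep (configA 0) (hexDep l s b) := by
  rw [hexDep, octDep_smul]
  exact (isDep_octDep s (isVDep_ray l)).smul _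

theorem hexDep_lab (l : Fin 4) (s : Fin 4 → Bool) (b : Bool) (i : Fin 4) (ε : Bool) :
    hexDep l s b (lab i (s i) ε) = sg ε * (-sg b * ray l i) := by
  rw [hexDep, octDep_lab]
  simp

theorem hexDep_pos_iff (l : Fin 4) (s : Fin 4 → Bool) (b : Bool) (k : Fin 17) :
    0 < hexDep l s b k ↔ k ∈ hexTriple l s b := by
  by_cases hk : k ∈ octFacet s
  · obtain ⟨i, ε, rfl⟩ := mem_octFacet.1 hk
    rw [hexDep_lab, mem_hexTriple]
    by_cases hi : i = l
    · subst hi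
      rw [ray_self]
      simp only [mul_zero, lt_self_iff_false, false_iff, not_exists, not_and]
      rintro j hj h
      exact hj (lab_inj.1 h).1.symm
    · have h1 : (∃ j, j ≠ l ∧ lab i (s i) ε = lab j (s j) (rsgn l j ^^ b)) ↔
          ε = (rsgn l i ^^ b) := by
        constructor
        · rintro ⟨j, hj, h⟩
          obtain ⟨rfl, -, h⟩ := lab_inj.1 h
          exact h
        · rintro rfl
          exact ⟨i, hi, rfl⟩
      rw [h1]
      have h2 := ray_sign hi
      revert h2
      cases rsgn l i <;> cases b <;> cases ε <;> simp <;> intro h <;> linarith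
  · rw [hexDep, octDep_notMem s _ hk]
    simp only [lt_self_iff_false, false_iff]
    exact fun h => hk (hexTriple_subset_octFacet l s b h)

theorem hexDep_not (l : Fin 4) (s : Fin 4 → Bool) (b : Bool) :
    hexDep l s (!b) = -hexDep l s b := by
  rw [hexDep, hexDep, sg_not, octDep_smul, octDep_smul]
  simp

theorem hexDep_neg_iff (l : Fin 4) (s : Fin 4 → Bool) (b : Bool) (k : Fin 17) :
    hexDep l s b k < 0 ↔ k ∈ hexTriple l s (!b) := by
  rw [← hexDep_pos_iff, hexDep_not]
  simp

theorem hexTriple_nonempty (l : Fin 4) (s : Fin 4 → Bool) (b : Bool) :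
    (hexTriple l s b).Nonempty := by
  have : ∃ i, i ≠ l := by revert l; decide
  obtain ⟨i, hi⟩ := this
  exact ⟨_, mem_hexTriple.2 ⟨i, hi, rfl⟩⟩

theorem hexDep_ne_zero (l : Fin 4) (s : Fin 4 → Bool) (b : Bool) : hexDep l s b ≠ 0 := by
  obtain ⟨k, hk⟩ := hexTriple_nonempty l s b
  rw [← hexDep_pos_iff] at hk
  intro h
  simp [h] at hk

/-- A dependence supported on the hexagon lies in the octagonal facet and has μ l = 0, so it is a
multiple of the l-th ray. -/
theorem isCircuit_hexTriple (l : Fin 4) (s : Fin 4 → Bool) (b : Bool) :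
    IsCircuit (configA 0) (hexTriple l s b) (hexTriple l s (!b)) := by
  have h := isCircuit_of_dep (isDep_hexDep l s b) (hexDep_ne_zero l s b) ?_
  · have e1 : (Finset.univ.filter fun k => 0 < hexDep l s b k) = hexTriple l s b := by
      ext k; simp [hexDep_pos_iff]
    have e2 : (Finset.univ.filter fun k => hexDep l s b k < 0) = hexTriple l s (!b) := by
      ext k; simp [hexDep_neg_iff]
    rwa [e1, e2] at h
  · intro d' hd' h0
    obtain ⟨μ, hμ, rfl⟩ := eq_octDep hd' fun k hk _ => h0 k (octDep_notMem s _ hk)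
    have hl : μ l = 0 := by
      have := h0 (lab l (s l) true) (by rw [hexDep_lab, ray_self]; simp)
      rw [octDep_lab] at this
      simpa using this
    obtain ⟨r, rfl⟩ := hμ.eq_smul_ray hl
    refine ⟨-r * sg b, ?_⟩
    rw [hexDep, octDep_smul, octDep_smul, smul_smul]
    congr 1
    cases b <;> simp

theorem IsTriangulation.not_hexTriple_both {T : Finset (Finset (Fin 17))}
    (hT : IsTriangulation (configA 0) T) {l : Fin 4} {s : Fin 4 → Bool} {b : Bool}
    {σ σ' : Finset (Fin 17)} (hσ : σ ∈ T) (hσ' : σ' ∈ T) (h : hexTriple l s b ⊆ σ) :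
    ¬ hexTriple l s (!b) ⊆ σ' :=
  hT.not_subset_circuit (isCircuit_hexTriple l s b) hσ hσ' h

/-! ### Supporting hyperplanes: every facet is octagonal or a simplex. -/

/-- `ℓ` is at most one on the configuration. -/
def IsFeasible (ℓ : (Fin 6 → ℝ) →ₗ[ℝ] ℝ) : Prop := ∀ k, ℓ (configA 0 k) ≤ 1

/-- The points of the configuration where `ℓ` is one. -/
noncomputable def tight (ℓ : (Fin 6 → ℝ) →ₗ[ℝ] ℝ) : Finset (Fin 17) :=
  Finset.univ.filter fun k => ℓ (configA 0 k) = 1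

theorem mem_tight {ℓ : (Fin 6 → ℝ) →ₗ[ℝ] ℝ} {k : Fin 17} :
    k ∈ tight ℓ ↔ ℓ (configA 0 k) = 1 := by
  simp [tight]

theorem zero_notMem_tight (ℓ : (Fin 6 → ℝ) →ₗ[ℝ] ℝ) : 0 ∉ tight ℓ := by
  rw [mem_tight, configA_zero, map_zero]
  exact zero_ne_one

/-- The inequalities say |X| + |f| ≤ 1. Two of the four sign choices attain equality only if f = 0
or X = 0, and in the second case f = ±1. -/
theorem tight_local_le (X f : ℝ) (h : ∀ s ε, sg s * X + sg ε * f ≤ 1) :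
    (∑ s, ∑ ε, if sg s * X + sg ε * f = 1 then 1 else 0) ≤ 2 ∧
      (f ≠ 0 → f ≠ 1 → f ≠ -1 → (∑ s, ∑ ε, if sg s * X + sg ε * f = 1 then 1 else 0) ≤ 1) := by
  have h1 := h true true
  have h2 := h true false
  have h3 := h false true
  have h4 := h false false
  simp only [Fintype.sum_bool, sg_true, sg_false, one_mul, neg_one_mul] at h1 h2 h3 h4 ⊢
  by_cases c1 : X + f = 1 <;> by_cases c2 : X + -f = 1 <;> by_cases c3 : -X + f = 1 <;>
    by_cases c4 : -X + -f = 1 <;> simp only [c1, c2, c3, c4, if_true, if_false] <;>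
    first
    | (norm_num; done)
    | (exfalso; linarith)
    | exact ⟨by norm_num, fun g1 g2 g3 => absurd (by linarith) g1⟩
    | exact ⟨by norm_num, fun g1 g2 g3 => absurd (by linarith) g2⟩
    | exact ⟨by norm_num, fun g1 g2 g3 => absurd (by linarith) g3⟩

/-- Since q is not an integer, m = ±1 is impossible, so z = -x. The bound on x - z = 2x then
excludes x = ±1. -/
theorem special_pair {q x z m : ℝ} (hq1 : 1.4 < q) (hq2 : q < 1.5)
    (hx : x = 0 ∨ x = 1 ∨ x = -1) (hz : z = 0 ∨ z = 1 ∨ z = -1) (hm : m = 0 ∨ m = 1 ∨ m = -1)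
    (h : q * m = x + z) (h1 : -1.5 ≤ x - z) (h2 : x - z ≤ 1.5) : x = 0 ∧ z = 0 := by
  rcases hx with rfl | rfl | rfl <;> rcases hz with rfl | rfl | rfl <;>
    rcases hm with rfl | rfl | rfl <;> first | exact ⟨rfl, rfl⟩ | (exfalso; linarith)

/-- Any three of the vᵢ contain a middle one, up to sign, with √2 times it equal to the sum of the
other two, while their difference is √2 times the remaining vector. The values at the latter are at
most one, which is what `special_pair` needs. -/
theorem vval_special {y₁ y₂ : ℝ} (h : ∀ i, |vval y₁ y₂ i| ≤ 1) (h0 : ¬ (y₁ = 0 ∧ y₂ = 0))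
    {i j k : Fin 4} (hij : i < j) (hjk : j < k)
    (hi : vval y₁ y₂ i = 0 ∨ vval y₁ y₂ i = 1 ∨ vval y₁ y₂ i = -1)
    (hj : vval y₁ y₂ j = 0 ∨ vval y₁ y₂ j = 1 ∨ vval y₁ y₂ j = -1)
    (hk : vval y₁ y₂ k = 0 ∨ vval y₁ y₂ k = 1 ∨ vval y₁ y₂ k = -1) : False := by
  have hq := sqrt_two_mul_self
  have hq1 := sqrt_two_gt
  have hq2 := sqrt_two_lt
  set q := √2
  have e0 : vval y₁ y₂ 0 = q * y₁ := rfl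
  have e1 : vval y₁ y₂ 1 = y₁ + y₂ := rfl
  have e2 : vval y₁ y₂ 2 = q * y₂ := rfl
  have e3 : vval y₁ y₂ 3 = y₂ - y₁ := rfl
  have b0 := abs_le.1 (h 0)
  have b1 := abs_le.1 (h 1)
  have b2 := abs_le.1 (h 2)
  have b3 := abs_le.1 (h 3)
  have r1 : q * vval y₁ y₂ 1 = vval y₁ y₂ 0 + vval y₁ y₂ 2 := by rw [e0, e1, e2]; ring
  have r3 : q * vval y₁ y₂ 3 = vval y₁ y₂ 2 - vval y₁ y₂ 0 := by rw [e0, e3, e2]; ring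
  have r0 : q * vval y₁ y₂ 0 = vval y₁ y₂ 1 - vval y₁ y₂ 3 := by
    rw [e0, e1, e3]; linear_combination y₁ * hq
  have r2 : q * vval y₁ y₂ 2 = vval y₁ y₂ 1 + vval y₁ y₂ 3 := by
    rw [e2, e1, e3]; linear_combination y₂ * hq
  have hne : ¬ (vval y₁ y₂ 0 = 0 ∧ vval y₁ y₂ 2 = 0) := by
    rintro ⟨g0, g2⟩
    rw [e0] at g0
    rw [e2] at g2
    exact h0 ⟨(mul_eq_zero.1 g0).resolve_left (by linarith),
      (mul_eq_zero.1 g2).resolve_left (by linarith)⟩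
  have hne' : ¬ (vval y₁ y₂ 1 = 0 ∧ vval y₁ y₂ 3 = 0) := by
    rintro ⟨g1, g3⟩
    rw [g1, g3] at r0 r2
    exact hne ⟨(mul_eq_zero.1 (by simpa using r0)).resolve_left (by linarith),
      (mul_eq_zero.1 (by simpa using r2)).resolve_left (by linarith)⟩
  clear_value q
  generalize g0 : vval y₁ y₂ 0 = f0 at *
  generalize g1 : vval y₁ y₂ 1 = f1 at *
  generalize g2 : vval y₁ y₂ 2 = f2 at *
  generalize g3 : vval y₁ y₂ 3 = f3 at *
  have p0 : -1.5 ≤ q * f0 ∧ q * f0 ≤ 1.5 := by constructor <;> nlinarith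
  have p1 : -1.5 ≤ q * f1 ∧ q * f1 ≤ 1.5 := by constructor <;> nlinarith
  have p2 : -1.5 ≤ q * f2 ∧ q * f2 ≤ 1.5 := by constructor <;> nlinarith
  have p3 : -1.5 ≤ q * f3 ∧ q * f3 ≤ 1.5 := by constructor <;> nlinarith
  have hneg : ∀ {x : ℝ}, (x = 0 ∨ x = 1 ∨ x = -1) → (-x = 0 ∨ -x = 1 ∨ -x = -1) := by
    rintro x (rfl | rfl | rfl) <;> simp
  fin_cases i <;> fin_cases j <;> first | exact absurd hij (by decide) | skip
  all_goals fin_cases k <;> first | exact absurd hjk (by decide) | skip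
  all_goals
    simp only [Fin.isValue, Fin.zero_eta, Fin.mk_one, Fin.reduceFinMk, g0, g1, g2, g3] at hi hj hk
  · exact hne (special_pair hq1 hq2 hi hk hj r1 (by linarith) (by linarith))
  · have := special_pair hq1 hq2 hj (hneg hk) hi (by linarith) (by linarith) (by linarith)
    exact hne' ⟨this.1, by linarith [this.2]⟩
  · have := special_pair hq1 hq2 hj (hneg hi) hk (by linarith) (by linarith) (by linarith)
    exact hne ⟨by linarith [this.2], this.1⟩
  · exact hne' (special_pair hq1 hq2 hi hk hj r2 (by linarith) (by linarith))

/-- If ℓ vanishes on the last two coordinates, the signs of its other coordinates give an octagonal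
facet. Otherwise at most two of the four groups of points have two tight points and the rest have at
most one, which makes at most 2 + 2 + 1 + 1 = 6. -/
theorem IsFeasible.tight_subset_or_card_le {ℓ : (Fin 6 → ℝ) →ₗ[ℝ] ℝ} (h : IsFeasible ℓ) :
    (∃ s, tight ℓ ⊆ octFacet s) ∨ (tight ℓ).card ≤ 6 := by
  set X : Fin 4 → ℝ := fun i => ℓ (Pi.single (i.castLE (by norm_num)) 1) with hX
  set y₁ := ℓ (Pi.single 4 1)
  set y₂ := ℓ (Pi.single 5 1)
  have hval : ∀ i s ε, ℓ (configA 0 (lab i s ε)) = sg s * X i + sg ε * vval y₁ y₂ i :=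
    fun i s ε => linear_configA ℓ i s ε
  have hle : ∀ i s ε, sg s * X i + sg ε * vval y₁ y₂ i ≤ 1 := fun i s ε => hval i s ε ▸ h _
  by_cases h0 : y₁ = 0 ∧ y₂ = 0
  · left
    have hv : ∀ i, vval y₁ y₂ i = 0 := by
      rw [h0.1, h0.2]
      intro i
      fin_cases i <;> simp [vval]
    refine ⟨fun i => decide (0 < X i), fun k hk => ?_⟩
    rcases lab_cases k with rfl | ⟨i, s, ε, rfl⟩
    · exact absurd hk (zero_notMem_tight ℓ)
    · rw [mem_tight, hval, hv, mul_zero, add_zero] at hk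
      rw [lab_mem_octFacet]
      cases s
      · simp only [sg_false] at hk
        have : ¬ 0 < X i := by linarith
        simp [this]
      · simp only [sg_true] at hk
        have : 0 < X i := by linarith
        simp [this]
  · right
    have habs : ∀ i, |vval y₁ y₂ i| ≤ 1 := by
      intro i
      have h1 := hle i true true
      have h2 := hle i true false
      have h3 := hle i false true
      have h4 := hle i false false
      simp only [sg_true, sg_false] at h1 h2 h3 h4
      rw [abs_le]
      constructor <;> linarith
    set z : Fin 4 → ℕ := fun i => ∑ s, ∑ ε, if sg s * X i + sg ε * vval y₁ y₂ i = 1 then 1 else 0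
      with hz
    have hcard : (tight ℓ).card = ∑ i, z i := by
      rw [tight, Finset.card_filter, sum_lab, configA_zero, map_zero, if_neg zero_ne_one, zero_add]
      simp only [hval, hz]
    have hz2 : ∀ i, z i ≤ 2 := fun i => (tight_local_le _ _ (hle i)).1
    have hz1 : ∀ i, z i ≤ 1 ∨
        (vval y₁ y₂ i = 0 ∨ vval y₁ y₂ i = 1 ∨ vval y₁ y₂ i = -1) := by
      intro i
      by_cases h1 : vval y₁ y₂ i = 0
      · exact Or.inr (Or.inl h1)
      by_cases h2 : vval y₁ y₂ i = 1
      · exact Or.inr (Or.inr (Or.inl h2))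
      by_cases h3 : vval y₁ y₂ i = -1
      · exact Or.inr (Or.inr (Or.inr h3))
      exact Or.inl ((tight_local_le _ _ (hle i)).2 h1 h2 h3)
    have hno : ∀ i j k, i < j → j < k → z i ≤ 1 ∨ z j ≤ 1 ∨ z k ≤ 1 := by
      intro i j k hij hjk
      rcases hz1 i with h1 | h1
      · exact Or.inl h1
      rcases hz1 j with h2 | h2
      · exact Or.inr (Or.inl h2)
      rcases hz1 k with h3 | h3
      · exact Or.inr (Or.inr h3)
      exact (vval_special habs h0 hij hjk h1 h2 h3).elim
    rw [hcard, Fin.sum_univ_four]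
    have a1 := hno 0 1 2 (by decide) (by decide)
    have a2 := hno 0 1 3 (by decide) (by decide)
    have a3 := hno 0 2 3 (by decide) (by decide)
    have a4 := hno 1 2 3 (by decide) (by decide)
    have b0 := hz2 0
    have b1 := hz2 1
    have b2 := hz2 2
    have b3 := hz2 3
    clear_value z
    omega

/-- The linear functional that is constant on an octagonal facet. -/
noncomputable def octFunctional (s : Fin 4 → Bool) : (Fin 6 → ℝ) →ₗ[ℝ] ℝ :=
  mkLinear (fun i => sg (s i)) 0 0

theorem vval_zero (i : Fin 4) : vval 0 0 i = 0 := by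
  fin_cases i <;> simp [vval]

theorem octFunctional_lab (s : Fin 4 → Bool) (i : Fin 4) (b ε : Bool) :
    octFunctional s (configA 0 (lab i b ε)) = if b = s i then 1 else -1 := by
  rw [octFunctional, mkLinear_configA, vval_zero]
  generalize s i = c
  cases b <;> cases c <;> simp

theorem isFeasible_octFunctional (s : Fin 4 → Bool) : IsFeasible (octFunctional s) := by
  intro k
  rcases lab_cases k with rfl | ⟨i, b, ε, rfl⟩
  · rw [configA_zero, map_zero]; exact zero_le_one
  · rw [octFunctional_lab]
    split_ifs <;> norm_num

theorem tight_octFunctional (s : Fin 4 → Bool) : tight (octFunctional s) = octFacet s := by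
  ext k
  rw [mem_tight]
  rcases lab_cases k with rfl | ⟨i, b, ε, rfl⟩
  · rw [configA_zero, map_zero]
    refine ⟨fun h => absurd h zero_ne_one, fun h => ?_⟩
    obtain ⟨i, ε, h⟩ := mem_octFacet.1 h
    exact absurd h.symm (lab_ne_zero _ _ _)
  · rw [octFunctional_lab, lab_mem_octFacet]
    split_ifs with h
    · simp [h]
    · norm_num [h]

theorem affineSpan_configA : affineSpan ℝ (Set.range (configA 0)) = ⊤ := by
  by_contra h
  obtain ⟨g, h0, x, hx⟩ := AffineSubspace.exists_affineMap_eq_zero h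
  apply hx
  have h1 : ∀ k, g (configA 0 k) = 0 := fun k => h0 _ (subset_affineSpan ℝ _ ⟨k, rfl⟩)
  have e : ∀ x, g x = g.linear x + g 0 := fun x => congrFun g.decomp x
  have hz : g 0 = 0 := by simpa [configA_zero] using h1 0
  have hl : ∀ i s ε, sg s * g.linear (Pi.single (i.castLE (by norm_num)) 1) +
      sg ε * vval (g.linear (Pi.single 4 1)) (g.linear (Pi.single 5 1)) i = 0 := by
    intro i s ε
    have := h1 (lab i s ε)
    rwa [e, hz, add_zero, linear_configA] at this
  rw [e, hz, linear_eq_mkLinear g.linear, add_zero]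
  have hX : ∀ i : Fin 4, g.linear (Pi.single (i.castLE (by norm_num)) 1) = 0 := by
    intro i
    have h2 := hl i true true
    have h3 := hl i true false
    simp only [sg_true, sg_false] at h2 h3
    linarith
  have hv : ∀ i, vval (g.linear (Pi.single 4 1)) (g.linear (Pi.single 5 1)) i = 0 := by
    intro i
    have h2 := hl i true true
    rw [hX] at h2
    simpa using h2
  have hq := sqrt_two_gt
  have h4 : g.linear (Pi.single 4 1) = 0 :=
    (mul_eq_zero.1 (hv 0)).resolve_left (by linarith)
  have h5 : g.linear (Pi.single 5 1) = 0 :=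
    (mul_eq_zero.1 (hv 2)).resolve_left (by linarith)
  rw [h4, h5]
  simp only [hX]
  simp [mkLinear]

theorem configA_neg (i : Fin 4) (s ε : Bool) :
    configA 0 (lab i (!s) (!ε)) = -configA 0 (lab i s ε) := by
  ext j
  have h1 := linear_configA (LinearMap.proj j) i s ε
  have h2 := linear_configA (LinearMap.proj j) i (!s) (!ε)
  simp only [LinearMap.proj_apply, sg_not] at h1 h2
  rw [Pi.neg_apply, h1, h2]
  ring

theorem isClosed_hull_configA : IsClosed (hull (configA 0)) := by
  rw [hull_eq_cellHull_univ]
  exact isClosed_cellHull _ _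

/-- The hull is centrally symmetric, so the origin is the midpoint of an interior point and its
mirror image. -/
theorem zero_mem_interior_hull : (0 : Fin 6 → ℝ) ∈ interior (hull (configA 0)) := by
  have hc : Convex ℝ (hull (configA 0)) := convex_convexHull ℝ _
  obtain ⟨y, hy⟩ := interior_convexHull_nonempty_iff_affineSpan_eq_top.2 affineSpan_configA
  have hneg : -y ∈ hull (configA 0) := by
    have h1 : -Set.range (configA 0) = Set.range (configA 0) := by
      have h2 : ∀ k, -configA 0 k ∈ Set.range (configA 0) := by
        intro k
        rcases lab_cases k with rfl | ⟨i, s, ε, rfl⟩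
        · exact ⟨0, by simp [configA_zero]⟩
        · exact ⟨_, configA_neg i s ε⟩
      ext x
      constructor
      · rintro ⟨k, hk⟩
        have := h2 k
        rwa [hk, neg_neg] at this
      · rintro ⟨k, rfl⟩
        exact h2 k
    rw [hull, ← h1, convexHull_neg]
    simpa using interior_subset hy
  have := hc.combo_interior_self_mem_interior (a := 1 / 2) (b := 1 / 2) hy hneg
    (by norm_num) (by norm_num) (by norm_num)
  simpa using this

theorem IsFeasible.le {ℓ : (Fin 6 → ℝ) →ₗ[ℝ] ℝ} (hℓ : IsFeasible ℓ) {x : Fin 6 → ℝ}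
    (hx : x ∈ hull (configA 0)) : ℓ x ≤ 1 := by
  obtain ⟨c, hc⟩ := mem_hull_iff.1 hx
  rw [hc.linear, ← hc.sum_one]
  exact Finset.sum_le_sum fun k _ => mul_le_of_le_one_right (hc.nonneg k) (hℓ k)

theorem IsFeasible.mem_frontier {ℓ : (Fin 6 → ℝ) →ₗ[ℝ] ℝ} (hℓ : IsFeasible ℓ) {x : Fin 6 → ℝ}
    (hx : x ∈ hull (configA 0)) (h1 : ℓ x = 1) : x ∈ frontier (hull (configA 0)) := by
  rw [isClosed_hull_configA.frontier_eq]
  refine ⟨hx, fun hi => ?_⟩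
  have hcont : Tendsto (fun t : ℝ => t • x) (𝓝[>] 1) (𝓝 x) := by
    have : Continuous fun t : ℝ => t • x := by fun_prop
    have := this.tendsto 1
    rw [one_smul] at this
    exact this.mono_left nhdsWithin_le_nhds
  obtain ⟨t, h2, h3⟩ := ((hcont.eventually (mem_interior_iff_mem_nhds.1 hi)).and
    self_mem_nhdsWithin).exists
  have := hℓ.le h2
  rw [map_smul, h1, smul_eq_mul, mul_one] at this
  exact absurd this (not_le.2 h3)

/-- The origin is interior. If it had positive weight, spreading this weight over the hull would put
a neighbourhood of `x` into the hull. -/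
theorem IsRep.eq_zero_of_mem_frontier {σ : Finset (Fin 17)} {c : Fin 17 → ℝ} {x : Fin 6 → ℝ}
    (h : IsRep (configA 0) σ c x) (hx : x ∈ frontier (hull (configA 0))) : c 0 = 0 := by
  by_contra h0
  have hpos : 0 < c 0 := lt_of_le_of_ne (h.nonneg 0) (Ne.symm h0)
  rw [isClosed_hull_configA.frontier_eq] at hx
  apply hx.2
  have hcv : Convex ℝ (hull (configA 0)) := convex_convexHull ℝ _
  have key : ∀ y ∈ hull (configA 0), x + c 0 • y ∈ hull (configA 0) := by
    intro y hy
    have h1 := hcv.sum_mem (t := Finset.univ) (w := c) (z := fun k => if k = 0 then y else configA 0 k)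
      (fun k _ => h.nonneg k) h.sum_one (fun k _ => by
        split_ifs
        · exact hy
        · exact subset_convexHull ℝ _ ⟨k, rfl⟩)
    convert h1 using 1
    rw [← h.sum_smul, sum_lab, sum_lab]
    simp only [lab_ne_zero, if_true, if_false, configA_zero, smul_zero, zero_add]
    rw [add_comm]
  rw [mem_interior]
  refine ⟨(fun z => (c 0)⁻¹ • (z - x)) ⁻¹' interior (hull (configA 0)), fun z hz => ?_, ?_, ?_⟩
  · have := key _ (interior_subset hz)
    rwa [smul_smul, mul_inv_cancel₀ h0, one_smul, add_sub_cancel] at this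
  · exact isOpen_interior.preimage (by fun_prop)
  · simpa using zero_mem_interior_hull

theorem IsFeasible.isIndep_insert {ℓ : (Fin 6 → ℝ) →ₗ[ℝ] ℝ} {κ : Finset (Fin 17)}
    (hκ : κ ⊆ tight ℓ) (hi : IsIndep (configA 0) κ) : IsIndep (configA 0) (insert 0 κ) := by
  rw [isIndep_iff] at hi ⊢
  intro d hd h0
  refine hi d hd fun k hk => ?_
  by_cases hk0 : k = 0
  · subst hk0
    have h1 := hd.sum_linear ℓ
    have h2 := hd.1
    rw [sum_lab] at h1 h2
    rw [configA_zero, map_zero, mul_zero, zero_add] at h1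
    have h3 : ∀ i s ε, d (lab i s ε) * ℓ (configA 0 (lab i s ε)) = d (lab i s ε) := by
      intro i s ε
      by_cases h : lab i s ε ∈ κ
      · rw [mem_tight.1 (hκ h), mul_one]
      · rw [h0 _ (by simp [h, lab_ne_zero]), zero_mul]
    simp only [h3] at h1
    linarith
  · exact h0 k (by simp [hk, hk0])

/-- Lifting the origin to 0 and all other points to 1 gives the subdivision into cones from the
origin over the facets, so the covering property of regular subdivisions finds the facet over `x`.
-/
theorem exists_facet {x : Fin 6 → ℝ} (hx : x ∈ hull (configA 0)) :
    ∃ ℓ c, IsFeasible ℓ ∧ IsRep (configA 0) (insert 0 (tight ℓ)) c x ∧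
      ((∃ s, tight ℓ ⊆ octFacet s) ∨ ((tight ℓ).card = 6 ∧ IsIndep (configA 0) (tight ℓ))) := by
  obtain ⟨σ, ⟨hspan, g, hg, hσ⟩, c, hc⟩ :=
    exists_rep_regularCells affineSpan_configA (fun k => if k = 0 then 0 else 1) hx
  have e : ∀ x, g x = g.linear x + g 0 := fun x => congrFun g.decomp x
  have hg0 : g 0 ≤ 0 := by simpa [configA_zero] using hg 0
  -- A spanning cell without the origin would force the affine function to be constantly 1, contrary
  -- to its value at the origin.
  have h0σ : 0 ∈ σ := by
    by_contra h0
    have := affineMap_eq_of_span hspan (g := g) (g' := AffineMap.const ℝ _ 1) (fun y hy => by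
      obtain ⟨k, hk, rfl⟩ := hy
      have hk0 : k ≠ 0 := fun h => h0 (h ▸ hk)
      simpa [hk0] using (hσ k).1 hk) 0
    simp only [AffineMap.const_apply] at this
    linarith
  have hz : g 0 = 0 := by simpa [configA_zero] using (hσ 0).1 h0σ
  have hf : IsFeasible g.linear := by
    intro k
    have := hg k
    rw [e, hz, add_zero] at this
    refine this.trans ?_
    dsimp only
    split_ifs <;> norm_num
  have hσ' : σ = insert 0 (tight g.linear) := by
    ext k
    rw [hσ, Finset.mem_insert, mem_tight, e, hz, add_zero]
    by_cases hk : k = 0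
    · simp [hk, configA_zero]
    · simp [hk]
  subst hσ'
  refine ⟨g.linear, c, hf, hc, hf.tight_subset_or_card_le.imp_right fun h => ?_⟩
  have h1 := card_le_of_spanning hspan
  rw [Finset.card_insert_of_notMem (zero_notMem_tight _)] at h1
  simp at h1
  have h2 : (tight g.linear).card = 6 := le_antisymm h (by omega)
  refine ⟨h2, (indep_of_spanning_of_card hspan ?_).mono (Finset.subset_insert _ _)⟩
  rw [Finset.card_insert_of_notMem (zero_notMem_tight _), h2]
  simp

/-! ### Finite combinatorics of the rhombus tilings of an octagon. -/

/-- The patterns of choices at the circuits of `v₁, …, v₄` that come from a linear functional on the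
space of dependences. -/
def isGood (q : Fin 4 → Bool) : Bool :=
  (!(q 0 ^^ q 2) || (q 0 ^^ q 1)) && (!(q 0 ^^ q 3) || (q 0 ^^ q 2))

/-- `S` contains the positive part of the `l`-th circuit. -/
def HasTriple (l : Fin 4) (b : Bool) (S : Fin 4 → Bool → Bool) : Prop :=
  ∀ i, i ≠ l → S i (rsgn l i ^^ b) = true

instance (l : Fin 4) (b : Bool) (S : Fin 4 → Bool → Bool) : Decidable (HasTriple l b S) :=
  inferInstanceAs (Decidable (∀ i, i ≠ l → S i (rsgn l i ^^ b) = true))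

/-- `S` contains none of the parts of circuits that are given by `q`. -/
def LocAvoids (q : Fin 4 → Bool) (S : Fin 4 → Bool → Bool) : Prop := ∀ l, ¬ HasTriple l (q l) S

instance (q : Fin 4 → Bool) (S : Fin 4 → Bool → Bool) : Decidable (LocAvoids q S) :=
  inferInstanceAs (Decidable (∀ l, ¬ HasTriple l (q l) S))

/-- The number of elements of `S`. -/
def locCard (S : Fin 4 → Bool → Bool) : ℕ :=
  ((S 0 true).toNat + (S 0 false).toNat) + ((S 1 true).toNat + (S 1 false).toNat) +
    ((S 2 true).toNat + (S 2 false).toNat) + ((S 3 true).toNat + (S 3 false).toNat)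

/-- Both elements of the `i`-th and `j`-th pair and one of each other pair. -/
def tile (i j : Fin 4) (e : Fin 4 → Bool) (m : Fin 4) (ε : Bool) : Bool :=
  decide (m = i) || decide (m = j) || (e m == ε)

/-- One element of the `l`-th pair together with a cell of the triangulation of the `l`-th circuit. -/
def hexTile (l : Fin 4) (ε : Bool) (i : Fin 4) (b : Bool) (m : Fin 4) (x : Bool) : Bool :=
  if m = l then x == ε else !decide (m = i) || (x == (rsgn l i ^^ !b))

/-- Quantifiers over functions are unrolled into Booleans here and below to make the kernel decision
of the finite statements cheap. -/
theorem forall_pattern {p : (Fin 4 → Bool) → Prop} : (∀ q, p q) ↔ ∀ a b c d, p ![a, b, c, d] := by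
  refine ⟨fun h _ _ _ _ => h _, fun h q => ?_⟩
  have : q = ![q 0, q 1, q 2, q 3] := by ext i; fin_cases i <;> rfl
  rw [this]
  exact h _ _ _ _

theorem forall_loc {p : (Fin 4 → Bool → Bool) → Prop} :
    (∀ S, p S) ↔ ∀ a b c d a' b' c' d',
      p fun i ε => cond ε (![a, b, c, d] i) (![a', b', c', d'] i) := by
  refine ⟨fun h _ _ _ _ _ _ _ _ => h _, fun h S => ?_⟩
  have : S = fun i ε => cond ε (![S 0 true, S 1 true, S 2 true, S 3 true] i)
      (![S 0 false, S 1 false, S 2 false, S 3 false] i) := by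
    ext i ε; cases ε <;> fin_cases i <;> rfl
  rw [this]
  exact h _ _ _ _ _ _ _ _

theorem exists_pattern {p : (Fin 4 → Bool) → Prop} : (∃ q, p q) ↔ ∃ a b c d, p ![a, b, c, d] := by
  have := forall_pattern (p := fun q => ¬ p q)
  rw [← not_iff_not]
  push Not
  exact this

/-- A tiling of the octagon contains a rhombus for each of the six pairs of directions. The bad
patterns are those that exclude all rhombi of some pair. -/
theorem isGood_of_tiles : ∀ q, (∀ i j, i < j → ∃ e, LocAvoids q (tile i j e)) → isGood q = true := by
  simp only [forall_pattern, exists_pattern]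
  decide +kernel

theorem locCard_tile : ∀ i j, i < j → ∀ e, locCard (tile i j e) = 6 := by
  simp only [forall_pattern]
  decide +kernel

/-- The part of a hexagon that is not forbidden does occur in the tiling, so the tiling determines
the pattern. -/
theorem exists_tile_of_hasTriple : ∀ q, isGood q = true → ∀ l, ∃ i j, i < j ∧ ∃ e,
    LocAvoids q (tile i j e) ∧ HasTriple l (!q l) (tile i j e) := by
  simp only [forall_pattern, exists_pattern]
  decide +kernel

set_option synthInstance.maxHeartbeats 400000 in
set_option synthInstance.maxSize 2000 in
-- This is used for covering: a support that avoids the forbidden parts always fits into a rhombus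
-- of the tiling.
theorem exists_tile_ge : ∀ q, isGood q = true → ∀ S, LocAvoids q S → ∃ i j, i < j ∧ ∃ e,
    LocAvoids q (tile i j e) ∧ ∀ m x, S m x = true → tile i j e m x = true := by
  simp only [forall_pattern, exists_pattern, forall_loc]
  decide +kernel

set_option synthInstance.maxHeartbeats 400000 in
set_option synthInstance.maxSize 2000 in
-- When the l-th hexagon is flippable, the cells around it are three rhombi joined with one end `ε`
-- of the l-th segment. The flip keeps this end, so the link is the same on both sides.
theorem exists_hexTile_iff : ∀ q, isGood q = true → ∀ l, isGood (Function.update q l (!q l)) = true →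
    ∃ ε, (∀ S, locCard S = 6 → ((LocAvoids q S ∧ HasTriple l (!q l) S) ↔
        ∃ i, i ≠ l ∧ ∀ m x, S m x = hexTile l ε i (q l) m x)) ∧
      (∀ S, locCard S = 6 → ((LocAvoids (Function.update q l (!q l)) S ∧ HasTriple l (q l) S) ↔
        ∃ i, i ≠ l ∧ ∀ m x, S m x = hexTile l ε i (!q l) m x)) := by
  simp only [forall_pattern, forall_loc]
  decide +kernel

theorem locCard_hexTile : ∀ l ε i, i ≠ l → ∀ b, locCard (hexTile l ε i b) = 6 := by
  decide +kernel

/-! ### Transfer between label sets and local patterns. -/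

/-- The elements of `κ` in the facet `s`. -/
def locOf (s : Fin 4 → Bool) (κ : Finset (Fin 17)) (i : Fin 4) (ε : Bool) : Bool :=
  decide (lab i (s i) ε ∈ κ)

/-- The labels in the facet `s` that are given by `S`. -/
def ofLoc (s : Fin 4 → Bool) (S : Fin 4 → Bool → Bool) : Finset (Fin 17) :=
  Finset.univ.filter fun k => ∃ i ε, k = lab i (s i) ε ∧ S i ε = true

theorem lab_mem_ofLoc {s : Fin 4 → Bool} {S : Fin 4 → Bool → Bool} {i : Fin 4} {b ε : Bool} :
    lab i b ε ∈ ofLoc s S ↔ b = s i ∧ S i ε = true := by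
  simp only [ofLoc, Finset.mem_filter, Finset.mem_univ, true_and]
  constructor
  · rintro ⟨j, ε', h, h'⟩
    obtain ⟨rfl, rfl, rfl⟩ := lab_inj.1 h
    exact ⟨rfl, h'⟩
  · rintro ⟨rfl, h⟩
    exact ⟨i, ε, rfl, h⟩

theorem zero_notMem_ofLoc (s : Fin 4 → Bool) (S : Fin 4 → Bool → Bool) : 0 ∉ ofLoc s S := by
  simp only [ofLoc, Finset.mem_filter, Finset.mem_univ, true_and, not_exists, not_and]
  exact fun i ε h => absurd h.symm (lab_ne_zero _ _ _)

theorem ofLoc_subset_octFacet (s : Fin 4 → Bool) (S : Fin 4 → Bool → Bool) :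
    ofLoc s S ⊆ octFacet s := by
  intro k hk
  rcases lab_cases k with rfl | ⟨i, b, ε, rfl⟩
  · exact absurd hk (zero_notMem_ofLoc s S)
  · exact lab_mem_octFacet.2 (lab_mem_ofLoc.1 hk).1

theorem zero_notMem_octFacet (s : Fin 4 → Bool) : 0 ∉ octFacet s := by
  rw [← tight_octFunctional]
  exact zero_notMem_tight _

theorem locOf_ofLoc (s : Fin 4 → Bool) (S : Fin 4 → Bool → Bool) : locOf s (ofLoc s S) = S := by
  ext i ε
  simp [locOf, lab_mem_ofLoc]

theorem ofLoc_locOf {s : Fin 4 → Bool} {κ : Finset (Fin 17)} (h : κ ⊆ octFacet s) :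
    ofLoc s (locOf s κ) = κ := by
  ext k
  rcases lab_cases k with rfl | ⟨i, b, ε, rfl⟩
  · exact iff_of_false (zero_notMem_ofLoc _ _) fun h0 => zero_notMem_octFacet s (h h0)
  · rw [lab_mem_ofLoc, locOf, decide_eq_true_iff]
    constructor
    · rintro ⟨rfl, h⟩
      exact h
    · intro hk
      obtain rfl := lab_mem_octFacet.1 (h hk)
      exact ⟨rfl, hk⟩

theorem card_eq_locCard {s : Fin 4 → Bool} {κ : Finset (Fin 17)} (h : κ ⊆ octFacet s) :
    κ.card = locCard (locOf s κ) := by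
  have h1 : κ.card = ∑ k, if k ∈ κ then 1 else 0 := by simp
  have h2 : ∀ i b ε, lab i b ε ∈ κ ↔ b = s i ∧ locOf s κ i ε = true := by
    intro i b ε
    rw [← lab_mem_ofLoc, ofLoc_locOf h]
  have h3 : ∀ i, (∑ b, ∑ ε, if lab i b ε ∈ κ then 1 else 0) =
      (locOf s κ i true).toNat + (locOf s κ i false).toNat := by
    intro i
    simp only [h2]
    rw [Finset.sum_eq_single (s i) (fun b _ hb => by simp [hb]) (by simp)]
    rw [Fintype.sum_bool]
    cases locOf s κ i true <;> cases locOf s κ i false <;> simp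
  rw [h1, sum_lab, if_neg fun h0 => zero_notMem_octFacet s (h h0)]
  simp only [h3, Fin.sum_univ_four, locCard, zero_add]

theorem hexTriple_subset_iff_hasTriple {l : Fin 4} {s : Fin 4 → Bool} {b : Bool}
    {κ : Finset (Fin 17)} : hexTriple l s b ⊆ κ ↔ HasTriple l b (locOf s κ) := by
  simp only [hexTriple_subset_iff, HasTriple, locOf, decide_eq_true_iff]

/-! ### Boundary triangulations and cones from global choices. -/

/-- A choice of one of the two parts of each hexagon: `o l s` is the choice at the hexagon that avoids
the index `l` in the facet `s`. -/
def IsHexChoice (o : Fin 4 → (Fin 4 → Bool) → Bool) : Prop :=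
  ∀ l s b, o l (Function.update s l b) = o l s

theorem IsHexChoice.congr {o : Fin 4 → (Fin 4 → Bool) → Bool} (ho : IsHexChoice o) {l : Fin 4}
    {s s' : Fin 4 → Bool} (h : ∀ i, i ≠ l → s i = s' i) : o l s = o l s' := by
  have : s' = Function.update s l (s' l) := by
    ext i
    by_cases hi : i = l
    · subst hi; simp
    · simp [hi, h i hi]
  rw [this, ho]

/-- `κ` contains none of the chosen parts of the hexagons. -/
def Avoids (o : Fin 4 → (Fin 4 → Bool) → Bool) (κ : Finset (Fin 17)) : Prop :=
  ∀ l s, ¬ hexTriple l s (o l s) ⊆ κ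

theorem Avoids.mono {o : Fin 4 → (Fin 4 → Bool) → Bool} {κ κ' : Finset (Fin 17)}
    (h : Avoids o κ) (hs : κ' ⊆ κ) : Avoids o κ' := fun l s h' => h l s (h'.trans hs)

theorem Avoids.loc {o : Fin 4 → (Fin 4 → Bool) → Bool} {κ : Finset (Fin 17)}
    (h : Avoids o κ) (s : Fin 4 → Bool) : LocAvoids (fun l => o l s) (locOf s κ) :=
  fun l hl => h l s (hexTriple_subset_iff_hasTriple.2 hl)

/-- A forbidden triple inside the facet `s` comes from a facet agreeing with `s` off its index `l`,
and both triple and choice ignore the sign at `l`. -/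
theorem IsHexChoice.avoids_iff {o : Fin 4 → (Fin 4 → Bool) → Bool} (ho : IsHexChoice o)
    {s : Fin 4 → Bool} {κ : Finset (Fin 17)} (hκ : κ ⊆ octFacet s) :
    Avoids o κ ↔ LocAvoids (fun l => o l s) (locOf s κ) := by
  refine ⟨fun h => h.loc s, fun h l s' h' => ?_⟩
  have hc := congr_of_hexTriple_subset (h'.trans hκ)
  apply h l
  rw [← hexTriple_subset_iff_hasTriple]
  rwa [hexTriple_congr hc, ho.congr hc] at h'

/-- `κ` avoids one of the two parts of each hexagon, so dependences in a facet cannot be supported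
on two such sets. -/
theorem Avoids.dep_eq_zero {o : Fin 4 → (Fin 4 → Bool) → Bool} {κ κ' : Finset (Fin 17)}
    (h : Avoids o κ) (h' : Avoids o κ') {s : Fin 4 → Bool} {d : Fin 17 → ℝ}
    (hd : IsDep (configA 0) d) (hs : ∀ k, k ∉ octFacet s → k ≠ 0 → d k = 0)
    (hp : ∀ k, k ≠ 0 → 0 < d k → k ∈ κ) (hn : ∀ k, k ≠ 0 → d k < 0 → k ∈ κ') : d = 0 := by
  by_contra h0
  obtain ⟨l, b, h1, h2⟩ := exists_hexTriple hd hs h0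
  have hz : ∀ b, ∀ k ∈ hexTriple l s b, k ≠ 0 := by
    rintro b k hk rfl
    exact zero_notMem_octFacet s (hexTriple_subset_octFacet l s b hk)
  have h3 : hexTriple l s b ⊆ κ := fun k hk => hp k (hz _ k hk) (h1 k hk)
  have h4 : hexTriple l s (!b) ⊆ κ' := fun k hk => hn k (hz _ k hk) (h2 k hk)
  by_cases hb : o l s = b
  · exact h l s (hb ▸ h3)
  · have : o l s = !b := by
      revert hb; cases o l s <;> cases b <;> simp
    exact h' l s (this ▸ h4)

theorem Avoids.isIndep {o : Fin 4 → (Fin 4 → Bool) → Bool} {κ : Finset (Fin 17)}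
    (h : Avoids o κ) {s : Fin 4 → Bool} (hκ : κ ⊆ octFacet s) : IsIndep (configA 0) κ := by
  rw [isIndep_iff]
  intro d hd h0
  refine h.dep_eq_zero h hd (s := s) (fun k hk _ => h0 k fun hk' => hk (hκ hk')) ?_ ?_
  · intro k _ hk
    by_contra hn
    exact hk.ne' (h0 k hn)
  · intro k _ hk
    by_contra hn
    exact hk.ne (h0 k hn)

/-- If one part of a circuit lies in a supporting hyperplane, so does the other, and a simplex facet
would contain a dependence. Simplex facets thus never meet the constraints of a choice. -/
theorem IsFeasible.not_hexTriple_subset {ℓ : (Fin 6 → ℝ) →ₗ[ℝ] ℝ} (hℓ : IsFeasible ℓ)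
    (hi : IsIndep (configA 0) (tight ℓ)) (l : Fin 4) (s : Fin 4 → Bool) (b : Bool) :
    ¬ hexTriple l s b ⊆ tight ℓ := by
  intro h
  have hd := isDep_hexDep l s b
  have h1 : ∑ k, hexDep l s b k * (ℓ (configA 0 k) - 1) = 0 := by
    simp only [mul_sub, Finset.sum_sub_distrib, hd.sum_linear ℓ, mul_one, hd.1, sub_zero]
  have h2 : ∀ k, 0 ≤ hexDep l s b k * (ℓ (configA 0 k) - 1) := by
    intro k
    by_cases hk : 0 < hexDep l s b k
    · rw [mem_tight.1 (h ((hexDep_pos_iff _ _ _ _).1 hk)), sub_self, mul_zero]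
    · exact mul_nonneg_of_nonpos_of_nonpos (not_lt.1 hk) (by linarith [hℓ k])
  have h3 := (Finset.sum_eq_zero_iff_of_nonneg fun k _ => h2 k).1 h1
  apply hexDep_ne_zero l s b
  refine isIndep_iff.1 hi _ hd fun k hk => ?_
  refine (mul_eq_zero.1 (h3 k (Finset.mem_univ k))).resolve_right fun h4 => hk ?_
  rw [mem_tight]
  linarith

open Classical in
/-- The cells of the triangulation of the boundary that is given by the choices `o`. -/
noncomputable def boundaryCells (o : Fin 4 → (Fin 4 → Bool) → Bool) : Finset (Finset (Fin 17)) :=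
  Finset.univ.filter fun κ => κ.card = 6 ∧ IsIndep (configA 0) κ ∧
    (∃ ℓ, IsFeasible ℓ ∧ κ ⊆ tight ℓ) ∧ Avoids o κ

theorem mem_boundaryCells {o : Fin 4 → (Fin 4 → Bool) → Bool} {κ : Finset (Fin 17)} :
    κ ∈ boundaryCells o ↔ κ.card = 6 ∧ IsIndep (configA 0) κ ∧
      (∃ ℓ, IsFeasible ℓ ∧ κ ⊆ tight ℓ) ∧ Avoids o κ := by
  simp [boundaryCells]

theorem zero_notMem_of_mem_boundaryCells {o : Fin 4 → (Fin 4 → Bool) → Bool} {κ : Finset (Fin 17)}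
    (h : κ ∈ boundaryCells o) : 0 ∉ κ := by
  obtain ⟨-, -, ⟨ℓ, -, h⟩, -⟩ := mem_boundaryCells.1 h
  exact fun h0 => zero_notMem_tight ℓ (h h0)

theorem mem_boundaryCells_of_octFacet {o : Fin 4 → (Fin 4 → Bool) → Bool} {κ : Finset (Fin 17)}
    {s : Fin 4 → Bool} (hκ : κ ⊆ octFacet s) :
    κ ∈ boundaryCells o ↔ κ.card = 6 ∧ Avoids o κ := by
  rw [mem_boundaryCells]
  exact ⟨fun h => ⟨h.1, h.2.2.2⟩, fun h => ⟨h.1, h.2.isIndep hκ,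
    ⟨_, isFeasible_octFunctional s, by rwa [tight_octFunctional]⟩, h.2⟩⟩

theorem IsHexChoice.ofLoc_mem_boundaryCells {o : Fin 4 → (Fin 4 → Bool) → Bool}
    (ho : IsHexChoice o) {s : Fin 4 → Bool} {S : Fin 4 → Bool → Bool} :
    ofLoc s S ∈ boundaryCells o ↔ locCard S = 6 ∧ LocAvoids (fun l => o l s) S := by
  rw [mem_boundaryCells_of_octFacet (ofLoc_subset_octFacet s S),
    ho.avoids_iff (ofLoc_subset_octFacet s S), card_eq_locCard (ofLoc_subset_octFacet s S),
    locOf_ofLoc]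

/-- A dependence in a supporting hyperplane vanishes if its positive part lies in a boundary cell
and its negative part avoids the same parts of hexagons. -/
theorem dep_eq_zero_of_mem_boundaryCells {o : Fin 4 → (Fin 4 → Bool) → Bool}
    {κ κ' : Finset (Fin 17)} (hκ : κ ∈ boundaryCells o) (hκ' : Avoids o κ')
    {ℓ : (Fin 6 → ℝ) →ₗ[ℝ] ℝ} (hℓ : IsFeasible ℓ) (ht : κ ⊆ tight ℓ) {d : Fin 17 → ℝ}
    (hd : IsDep (configA 0) d) (h0 : ∀ k, k ∉ tight ℓ → d k = 0)
    (hp : ∀ k, k ≠ 0 → 0 < d k → k ∈ κ) (hn : ∀ k, k ≠ 0 → d k < 0 → k ∈ κ') : d = 0 := by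
  obtain ⟨hcard, hi, -, hav⟩ := mem_boundaryCells.1 hκ
  rcases hℓ.tight_subset_or_card_le with ⟨s, hs⟩ | hc
  · exact hav.dep_eq_zero hκ' hd (fun k hk _ => h0 k fun h => hk (hs h)) hp hn
  · obtain rfl := Finset.eq_of_subset_of_card_le ht (hcard ▸ hc)
    exact isIndep_iff.1 hi d hd h0

theorem IsRep.linear_of_subset_tight {ℓ : (Fin 6 → ℝ) →ₗ[ℝ] ℝ} {κ : Finset (Fin 17)}
    (ht : κ ⊆ tight ℓ) {c : Fin 17 → ℝ} {x : Fin 6 → ℝ}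
    (h : IsRep (configA 0) (insert 0 κ) c x) : ℓ x = 1 - c 0 := by
  have h1 := h.sum_one
  rw [h.linear]
  rw [sum_lab] at h1 ⊢
  rw [configA_zero, map_zero, mul_zero, zero_add, ← h1, add_sub_cancel_left]
  refine Finset.sum_congr rfl fun i _ => Finset.sum_congr rfl fun s _ =>
    Finset.sum_congr rfl fun ε _ => ?_
  by_cases hk : lab i s ε ∈ κ
  · rw [mem_tight.1 (ht hk), mul_one]
  · rw [h.supp _ (by simp [hk, lab_ne_zero]), zero_mul]

/-- The difference 1 - c 0 - ℓ x is a sum of non-negative slacks of the points other than the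
origin. If it vanishes, weights off the tight points vanish too. -/
theorem IsFeasible.le_of_rep {ℓ : (Fin 6 → ℝ) →ₗ[ℝ] ℝ} (hℓ : IsFeasible ℓ) {σ : Finset (Fin 17)}
    {c : Fin 17 → ℝ} {x : Fin 6 → ℝ} (h : IsRep (configA 0) σ c x) :
    ℓ x ≤ 1 - c 0 ∧ (1 - c 0 ≤ ℓ x → ∀ k, k ≠ 0 → k ∉ tight ℓ → c k = 0) := by
  have h1 : 1 - c 0 - ℓ x = ∑ i, ∑ s, ∑ ε, c (lab i s ε) * (1 - ℓ (configA 0 (lab i s ε))) := by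
    have h1 := h.sum_one
    rw [h.linear]
    rw [sum_lab] at h1 ⊢
    rw [configA_zero, map_zero, mul_zero, zero_add]
    simp only [mul_sub, mul_one, Finset.sum_sub_distrib]
    linarith
  have hn : ∀ i s ε, 0 ≤ c (lab i s ε) * (1 - ℓ (configA 0 (lab i s ε))) := fun i s ε =>
    mul_nonneg (h.nonneg _) (by linarith [hℓ (lab i s ε)])
  constructor
  · have : 0 ≤ 1 - c 0 - ℓ x := by
      rw [h1]
      exact Finset.sum_nonneg fun i _ => Finset.sum_nonneg fun s _ => Finset.sum_nonneg fun ε _ =>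
        hn i s ε
    linarith
  · intro h2 k hk0 hk
    obtain ⟨i, s, ε, rfl⟩ := (lab_cases k).resolve_left hk0
    have h3 : ∑ i, ∑ s, ∑ ε, c (lab i s ε) * (1 - ℓ (configA 0 (lab i s ε))) ≤ 0 := by
      rw [← h1]; linarith
    have h4 : c (lab i s ε) * (1 - ℓ (configA 0 (lab i s ε))) ≤ 0 := by
      refine le_trans ?_ h3
      refine le_trans ?_ (Finset.single_le_sum (fun i _ => Finset.sum_nonneg fun s _ =>
        Finset.sum_nonneg fun ε _ => hn i s ε) (Finset.mem_univ i))
      refine le_trans ?_ (Finset.single_le_sum (fun s _ => Finset.sum_nonneg fun ε _ => hn i s ε)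
        (Finset.mem_univ s))
      exact Finset.single_le_sum (f := fun ε => c (lab i s ε) * (1 - ℓ (configA 0 (lab i s ε))))
        (fun ε _ => hn i s ε) (Finset.mem_univ ε)
    refine (mul_eq_zero.1 (le_antisymm h4 (hn i s ε))).resolve_right fun h5 => hk ?_
    rw [mem_tight]
    linarith

/-- Each supporting functional is at most 1 minus the origin weight, with equality on its own cone.
Comparing both ways gives equal origin weights, so the difference is a dependence in one supporting
hyperplane. -/
theorem rep_eq_of_mem_boundaryCells {o : Fin 4 → (Fin 4 → Bool) → Bool}
    {κ κ' : Finset (Fin 17)} (hκ : κ ∈ boundaryCells o) (hκ' : κ' ∈ boundaryCells o)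
    {c c' : Fin 17 → ℝ} {x : Fin 6 → ℝ} (hc : IsRep (configA 0) (insert 0 κ) c x)
    (hc' : IsRep (configA 0) (insert 0 κ') c' x) : c = c' := by
  obtain ⟨-, -, ⟨ℓ, hℓ, ht⟩, -⟩ := mem_boundaryCells.1 hκ
  obtain ⟨-, -, ⟨ℓ', hℓ', ht'⟩, hav'⟩ := mem_boundaryCells.1 hκ'
  have e := hc.linear_of_subset_tight ht
  have e' := hc'.linear_of_subset_tight ht'
  have f := hℓ.le_of_rep hc'
  have f' := hℓ'.le_of_rep hc
  have h00 : c 0 = c' 0 := by linarith [f.1, f'.1]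
  rw [← sub_eq_zero]
  refine dep_eq_zero_of_mem_boundaryCells hκ hav' hℓ ht (hc.sub hc') ?_ ?_ ?_
  · intro k hk
    by_cases hk0 : k = 0
    · rw [hk0, Pi.sub_apply, h00, sub_self]
    · have hk' : k ∉ κ := fun h => hk (ht h)
      rw [Pi.sub_apply, f.2 (by linarith) k hk0 hk, hc.supp k (by simp [hk0, hk']), sub_self]
  · intro k hk0 hk
    by_contra hn
    rw [Pi.sub_apply, hc.supp k (by simp [hk0, hn])] at hk
    linarith [hc'.nonneg k]
  · intro k hk0 hk
    by_contra hn
    rw [Pi.sub_apply, hc'.supp k (by simp [hk0, hn])] at hk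
    linarith [hc.nonneg k]

/-- Up to positive factors, the functional pμ₀ + rμ₂ has the values r, p - r, p, p + r on the four
rays. The corresponding lines cut the (p, r)-plane into eight sectors, whose sign patterns are the
good ones. A good pattern therefore gives a regular tiling of the facet. -/
theorem exists_functional_of_isGood : ∀ q, isGood q = true →
    ∃ p r : ℝ, ∀ l, 0 < -sg (q l) * (p * ray l 0 + r * ray l 2) := by
  have hq := sqrt_two_gt
  have key : ∀ {a b c d : Bool} (p r : ℝ), 0 < -sg a * r → 0 < -sg b * (p - r) →
      0 < -sg c * p → 0 < -sg d * (p + r) →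
      ∃ p r : ℝ, ∀ l, 0 < -sg (![a, b, c, d] l) * (p * ray l 0 + r * ray l 2) := by
    intro a b c d p r h0 h1 h2 h3
    refine ⟨p, r, fun l => ?_⟩
    fin_cases l
    · have := mul_pos h0 (by linarith : 0 < √2)
      simp [ray] at this ⊢
      linarith
    · simp [ray] at h1 ⊢
      linarith
    · have := mul_pos h2 (by linarith : 0 < √2)
      simp [ray] at this ⊢
      linarith
    · simp [ray] at h3 ⊢
      linarith
  rw [forall_pattern]
  rintro (_ | _) (_ | _) (_ | _) (_ | _) h <;> simp [isGood] at h
  -- The witnesses (±2, ±1) and (±1, ±2) are one point in each of the eight sectors.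
  · exact key 2 1 (by simp [sg]) (by norm_num [sg]) (by simp [sg]) (by norm_num [sg])
  · exact key 1 2 (by simp [sg]) (by norm_num [sg]) (by simp [sg]) (by norm_num [sg])
  · exact key (-1) 2 (by simp [sg]) (by norm_num [sg]) (by simp [sg]) (by norm_num [sg])
  · exact key (-2) 1 (by simp [sg]) (by norm_num [sg]) (by simp [sg]) (by norm_num [sg])
  · exact key 2 (-1) (by simp [sg]) (by norm_num [sg]) (by simp [sg]) (by norm_num [sg])
  · exact key 1 (-2) (by simp [sg]) (by norm_num [sg]) (by simp [sg]) (by norm_num [sg])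
  · exact key (-1) (-2) (by simp [sg]) (by norm_num [sg]) (by simp [sg]) (by norm_num [sg])
  · exact key (-2) (-1) (by simp [sg]) (by norm_num [sg]) (by simp [sg]) (by norm_num [sg])

theorem IsRep.exists_sub_smul {ι E : Type*} [Fintype ι] [NormedAddCommGroup E] [NormedSpace ℝ E]
    {a : ι → E} {σ : Finset ι} {c d : ι → ℝ} {x : E} (h : IsRep a σ c x) (hd : IsDep a d)
    (hs : ∀ i, i ∉ σ → d i = 0) (hp : ∀ i, 0 < d i → 0 < c i) :
    ∃ t : ℝ, 0 < t ∧ IsRep a σ (c - t • d) x := by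
  have h1 : ∀ᶠ t : ℝ in 𝓝[>] 0, ∀ i, 0 ≤ (c - t • d) i := by
    rw [eventually_all]
    intro i
    by_cases hi : 0 < d i
    · have h2 : Tendsto (fun t : ℝ => c i - t * d i) (𝓝[>] 0) (𝓝 (c i)) := by
        have : Continuous fun t : ℝ => c i - t * d i := by fun_prop
        have := this.tendsto 0
        rw [zero_mul, sub_zero] at this
        exact this.mono_left nhdsWithin_le_nhds
      filter_upwards [h2.eventually (lt_mem_nhds (hp i hi))] with t ht
      exact ht.le
    · filter_upwards [self_mem_nhdsWithin] with t ht
      simp only [Pi.sub_apply, Pi.smul_apply, smul_eq_mul]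
      have := mul_nonneg (le_of_lt ht) (neg_nonneg.2 (not_lt.1 hi))
      linarith [h.nonneg i]
  obtain ⟨t, h2, h3⟩ := (h1.and self_mem_nhdsWithin).exists
  refine ⟨t, h3, h2, fun i hi => by simp [h.supp i hi, hs i hi], ?_, ?_⟩
  · simp [Finset.sum_sub_distrib, h.sum_one, ← Finset.mul_sum, hd.1]
  · simp [sub_smul, Finset.sum_sub_distrib, h.sum_smul, ← smul_smul, ← Finset.smul_sum, hd.2]

theorem isCompact_setOf_isRep {ι E : Type*} [Fintype ι] [NormedAddCommGroup E] [NormedSpace ℝ E]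
    (a : ι → E) (σ : Finset ι) (x : E) : IsCompact {c | IsRep a σ c x} := by
  have h1 : {c | IsRep a σ c x} = (⋂ i, {c : ι → ℝ | 0 ≤ c i}) ∩
      (⋂ i, {c | i ∉ σ → c i = 0}) ∩ {c | ∑ i, c i = 1} ∩ {c | ∑ i, c i • a i = x} := by
    ext c
    simp only [Set.mem_ofPred_eq, Set.mem_inter_iff, Set.mem_iInter]
    exact ⟨fun h => ⟨⟨⟨h.nonneg, h.supp⟩, h.sum_one⟩, h.sum_smul⟩,
      fun h => ⟨h.1.1.1, h.1.1.2, h.1.2, h.2⟩⟩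
  refine (isCompact_Icc (a := (0 : ι → ℝ)) (b := 1)).of_isClosed_subset ?_ ?_
  · rw [h1]
    refine ((IsClosed.inter (isClosed_iInter fun i => ?_) (isClosed_iInter fun i => ?_)).inter
      ?_).inter ?_
    · exact isClosed_le continuous_const (continuous_apply i)
    · by_cases hi : i ∈ σ
      · simp [hi]
      · simpa [hi] using isClosed_eq (continuous_apply i) continuous_const
    · exact isClosed_eq (by fun_prop) continuous_const
    · exact isClosed_eq (by fun_prop) continuous_const
  · intro c hc
    refine ⟨hc.nonneg, fun i => ?_⟩
    rw [Pi.one_apply, ← hc.sum_one]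
    exact Finset.single_le_sum (fun i _ => hc.nonneg i) (Finset.mem_univ i)

/-- All patterns of the choices `o` are good. -/
def IsGoodChoice (o : Fin 4 → (Fin 4 → Bool) → Bool) : Prop :=
  ∀ s, isGood (fun l => o l s) = true

/-- In an octagonal facet, a representation of `x` minimising a functional adapted to the pattern
cannot contain a forbidden triple, since moving along the hexagon dependence would lower it. Its
support then extends to a rhombus cell. -/
theorem exists_rep_boundaryCells {o : Fin 4 → (Fin 4 → Bool) → Bool} (ho : IsHexChoice o)
    (hg : IsGoodChoice o) {x : Fin 6 → ℝ} (hx : x ∈ hull (configA 0)) :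
    ∃ κ ∈ boundaryCells o, ∃ c, IsRep (configA 0) (insert 0 κ) c x := by
  obtain ⟨ℓ, c, hℓ, hc, ⟨s, hs⟩ | ⟨hcard, hi⟩⟩ := exists_facet hx
  · obtain ⟨p, r, hpr⟩ := exists_functional_of_isGood _ (hg s)
    -- The origin stays in the support, so `x` ranges over the cone and not only over the facet.
    have hne : {c | IsRep (configA 0) (insert 0 (octFacet s)) c x}.Nonempty :=
      ⟨c, hc.mono (Finset.insert_subset_insert _ hs)⟩
    obtain ⟨c, hc, hmin⟩ := (isCompact_setOf_isRep (configA 0) (insert 0 (octFacet s)) x).exists_isMinOn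
      hne (f := fun c => p * c (lab 0 (s 0) true) + r * c (lab 2 (s 2) true)) (by fun_prop)
    set κ₀ := Finset.univ.filter fun k => k ≠ 0 ∧ 0 < c k with hκ₀
    have hsub : κ₀ ⊆ octFacet s := by
      intro k hk
      simp only [hκ₀, Finset.mem_filter, Finset.mem_univ, true_and] at hk
      exact (Finset.mem_insert.1 (IsRep.mem_of_pos hc hk.2)).resolve_left hk.1
    have hav : LocAvoids (fun l => o l s) (locOf s κ₀) := by
      intro l hl
      rw [← hexTriple_subset_iff_hasTriple] at hl
      obtain ⟨t, ht, hct⟩ := IsRep.exists_sub_smul hc (isDep_hexDep l s (o l s))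
        (fun k hk => octDep_notMem _ _ fun h => hk (Finset.mem_insert_of_mem h))
        (fun k hk => by
          have := hl ((hexDep_pos_iff _ _ _ _).1 hk)
          simp only [hκ₀, Finset.mem_filter] at this
          exact this.2.2)
      have h1 := hmin hct
      simp only [Set.mem_ofPred_eq, Pi.sub_apply, Pi.smul_apply, smul_eq_mul, hexDep_lab, sg_true,
        one_mul] at h1
      have h2 := mul_pos ht (hpr l)
      linarith
    obtain ⟨i, j, hij, e, h1, h2⟩ := exists_tile_ge _ (hg s) _ hav
    refine ⟨ofLoc s (tile i j e), ho.ofLoc_mem_boundaryCells.2 ⟨locCard_tile i j hij e, h1⟩, c,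
      hc.nonneg, fun k hk => ?_, hc.sum_one, hc.sum_smul⟩
    by_contra hk0
    have hpos : 0 < c k := lt_of_le_of_ne (hc.nonneg k) (Ne.symm hk0)
    simp only [Finset.mem_insert, not_or] at hk
    apply hk.2
    have hk1 : k ∈ κ₀ := by simp [hκ₀, hk.1, hpos]
    rw [← ofLoc_locOf hsub] at hk1
    obtain ⟨m, b, ε, rfl⟩ := (lab_cases k).resolve_left hk.1
    rw [lab_mem_ofLoc] at hk1 ⊢
    exact ⟨hk1.1, h2 _ _ hk1.2⟩
  · exact ⟨tight ℓ, mem_boundaryCells.2 ⟨hcard, hi, ⟨ℓ, hℓ, subset_rfl⟩,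
      fun l s => hℓ.not_hexTriple_subset hi l s _⟩, c, hc⟩

theorem cellHull_subset_frontier {o : Fin 4 → (Fin 4 → Bool) → Bool} {κ : Finset (Fin 17)}
    (hκ : κ ∈ boundaryCells o) : cellHull (configA 0) κ ⊆ frontier (hull (configA 0)) := by
  intro x hx
  obtain ⟨-, -, ⟨ℓ, hℓ, ht⟩, -⟩ := mem_boundaryCells.1 hκ
  refine hℓ.mem_frontier (cellHull_subset_hull _ _ hx) ?_
  obtain ⟨c, hc⟩ := mem_cellHull_iff.1 hx
  rw [(hc.mono (Finset.subset_insert 0 κ)).linear_of_subset_tight ht,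
    hc.supp 0 (zero_notMem_of_mem_boundaryCells hκ), sub_zero]

theorem isBoundaryTriangulation_boundaryCells {o : Fin 4 → (Fin 4 → Bool) → Bool}
    (ho : IsHexChoice o) (hg : IsGoodChoice o) :
    IsBoundaryTriangulation (configA 0) (boundaryCells o) where
  indep κ hκ := (mem_boundaryCells.1 hκ).2.1
  card κ hκ := by simpa using (mem_boundaryCells.1 hκ).1
  inter κ hκ κ' hκ' := cellHull_inter_eq fun c c' x hc hc' =>
    rep_eq_of_mem_boundaryCells hκ hκ' (hc.mono (Finset.subset_insert _ _))
      (hc'.mono (Finset.subset_insert _ _))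
  cover := by
    apply subset_antisymm
    · exact Set.iUnion₂_subset fun κ hκ => cellHull_subset_frontier hκ
    · intro x hx
      obtain ⟨κ, hκ, c, hc⟩ := exists_rep_boundaryCells ho hg (isClosed_hull_configA.frontier_subset hx)
      refine Set.mem_iUnion₂.2 ⟨κ, hκ, mem_cellHull_iff.2 ⟨c, hc.nonneg, fun k hk => ?_, hc.sum_one,
        hc.sum_smul⟩⟩
      by_cases hk0 : k = 0
      · rw [hk0, hc.eq_zero_of_mem_frontier hx]
      · exact hc.supp k (by simp [hk, hk0])

/-- The cone over the boundary triangulation given by `o`. -/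
noncomputable def coneCells (o : Fin 4 → (Fin 4 → Bool) → Bool) : Finset (Finset (Fin 17)) :=
  (boundaryCells o).image (insert 0)

theorem mem_coneCells {o : Fin 4 → (Fin 4 → Bool) → Bool} {σ : Finset (Fin 17)} :
    σ ∈ coneCells o ↔ ∃ κ ∈ boundaryCells o, insert 0 κ = σ := by
  simp [coneCells]

theorem isTriangulation_coneCells {o : Fin 4 → (Fin 4 → Bool) → Bool}
    (ho : IsHexChoice o) (hg : IsGoodChoice o) : IsTriangulation (configA 0) (coneCells o) := by
  have hi : ∀ κ ∈ boundaryCells o, IsIndep (configA 0) (insert 0 κ) := by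
    intro κ hκ
    obtain ⟨-, hi, ⟨ℓ, -, ht⟩, -⟩ := mem_boundaryCells.1 hκ
    exact IsFeasible.isIndep_insert ht hi
  constructor
  · intro σ hσ
    obtain ⟨κ, hκ, rfl⟩ := mem_coneCells.1 hσ
    exact hi κ hκ
  · intro σ hσ
    obtain ⟨κ, hκ, rfl⟩ := mem_coneCells.1 hσ
    refine spanning_of_indep_of_card (hi κ hκ) ?_
    rw [Finset.card_insert_of_notMem (zero_notMem_of_mem_boundaryCells hκ),
      (mem_boundaryCells.1 hκ).1]
    simp
  · intro σ hσ σ' hσ'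
    obtain ⟨κ, hκ, rfl⟩ := mem_coneCells.1 hσ
    obtain ⟨κ', hκ', rfl⟩ := mem_coneCells.1 hσ'
    exact cellHull_inter_eq fun c c' x hc hc' => rep_eq_of_mem_boundaryCells hκ hκ' hc hc'
  · apply subset_antisymm
    · exact Set.iUnion₂_subset fun σ _ => cellHull_subset_hull _ _
    · intro x hx
      obtain ⟨κ, hκ, c, hc⟩ := exists_rep_boundaryCells ho hg hx
      exact Set.mem_iUnion₂.2 ⟨_, mem_coneCells.2 ⟨κ, hκ, rfl⟩, mem_cellHull_iff.2 ⟨c, hc⟩⟩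

/-! ### The choices of a triangulation and the boundary it induces. -/

/-- The choices given by a triangulation: the part of the hexagon that does not occur in `T`. -/
def choiceOf (T : Finset (Finset (Fin 17))) (l : Fin 4) (s : Fin 4 → Bool) : Bool :=
  decide (∀ σ ∈ T, ¬ hexTriple l s true ⊆ σ)

theorem isHexChoice_choiceOf (T : Finset (Finset (Fin 17))) : IsHexChoice (choiceOf T) := by
  intro l s b
  unfold choiceOf
  rw [hexTriple_congr (s' := s) fun i hi => by simp [hi]]

theorem IsTriangulation.avoids_choiceOf {T : Finset (Finset (Fin 17))}
    (hT : IsTriangulation (configA 0) T) {σ : Finset (Fin 17)} (hσ : σ ∈ T) :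
    Avoids (choiceOf T) σ := by
  intro l s h
  by_cases hc : ∀ σ ∈ T, ¬ hexTriple l s true ⊆ σ
  · rw [choiceOf, decide_eq_true hc] at h
    exact hc σ hσ h
  · rw [choiceOf, decide_eq_false hc] at h
    push Not at hc
    obtain ⟨σ', hσ', h'⟩ := hc
    exact hT.not_hexTriple_both hσ hσ' h h'

theorem LocAvoids.anti {q : Fin 4 → Bool} {S S' : Fin 4 → Bool → Bool} (h : LocAvoids q S)
    (hS : ∀ i ε, S' i ε = true → S i ε = true) : LocAvoids q S' :=
  fun l hl => h l fun i hi => hS _ _ (hl i hi)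

/-- Any two coordinates of a dependence determine the others, with coefficients whose absolute
values have sum at most 1 + √2 < 3. -/
theorem IsVDep.abs_le {μ : Fin 4 → ℝ} (h : IsVDep μ) {k l : Fin 4} (hkl : k ≠ l) {e : ℝ}
    (hk : |μ k| ≤ e) (hl : |μ l| ≤ e) (i : Fin 4) : |μ i| ≤ 3 * e := by
  obtain ⟨r1, r3⟩ := h.relations
  obtain ⟨r0, r2⟩ := h.relations'
  have hq := sqrt_two_gt
  have hq' := sqrt_two_lt
  have he : 0 ≤ e := (abs_nonneg _).trans hk
  have mul_le : ∀ m B, 0 ≤ B → |μ m| ≤ B → |√2 * μ m| ≤ 1.5 * B := by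
    intro m B hB hm
    rw [abs_mul, abs_of_pos (by linarith : 0 < √2)]
    exact mul_le_mul hq'.le hm (abs_nonneg _) (by norm_num)
  have k1 := mul_le k e he hk
  have l1 := mul_le l e he hl
  simp only [_root_.abs_le] at mul_le hk hl k1 l1 ⊢
  obtain ⟨hk, hk'⟩ := hk
  obtain ⟨hl, hl'⟩ := hl
  obtain ⟨k1, k2⟩ := k1
  obtain ⟨l1, l2⟩ := l1
  fin_cases k <;> fin_cases l <;> first | exact absurd rfl hkl | skip
  all_goals
    fin_cases i <;>
    simp only [Fin.isValue, Fin.zero_eta, Fin.mk_one, Fin.reduceFinMk] at hk hk' hl hl' k1 k2 l1 l2 ⊢ <;>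
    constructor <;> linarith

/-- For each pair i, j a point near the centre of a face spanned by both pairs is considered. The
cell of `T` containing it must contain both elements of the pairs i and j and at least one element
of each other pair, that is, a rhombus for i and j. -/
theorem isGood_choiceOf {T : Finset (Finset (Fin 17))} (hT : IsTriangulation (configA 0) T) :
    IsGoodChoice (choiceOf T) := by
  intro s
  refine isGood_of_tiles _ fun i j hij => ?_
  -- The eight weights sum to (4 · 10 + 4 · 1) / 44 = 1. The ratio 10 exceeds the factor 3 of
  -- `IsVDep.abs_le`, so a change of representation cannot annihilate the large weights.
  set w : Fin 4 → ℝ := fun m => if m = i ∨ m = j then 10 / 44 else 1 / 44 with hw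
  set c₀ : Fin 17 → ℝ := fun k => ∑ m, ∑ ε, if k = lab m (s m) ε then w m else 0 with hc₀
  have hval : ∀ m ε, c₀ (lab m (s m) ε) = w m := by
    intro m ε
    simp only [hc₀]
    rw [Finset.sum_eq_single m, Finset.sum_eq_single ε]
    · simp
    · intro ε' _ h
      exact if_neg fun h' => h (lab_inj.1 h').2.2.symm
    · simp
    · intro m' _ h
      exact Finset.sum_eq_zero fun ε' _ => if_neg fun h' => h (lab_inj.1 h').1.symm
    · simp
  have hoff : ∀ k, k ∉ octFacet s → c₀ k = 0 := fun k hk =>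
    Finset.sum_eq_zero fun m _ => Finset.sum_eq_zero fun ε _ => if_neg fun h =>
      hk (mem_octFacet.2 ⟨m, ε, h⟩)
  have hw0 : ∀ m, 0 < w m := by
    intro m
    simp only [hw]
    split_ifs <;> norm_num
  have hsum : ∑ k, c₀ k = 1 := by
    rw [sum_lab, hoff 0 (zero_notMem_octFacet s), zero_add]
    have : ∀ m, ∑ b, ∑ ε, c₀ (lab m b ε) = 2 * w m := by
      intro m
      rw [Finset.sum_eq_single (s m) _ (by simp)]
      · simp [hval, two_mul]
      · intro b _ hb
        exact Finset.sum_eq_zero fun ε _ => hoff _ fun h => hb (lab_mem_octFacet.1 h)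
    have hw' : ∀ m, w m = 1 / 44 + (if m = i then 9 / 44 else 0) + if m = j then 9 / 44 else 0 := by
      intro m
      simp only [hw]
      by_cases hi : m = i
      · subst hi
        norm_num [hij.ne]
      · by_cases hj : m = j
        · subst hj
          norm_num [hij.ne']
        · norm_num [hi, hj]
    simp only [this, ← Finset.mul_sum, hw', Finset.sum_add_distrib, Finset.sum_ite_eq',
      Finset.mem_univ, if_true, Finset.sum_const, Finset.card_univ, Fintype.card_fin]
    norm_num
  have hrep : IsRep (configA 0) (octFacet s) c₀ (∑ k, c₀ k • configA 0 k) :=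
    ⟨fun k => Finset.sum_nonneg fun m _ => Finset.sum_nonneg fun ε _ => by
      split_ifs
      · exact (hw0 m).le
      · exact le_rfl, hoff, hsum, rfl⟩
  obtain ⟨σ, hσ, c, hc⟩ := hT.exists_rep (mem_hull_iff.2 ⟨c₀, hrep.mono (Finset.subset_univ _)⟩)
  have hl1 := (hrep.mono (Finset.subset_insert 0 _)).linear_of_subset_tight
    (tight_octFunctional s).ge
  rw [hoff 0 (zero_notMem_octFacet s), sub_zero] at hl1
  have hl2 := (isFeasible_octFunctional s).le_of_rep hc
  have hcoff := hl2.2 (by linarith [hc.nonneg 0])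
  rw [tight_octFunctional] at hcoff
  obtain ⟨μ, hμ, hd⟩ := eq_octDep (hc.sub hrep) (s := s) fun k hk hk0 => by
    rw [Pi.sub_apply, hcoff k hk0 hk, hoff k hk, sub_zero]
  have hcv : ∀ m ε, c (lab m (s m) ε) = w m + sg ε * μ m := by
    intro m ε
    have := congrFun hd (lab m (s m) ε)
    rw [Pi.sub_apply, octDep_lab, hval] at this
    linarith
  -- Non-negativity at both elements of a light pair bounds the change there by the light weight.
  have hsmall : ∀ m, m ≠ i → m ≠ j → |μ m| ≤ 1 / 44 := by
    intro m hi hj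
    have h1 := hc.nonneg (lab m (s m) true)
    have h2 := hc.nonneg (lab m (s m) false)
    rw [hcv] at h1 h2
    simp only [hw, hi, hj, or_self, if_false, sg_true, sg_false] at h1 h2
    rw [abs_le]
    constructor <;> linarith
  have hex : ∀ i j : Fin 4, ∃ k l, k ≠ l ∧ k ≠ i ∧ k ≠ j ∧ l ≠ i ∧ l ≠ j := by decide
  obtain ⟨k, l, hkl, hki, hkj, hli, hlj⟩ := hex i j
  have hbig := hμ.abs_le hkl (hsmall k hki hkj) (hsmall l hli hlj)
  refine ⟨fun m => decide (0 < c (lab m (s m) true)),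
    ((hT.avoids_choiceOf hσ).loc s).anti fun m ε hm => ?_⟩
  rw [locOf, decide_eq_true_iff]
  apply hc.mem_of_pos
  have hb := abs_le.1 (hbig m)
  by_cases hmij : m = i ∨ m = j
  · rw [hcv]
    simp only [hw, hmij, if_true]
    cases ε <;> simp <;> linarith
  · have hm' : decide (0 < c (lab m (s m) true)) = ε := by
      rw [not_or] at hmij
      simpa [tile, hmij.1, hmij.2] using hm
    cases ε
    · rw [decide_eq_false_iff_not, hcv] at hm'
      rw [hcv]
      have := hw0 m
      simp only [sg_true, sg_false] at hm' ⊢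
      linarith
    · exact of_decide_eq_true hm'

theorem exists_isRep_pos {ι E : Type*} [Fintype ι] [DecidableEq ι] [NormedAddCommGroup E]
    [NormedSpace ℝ E] (a : ι → E) {σ : Finset ι} (hσ : σ.Nonempty) :
    ∃ c x, IsRep a σ c x ∧ ∀ i ∈ σ, 0 < c i := by
  have hpos : (0 : ℝ) < σ.card := by exact_mod_cast hσ.card_pos
  refine ⟨fun i => if i ∈ σ then (σ.card : ℝ)⁻¹ else 0, _, ⟨fun i => ?_, fun i hi => by simp [hi],
    ?_, rfl⟩, fun i hi => by simpa [hi] using hpos⟩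
  · split_ifs
    · positivity
    · exact le_rfl
  · simp [hpos.ne']

/-- A point with all weights positive tests both inclusions. For a cell of the choice, the cell of
`T` at that point must represent it in the same way. For a boundary facet of `T`, a supporting
functional at that point must be tight on the whole facet. -/
theorem induces_boundaryCells {T : Finset (Finset (Fin 17))} (hT : IsTriangulation (configA 0) T) :
    Induces (configA 0) T (boundaryCells (choiceOf T)) := by
  have hcard : ∀ σ ∈ T, σ.card = 7 := fun σ hσ => by
    simpa using card_eq_of_indep_of_spanning (hT.indep σ hσ) (hT.spanning σ hσ)
  intro τ
  constructor
  · intro hτ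
    refine ⟨?_, cellHull_subset_frontier hτ⟩
    obtain ⟨h6, hi, ⟨ℓ, hℓ, ht⟩, hav⟩ := mem_boundaryCells.1 hτ
    obtain ⟨c', x, hc', hpos⟩ := exists_isRep_pos (configA 0)
      (Finset.card_pos.1 (by omega : 0 < τ.card))
    obtain ⟨σ, hσ, c, hc⟩ := hT.exists_rep (mem_hull_iff.2 ⟨c', hc'.mono (Finset.subset_univ _)⟩)
    have hl1 := (hc'.mono (Finset.subset_insert 0 _)).linear_of_subset_tight ht
    rw [hc'.supp 0 (zero_notMem_of_mem_boundaryCells hτ), sub_zero] at hl1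
    have hl2 := hℓ.le_of_rep hc
    have hc0 : c 0 = 0 := le_antisymm (by linarith) (hc.nonneg 0)
    have hcoff := hl2.2 (by linarith)
    have hd : c' - c = 0 := by
      refine dep_eq_zero_of_mem_boundaryCells hτ (hT.avoids_choiceOf hσ) hℓ ht (hc'.sub hc) ?_ ?_ ?_
      · intro k hk
        rw [Pi.sub_apply, hc'.supp k fun h => hk (ht h), zero_sub, neg_eq_zero]
        by_cases hk0 : k = 0
        · rw [hk0, hc0]
        · exact hcoff k hk0 hk
      · intro k _ hk
        by_contra hn
        rw [Pi.sub_apply, hc'.supp k hn] at hk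
        linarith [hc.nonneg k]
      · intro k _ hk
        by_contra hn
        rw [Pi.sub_apply, hc.supp k hn] at hk
        linarith [hc'.nonneg k]
    rw [sub_eq_zero] at hd
    have hsub : τ ⊆ σ := fun k hk => hc.mem_of_pos (hd ▸ hpos k hk)
    obtain ⟨i, hi⟩ := Finset.card_eq_one.1 (by
      rw [Finset.card_sdiff_of_subset hsub, hcard σ hσ, h6] : (σ \ τ).card = 1)
    have hi' : i ∈ σ \ τ := hi ▸ Finset.mem_singleton_self i
    rw [Finset.mem_sdiff] at hi'
    refine ⟨σ, hσ, i, hi'.1, ?_⟩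
    rw [Finset.erase_eq, ← hi, Finset.sdiff_sdiff_eq_self hsub]
  · rintro ⟨⟨σ, hσ, i, hi, rfl⟩, hfr⟩
    have h6 : (σ.erase i).card = 6 := by rw [Finset.card_erase_of_mem hi, hcard σ hσ]
    refine mem_boundaryCells.2 ⟨h6, (hT.indep σ hσ).mono (Finset.erase_subset _ _), ?_,
      (hT.avoids_choiceOf hσ).mono (Finset.erase_subset _ _)⟩
    obtain ⟨c', x, hc', hpos⟩ := exists_isRep_pos (configA 0)
      (Finset.card_pos.1 (by omega : 0 < (σ.erase i).card))
    have hx := hfr (mem_cellHull_iff.2 ⟨c', hc'⟩)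
    obtain ⟨ℓ, c, hℓ, hc, -⟩ := exists_facet (isClosed_hull_configA.frontier_subset hx)
    have hl1 := hc.linear_of_subset_tight subset_rfl
    have hl2 := hℓ.le_of_rep hc'
    rw [hc.eq_zero_of_mem_frontier hx] at hl1
    rw [hc'.eq_zero_of_mem_frontier hx] at hl2
    refine ⟨ℓ, hℓ, fun k hk => ?_⟩
    have hk0 : k ≠ 0 := by
      rintro rfl
      exact (hpos _ hk).ne' (hc'.eq_zero_of_mem_frontier hx)
    by_contra hn
    exact (hpos k hk).ne' (hl2.2 hl1.ge k hk0 hn)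

theorem Induces.unique {ι E : Type*} [Fintype ι] [DecidableEq ι] [NormedAddCommGroup E]
    [NormedSpace ℝ E] {a : ι → E} {T K K' : Finset (Finset ι)} (h : Induces a T K)
    (h' : Induces a T K') : K = K' := by
  ext τ
  rw [h τ, h' τ]

theorem exists_mem_boundaryCells {o : Fin 4 → (Fin 4 → Bool) → Bool} (ho : IsHexChoice o)
    (hg : IsGoodChoice o) (l : Fin 4) (s : Fin 4 → Bool) :
    ∃ κ ∈ boundaryCells o, hexTriple l s (!o l s) ⊆ κ := by
  obtain ⟨i, j, hij, e, h1, h2⟩ := exists_tile_of_hasTriple _ (hg s) l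
  refine ⟨ofLoc s (tile i j e), ho.ofLoc_mem_boundaryCells.2 ⟨locCard_tile i j hij e, h1⟩, ?_⟩
  rw [hexTriple_subset_iff_hasTriple, locOf_ofLoc]
  exact h2

/-- Every part that is not forbidden occurs in some cell, so it cannot be forbidden by the other
choice. -/
theorem boundaryCells_injective {o o' : Fin 4 → (Fin 4 → Bool) → Bool} (ho : IsHexChoice o)
    (hg : IsGoodChoice o) (h : boundaryCells o = boundaryCells o') : o = o' := by
  ext l s
  obtain ⟨κ, hκ, hs⟩ := exists_mem_boundaryCells ho hg l s
  rw [h] at hκ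
  have h1 : o' l s ≠ !o l s := fun h1 => (mem_boundaryCells.1 hκ).2.2.2 l s (h1 ▸ hs)
  revert h1
  cases o l s <;> cases o' l s <;> simp

theorem induces_iff {T K : Finset (Finset (Fin 17))} (hT : IsTriangulation (configA 0) T) :
    Induces (configA 0) T K ↔ K = boundaryCells (choiceOf T) :=
  ⟨fun h => h.unique (induces_boundaryCells hT), fun h => h ▸ induces_boundaryCells hT⟩

theorem exists_hexTriple_subset {T : Finset (Finset (Fin 17))}
    (hT : IsTriangulation (configA 0) T) (l : Fin 4) (s : Fin 4 → Bool) :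
    ∃ σ ∈ T, hexTriple l s (!choiceOf T l s) ⊆ σ := by
  obtain ⟨κ, hκ, hs⟩ := exists_mem_boundaryCells (isHexChoice_choiceOf T) (isGood_choiceOf hT) l s
  obtain ⟨⟨σ, hσ, i, -, rfl⟩, -⟩ := (induces_boundaryCells hT κ).1 hκ
  exact ⟨σ, hσ, hs.trans (Finset.erase_subset _ _)⟩

theorem choiceOf_coneCells {o : Fin 4 → (Fin 4 → Bool) → Bool} (ho : IsHexChoice o)
    (hg : IsGoodChoice o) : choiceOf (coneCells o) = o := by
  have hT := isTriangulation_coneCells ho hg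
  ext l s
  obtain ⟨κ, hκ, hs⟩ := exists_mem_boundaryCells ho hg l s
  have h1 : choiceOf (coneCells o) l s ≠ !o l s := fun h1 =>
    hT.avoids_choiceOf (mem_coneCells.2 ⟨κ, hκ, rfl⟩) l s
      (h1 ▸ hs.trans (Finset.subset_insert _ _))
  revert h1
  cases o l s <;> cases choiceOf (coneCells o) l s <;> simp

/-! ### Flips that change the boundary, and rigid choices. -/

theorem IsCircuit.eq_of_subset {ι E : Type*} [Fintype ι] [DecidableEq ι] [NormedAddCommGroup E]
    [NormedSpace ℝ E] {a : ι → E} {P N P' N' : Finset ι} (h : IsCircuit a P N)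
    (h' : IsCircuit a P' N') (hP : P ⊆ P') (hN : N ⊆ N') : P = P' := by
  have h1 : P ∪ N = P' ∪ N' := by
    by_contra hne
    exact h.dep (h'.minimal _ ((Finset.union_subset_union hP hN).ssubset_of_ne hne))
  refine subset_antisymm hP fun k hk => ?_
  have h2 : k ∈ P ∪ N := h1 ▸ Finset.mem_union_left _ hk
  refine (Finset.mem_union.1 h2).resolve_right fun hk' => ?_
  exact Finset.disjoint_left.1 h'.disj hk (hN hk')

/-- One part of the hexagon disappears and the other appears, so they contain the removed and the
inserted part of the flip circuit. Circuits are minimal, so the circuits coincide. -/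
theorem eq_hexTriple_of_choiceOf_ne {T T' : Finset (Finset (Fin 17))}
    (hT : IsTriangulation (configA 0) T) (hT' : IsTriangulation (configA 0) T')
    {P N : Finset (Fin 17)} (hC : IsCircuit (configA 0) P N) {L : Finset (Finset (Fin 17))}
    (hL : ∀ τ ∈ circuitTriangulation P N, link T τ = L)
    (h : T' = T \ joinCells L (circuitTriangulation P N) ∪ joinCells L (circuitTriangulation N P))
    {l : Fin 4} {s : Fin 4 → Bool} (hne : choiceOf T' l s ≠ choiceOf T l s) :
    P = hexTriple l s (choiceOf T l s) := by
  have hne' : choiceOf T' l s = !choiceOf T l s := by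
    revert hne
    cases choiceOf T' l s <;> cases choiceOf T l s <;> simp
  obtain ⟨σ, hσ, hs⟩ := exists_hexTriple_subset hT l s
  obtain ⟨σ', hσ', hs'⟩ := exists_hexTriple_subset hT' l s
  rw [hne', Bool.not_not] at hs'
  refine hC.eq_of_subset (isCircuit_hexTriple l s _) ?_ ?_
  · exact subset_of_face_added hL h hσ' hs' fun σ hσ => hT.avoids_choiceOf hσ l s
  · exact subset_of_face_removed h hσ hs fun σ' hσ' => hne' ▸ hT'.avoids_choiceOf hσ' l s

theorem eq_of_hexTriple_eq {l l' : Fin 4} {s s' : Fin 4 → Bool} {b b' : Bool}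
    (h : hexTriple l s b = hexTriple l' s' b') : l = l' := by
  by_contra hne
  have h1 : lab l' (s l') (rsgn l l' ^^ b) ∈ hexTriple l s b :=
    mem_hexTriple.2 ⟨l', Ne.symm hne, rfl⟩
  rw [h] at h1
  obtain ⟨i, hi, h2⟩ := mem_hexTriple.1 h1
  exact hi (lab_inj.1 h2).1.symm

/-- The choices `o` belong to triangulations of the boundary that no flip can change: the choice at
a hexagon cannot be changed in both of the octagonal facets that contain it. -/
structure IsRigidChoice (o : Fin 4 → (Fin 4 → Bool) → Bool) : Prop where
  hex : IsHexChoice o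
  good : IsGoodChoice o
  rigid : ∀ l s, ∃ c,
    isGood (Function.update (fun m => o m (Function.update s l c)) l (!o l s)) = false

/-- A changed hexagon determines the circuit of the flip, so hexagons with another omitted index
keep their choices. The pattern in the blocking facet would change at one place only and become bad,
although patterns of triangulations are good. -/
theorem IsRigidChoice.choiceOf_eq {T T' : Finset (Finset (Fin 17))}
    (hT : IsTriangulation (configA 0) T) (hT' : IsTriangulation (configA 0) T')
    (hr : IsRigidChoice (choiceOf T)) (hf : IsFlip (configA 0) T T') :
    choiceOf T' = choiceOf T := by
  obtain ⟨P, N, hC, L, -, hL, h⟩ := hf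
  by_contra hne
  obtain ⟨l, s, hne⟩ : ∃ l s, choiceOf T' l s ≠ choiceOf T l s := by
    by_contra hn
    push Not at hn
    exact hne (funext₂ hn)
  have hP := eq_hexTriple_of_choiceOf_ne hT hT' hC hL h hne
  obtain ⟨c, hc⟩ := hr.rigid l s
  have hg := isGood_choiceOf hT' (Function.update s l c)
  rw [← Bool.not_eq_true] at hc
  apply hc
  rw [← hg]
  congr 1
  ext m
  by_cases hm : m = l
  · subst hm
    rw [Function.update_self, isHexChoice_choiceOf T' m s c]
    revert hne
    cases choiceOf T' m s <;> cases choiceOf T m s <;> simp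
  · rw [Function.update_of_ne hm]
    by_contra hn
    have := eq_hexTriple_of_choiceOf_ne hT hT' hC hL h (Ne.symm hn)
    rw [hP] at this
    exact hm (eq_of_hexTriple_eq this).symm

theorem IsRigidChoice.isRigidBoundary {o : Fin 4 → (Fin 4 → Bool) → Bool} (hr : IsRigidChoice o) :
    IsRigidBoundary (configA 0) (boundaryCells o) where
  triang := isBoundaryTriangulation_boundaryCells hr.hex hr.good
  extends_inside := ⟨⟨coneCells o, isTriangulation_coneCells hr.hex hr.good⟩, by
    have := induces_boundaryCells (isTriangulation_coneCells hr.hex hr.good)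
    rwa [choiceOf_coneCells hr.hex hr.good] at this⟩
  no_flip T T' h hadj := by
    have h1 := boundaryCells_injective hr.hex hr.good ((induces_iff T.2).1 h)
    subst h1
    rw [induces_iff T'.2, hr.choiceOf_eq T.2 T'.2 (flipGraph_adj_iff.1 hadj).2]

/-- Building a flip requires only that the remaining cells do not contain the part `N` common to all
replaced cells: then they neither enlarge the links nor coincide with replaced cells. -/
theorem isFlip_union_joinCells {ι E : Type*} [Fintype ι] [DecidableEq ι] [NormedAddCommGroup E]
    [NormedSpace ℝ E] {a : ι → E} {P N : Finset ι} (hC : IsCircuit a P N)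
    {L R : Finset (Finset ι)} (hL : L.Nonempty) (hd : ∀ ρ ∈ L, Disjoint ρ (P ∪ N))
    (hR : ∀ σ ∈ R, ¬ N ⊆ σ) :
    IsFlip a (R ∪ joinCells L (circuitTriangulation P N))
      (R ∪ joinCells L (circuitTriangulation N P)) := by
  have hN : ∀ i ∈ P, N ⊆ (P ∪ N).erase i := fun i hi k hk =>
    Finset.mem_erase.2 ⟨fun h => Finset.disjoint_left.1 hC.disj hi (h ▸ hk),
      Finset.mem_union_right _ hk⟩
  refine ⟨P, N, hC, L, hL, fun τ hτ => ?_, ?_⟩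
  · obtain ⟨i, hi, rfl⟩ := Finset.mem_image.1 hτ
    ext ρ
    rw [mem_link, Finset.mem_union, mem_joinCells_circuit]
    constructor
    · rintro ⟨h1, h2 | ⟨ρ', hρ', j, hj, h2⟩⟩
      · exact absurd ((hN i hi).trans Finset.subset_union_right) (hR _ h2)
      · rw [(join_erase_inj (Finset.mem_union_left _ hj) h1
          (hd ρ' hρ') h2).2]
        exact hρ'
    · exact fun hρ => ⟨(hd ρ hρ).mono_right (Finset.erase_subset _ _),
        Or.inr ⟨ρ, hρ, i, hi, rfl⟩⟩
  · congr 1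
    rw [Finset.union_sdiff_right, eq_comm, Finset.sdiff_eq_self_iff_disjoint, Finset.disjoint_left]
    intro σ hσ hσ'
    obtain ⟨ρ, -, i, hi, rfl⟩ := mem_joinCells_circuit.1 hσ'
    exact hR _ hσ ((hN i hi).trans Finset.subset_union_right)

/-- Only the two facets around the hexagon can contain such cells, one for each sign `c` at `l`, and
simplex facets contain no hexagon part. The local description `H` lists the cells in each of the
two. -/
theorem mem_boundaryCells_hexTriple_iff {o : Fin 4 → (Fin 4 → Bool) → Bool} (ho : IsHexChoice o)
    {l : Fin 4} {s : Fin 4 → Bool} {b : Bool} {ε : Bool → Bool}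
    (H : ∀ c S, locCard S = 6 →
      ((LocAvoids (fun m => o m (Function.update s l c)) S ∧ HasTriple l (!b) S) ↔
        ∃ i, i ≠ l ∧ ∀ m x, S m x = hexTile l (ε c) i b m x)) {κ : Finset (Fin 17)} :
    (κ ∈ boundaryCells o ∧ hexTriple l s (!b) ⊆ κ) ↔
      ∃ c i, i ≠ l ∧ κ = ofLoc (Function.update s l c) (hexTile l (ε c) i b) := by
  have hs : ∀ c, hexTriple l (Function.update s l c) (!b) = hexTriple l s (!b) := fun c =>
    hexTriple_congr (fun i hi => by simp [hi]) _
  constructor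
  · rintro ⟨hκ, hsub⟩
    obtain ⟨h6, hi, ⟨ℓ, hℓ, ht⟩, hav⟩ := mem_boundaryCells.1 hκ
    rcases hℓ.tight_subset_or_card_le with ⟨t, ht'⟩ | hc
    · have hκt := ht.trans ht'
      have hst : t = Function.update s l (t l) := by
        ext i
        by_cases hil : i = l
        · subst hil; simp
        · simp [hil, congr_of_hexTriple_subset (hsub.trans hκt) i hil]
      generalize t l = c at hst
      subst hst
      rw [← hs c, hexTriple_subset_iff_hasTriple] at hsub
      obtain ⟨i, hil, h⟩ := (H c _ (by rw [← card_eq_locCard hκt, h6])).1 ⟨hav.loc _, hsub⟩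
      refine ⟨c, i, hil, ?_⟩
      rw [← funext₂ h, ofLoc_locOf hκt]
    · obtain rfl := Finset.eq_of_subset_of_card_le ht (h6 ▸ hc)
      exact absurd hsub (hℓ.not_hexTriple_subset hi _ _ _)
  · rintro ⟨c, i, hil, rfl⟩
    have h6 := locCard_hexTile l (ε c) i hil b
    obtain ⟨h1, h2⟩ := (H c _ h6).2 ⟨i, hil, fun _ _ => rfl⟩
    refine ⟨ho.ofLoc_mem_boundaryCells.2 ⟨h6, h1⟩, ?_⟩
    rwa [← hs c, hexTriple_subset_iff_hasTriple, locOf_ofLoc]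

theorem lab_mem_hexagon {l : Fin 4} {s : Fin 4 → Bool} {b : Bool} {m : Fin 4} {c x : Bool} :
    lab m c x ∈ hexTriple l s b ∪ hexTriple l s (!b) ↔ m ≠ l ∧ c = s m := by
  rw [Finset.mem_union, mem_hexTriple, mem_hexTriple]
  constructor
  · rintro (⟨i, hi, h⟩ | ⟨i, hi, h⟩) <;> obtain ⟨rfl, rfl, -⟩ := lab_inj.1 h <;> exact ⟨hi, rfl⟩
  · rintro ⟨hm, rfl⟩
    by_cases hx : x = (rsgn l m ^^ b)
    · exact Or.inl ⟨m, hm, by rw [hx]⟩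
    · refine Or.inr ⟨m, hm, ?_⟩
      have : x = (rsgn l m ^^ !b) := by
        revert hx; cases x <;> cases rsgn l m <;> cases b <;> simp
      rw [this]

theorem insert_ofLoc_hexTile {l : Fin 4} {s : Fin 4 → Bool} {b c ε : Bool} {i : Fin 4} (hi : i ≠ l) :
    insert 0 (ofLoc (Function.update s l c) (hexTile l ε i b)) =
      {0, lab l c ε} ∪ (hexTriple l s b ∪ hexTriple l s (!b)).erase (lab i (s i) (rsgn l i ^^ b)) := by
  ext k
  rcases lab_cases k with rfl | ⟨m, d, x, rfl⟩
  · simp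
  · rw [Finset.mem_union, Finset.mem_erase, lab_mem_hexagon]
    simp only [Finset.mem_insert, lab_ne_zero, false_or, lab_mem_ofLoc, Finset.mem_singleton,
      ne_eq, lab_inj, hexTile]
    by_cases hm : m = l
    · subst hm
      simp
    · by_cases hmi : m = i
      · subst hmi
        simp only [Function.update_of_ne hm, hm, if_false, false_and, false_or,
          not_false_eq_true, true_and]
        cases x <;> cases rsgn l m <;> cases b <;> simp
      · simp [hm, hmi]

/-- The star of the hexagon in the cone is a join whose link has two elements, one for each facet:
the origin together with the end `ε c` of the l-th segment. -/
theorem coneCells_eq_union {o : Fin 4 → (Fin 4 → Bool) → Bool} (ho : IsHexChoice o)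
    {l : Fin 4} {s : Fin 4 → Bool} {b : Bool} {ε : Bool → Bool}
    (H : ∀ c S, locCard S = 6 →
      ((LocAvoids (fun m => o m (Function.update s l c)) S ∧ HasTriple l (!b) S) ↔
        ∃ i, i ≠ l ∧ ∀ m x, S m x = hexTile l (ε c) i b m x)) :
    coneCells o = ((coneCells o).filter fun σ => ¬ hexTriple l s (!b) ⊆ σ) ∪
      joinCells (Finset.univ.image fun c => {0, lab l c (ε c)})
        (circuitTriangulation (hexTriple l s b) (hexTriple l s (!b))) := by
  have h0 : ∀ κ, hexTriple l s (!b) ⊆ insert 0 κ ↔ hexTriple l s (!b) ⊆ κ := fun κ =>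
    Finset.subset_insert_iff_of_notMem fun h =>
      zero_notMem_octFacet s (hexTriple_subset_octFacet _ _ _ h)
  have h1 : ∀ σ, σ ∈ joinCells (Finset.univ.image fun c => {0, lab l c (ε c)})
      (circuitTriangulation (hexTriple l s b) (hexTriple l s (!b))) ↔
      σ ∈ coneCells o ∧ hexTriple l s (!b) ⊆ σ := by
    intro σ
    rw [mem_joinCells_circuit, mem_coneCells]
    constructor
    · rintro ⟨ρ, hρ, k, hk, rfl⟩
      obtain ⟨c, -, rfl⟩ := Finset.mem_image.1 hρ
      obtain ⟨i, hi, rfl⟩ := mem_hexTriple.1 hk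
      rw [← insert_ofLoc_hexTile (c := c) (ε := ε c) hi, h0]
      obtain ⟨h2, h3⟩ := (mem_boundaryCells_hexTriple_iff ho H).2 ⟨c, i, hi, rfl⟩
      exact ⟨⟨_, h2, rfl⟩, h3⟩
    · rintro ⟨⟨κ, hκ, rfl⟩, hs⟩
      rw [h0] at hs
      obtain ⟨c, i, hi, rfl⟩ := (mem_boundaryCells_hexTriple_iff ho H).1 ⟨hκ, hs⟩
      exact ⟨_, Finset.mem_image_of_mem _ (Finset.mem_univ c), _, mem_hexTriple.2 ⟨i, hi, rfl⟩,
        insert_ofLoc_hexTile hi⟩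
  ext σ
  rw [Finset.mem_union, Finset.mem_filter, h1]
  tauto

/-- The choices `o` changed at one hexagon. -/
def flipChoice (o : Fin 4 → (Fin 4 → Bool) → Bool) (l : Fin 4) (s : Fin 4 → Bool) (m : Fin 4)
    (t : Fin 4 → Bool) : Bool :=
  if m = l ∧ ∀ i, i ≠ l → t i = s i then !o m t else o m t

theorem isHexChoice_flipChoice {o : Fin 4 → (Fin 4 → Bool) → Bool} (ho : IsHexChoice o)
    (l : Fin 4) (s : Fin 4 → Bool) : IsHexChoice (flipChoice o l s) := by
  intro m t b
  have : (m = l ∧ ∀ i, i ≠ l → Function.update t m b i = s i) ↔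
      m = l ∧ ∀ i, i ≠ l → t i = s i := by
    refine and_congr_right ?_
    rintro rfl
    exact forall₂_congr fun i hi => by simp [hi]
  simp only [flipChoice, this, ho m t b]

theorem flipChoice_pattern (o : Fin 4 → (Fin 4 → Bool) → Bool) (l : Fin 4) (s : Fin 4 → Bool)
    (c : Bool) : (fun m => flipChoice o l s m (Function.update s l c)) =
      Function.update (fun m => o m (Function.update s l c)) l (!o l (Function.update s l c)) := by
  ext m
  by_cases hm : m = l
  · subst hm
    simp +contextual [flipChoice]
  · simp [flipChoice, hm]

theorem avoids_of_flip {o o' : Fin 4 → (Fin 4 → Bool) → Bool} {l : Fin 4} {s : Fin 4 → Bool}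
    (ho' : IsHexChoice o')
    (h : ∀ m t, o' m t ≠ o m t → m = l ∧ ∀ i, i ≠ l → t i = s i)
    {κ : Finset (Fin 17)} (hκ : Avoids o κ) (hs : ¬ hexTriple l s (o' l s) ⊆ κ) : Avoids o' κ := by
  intro m t
  by_cases hm : o' m t = o m t
  · rw [hm]
    exact hκ m t
  · obtain ⟨rfl, ht⟩ := h m t hm
    rwa [hexTriple_congr ht, ho'.congr ht]

/-- Both cones are one common family of cells plus the star of the hexagon, triangulated in its two
ways with the same link, because the ends `ε c` do not change. -/
theorem isFlip_coneCells {o : Fin 4 → (Fin 4 → Bool) → Bool} (ho : IsHexChoice o)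
    (hg : IsGoodChoice o) {l : Fin 4} {s : Fin 4 → Bool}
    (hf : ∀ c, isGood (Function.update (fun m => o m (Function.update s l c)) l (!o l s)) = true) :
    IsFlip (configA 0) (coneCells o) (coneCells (flipChoice o l s)) := by
  have ho' := isHexChoice_flipChoice ho l s
  have hex := fun c => exists_hexTile_iff _ (hg (Function.update s l c)) l (by
    rw [ho l s c]; exact hf c)
  simp only [ho l s] at hex
  choose ε h1 h2 using hex
  have hne : ∀ m t, flipChoice o l s m t ≠ o m t → m = l ∧ ∀ i, i ≠ l → t i = s i := by
    intro m t h
    by_contra hn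
    exact h (by rw [flipChoice, if_neg hn])
  have hb : flipChoice o l s l s = !o l s := by simp [flipChoice]
  have e1 := coneCells_eq_union ho (l := l) (s := s) (b := o l s) (ε := ε) h1
  have e2 := coneCells_eq_union ho' (l := l) (s := s) (b := !o l s) (ε := ε) (by
    intro c S hS
    rw [flipChoice_pattern, ho l s, Bool.not_not]
    exact h2 c S hS)
  rw [Bool.not_not] at e2
  have e3 : ((coneCells o).filter fun σ => ¬ hexTriple l s (!o l s) ⊆ σ) =
      (coneCells (flipChoice o l s)).filter fun σ => ¬ hexTriple l s (o l s) ⊆ σ := by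
    have h0 : ∀ b κ, hexTriple l s b ⊆ insert 0 κ ↔ hexTriple l s b ⊆ κ := fun b κ =>
      Finset.subset_insert_iff_of_notMem fun h =>
        zero_notMem_octFacet s (hexTriple_subset_octFacet _ _ _ h)
    ext σ
    simp only [Finset.mem_filter, mem_coneCells]
    constructor
    · rintro ⟨⟨κ, hκ, rfl⟩, hs⟩
      rw [h0] at hs ⊢
      obtain ⟨k1, k2, k3, hav⟩ := mem_boundaryCells.1 hκ
      exact ⟨⟨κ, mem_boundaryCells.2 ⟨k1, k2, k3, avoids_of_flip ho' hne hav (hb ▸ hs)⟩, rfl⟩,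
        hav l s⟩
    · rintro ⟨⟨κ, hκ, rfl⟩, hs⟩
      rw [h0] at hs ⊢
      obtain ⟨k1, k2, k3, hav⟩ := mem_boundaryCells.1 hκ
      exact ⟨⟨κ, mem_boundaryCells.2 ⟨k1, k2, k3, avoids_of_flip ho
        (fun m t h => hne m t (Ne.symm h)) hav hs⟩, rfl⟩, hb ▸ hav l s⟩
  rw [e1, e2, ← e3]
  refine isFlip_union_joinCells (isCircuit_hexTriple l s _) ?_ ?_ ?_
  · exact Finset.univ_nonempty.image _
  · intro ρ hρ
    obtain ⟨c, -, rfl⟩ := Finset.mem_image.1 hρ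
    rw [Finset.disjoint_insert_left, Finset.disjoint_singleton_left]
    refine ⟨?_, fun h => (lab_mem_hexagon.1 h).1 rfl⟩
    rw [Finset.mem_union]
    rintro (h | h) <;> exact zero_notMem_octFacet s (hexTriple_subset_octFacet _ _ _ h)
  · exact fun σ hσ => (Finset.mem_filter.1 hσ).2

/-- If a hexagon is blocked in neither of its facets, the cone over the boundary has a flip changing
it, so a rigid boundary comes from a rigid choice. -/
theorem isRigidBoundary_iff {K : Finset (Finset (Fin 17))} :
    IsRigidBoundary (configA 0) K ↔ ∃ o, IsRigidChoice o ∧ K = boundaryCells o := by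
  constructor
  · intro hK
    obtain ⟨T, hT⟩ := hK.extends_inside
    rw [induces_iff T.2] at hT
    have ho := isHexChoice_choiceOf T.1
    have hg := isGood_choiceOf T.2
    generalize choiceOf T.1 = o at hT ho hg
    refine ⟨o, ⟨ho, hg, fun l s => ?_⟩, hT⟩
    by_contra hn
    push Not at hn
    simp only [ne_eq, Bool.not_eq_false] at hn
    have ho' := isHexChoice_flipChoice ho l s
    have hg' : IsGoodChoice (flipChoice o l s) := by
      intro t
      by_cases ht : ∀ i, i ≠ l → t i = s i
      · have : t = Function.update s l (t l) := by
          ext i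
          by_cases hil : i = l
          · subst hil; simp
          · simp [hil, ht i hil]
        rw [this, flipChoice_pattern, ho l s]
        exact hn _
      · simpa [flipChoice, ht] using hg t
    have hne : flipChoice o l s ≠ o := fun h => by
      have := congrFun₂ h l s
      simp [flipChoice] at this
    have hc := choiceOf_coneCells ho hg
    have hc' := choiceOf_coneCells ho' hg'
    let T₁ : Triangulation (configA 0) := ⟨coneCells o, isTriangulation_coneCells ho hg⟩
    let T₂ : Triangulation (configA 0) :=
      ⟨coneCells (flipChoice o l s), isTriangulation_coneCells ho' hg'⟩
    have hadj : (flipGraph (configA 0)).Adj T₁ T₂ := by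
      refine flipGraph_adj_iff.2 ⟨fun h => hne ?_, isFlip_coneCells ho hg hn⟩
      have h' : coneCells o = coneCells (flipChoice o l s) := congrArg Subtype.val h
      exact hc'.symm.trans ((congrArg choiceOf h').symm.trans hc)
    have h1 := hK.no_flip T₁ T₂ ((induces_iff T₁.2).2
      (hT.trans (congrArg boundaryCells hc.symm))) hadj
    have h2 := hT.symm.trans ((induces_iff T₂.2).1 h1)
    exact hne (hc'.symm.trans (boundaryCells_injective ho hg h2).symm)
  · rintro ⟨o, hr, rfl⟩
    exact hr.isRigidBoundary

/-! ### Counting rigid choices by exhaustive search over the 16 facets. -/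

/-- The binary digits of `n`. -/
def digits (n : ℕ) (m : Fin 4) : Bool := n.testBit m

/-- The number with the given binary digits. -/
def code (q : Fin 4 → Bool) : ℕ :=
  (q 0).toNat + 2 * (q 1).toNat + 4 * (q 2).toNat + 8 * (q 3).toNat

theorem digits_code : ∀ q, digits (code q) = q := by
  simp only [forall_pattern]
  decide

theorem code_lt : ∀ q, code q < 16 := by
  simp only [forall_pattern]
  decide

theorem digits_code_xor : ∀ q (l : Fin 4),
    digits (code q ^^^ 2 ^ (l : ℕ)) = Function.update q l (!q l) := by
  simp only [forall_pattern]
  decide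

theorem digits_xor : ∀ n < 16, ∀ l : Fin 4, n.testBit l = true →
    n ^^^ 2 ^ (l : ℕ) < n ∧ digits (n ^^^ 2 ^ (l : ℕ)) = Function.update (digits n) l false ∧
      digits n = Function.update (digits n) l true := by
  decide

/-- The codes of the good patterns. -/
def goodCodes : List ℕ := [0, 1, 2, 6, 9, 13, 14, 15]

theorem code_mem_goodCodes : ∀ q, isGood q = true → code q ∈ goodCodes := by
  simp only [forall_pattern]
  decide

/-- The pattern `q` at the facet `n` fits to the patterns `L` at the facets before `n`. -/
def fits (n : ℕ) (L : List ℕ) (q : ℕ) : Bool :=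
  (List.finRange 4).all fun l => !(n.testBit l) ||
    ((q.testBit l == (L.getD (n ^^^ 2 ^ (l : ℕ)) 0).testBit l) &&
      !(isGood (digits (q ^^^ 2 ^ (l : ℕ))) &&
        isGood (digits (L.getD (n ^^^ 2 ^ (l : ℕ)) 0 ^^^ 2 ^ (l : ℕ)))))

/-- The fitting lists of patterns at the first `n` facets. -/
def partialChoices : ℕ → List (List ℕ)
  | 0 => [[]]
  | n + 1 => (partialChoices n).flatMap fun L =>
      (goodCodes.filter (fits n L)).map fun q => L ++ [q]

/-- The choices with the given patterns. -/
def decodeChoice (L : List ℕ) (m : Fin 4) (s : Fin 4 → Bool) : Bool :=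
  (L.getD (code s) 0).testBit m

/-- The patterns of the choices `o` at the first `n` facets. -/
def encodeChoice (o : Fin 4 → (Fin 4 → Bool) → Bool) (n : ℕ) : List ℕ :=
  (List.range n).map fun k => code fun m => o m (digits k)

theorem encodeChoice_getD (o : Fin 4 → (Fin 4 → Bool) → Bool) {n k : ℕ} (h : k < n) :
    (encodeChoice o n).getD k 0 = code fun m => o m (digits k) := by
  simp [encodeChoice, List.getD_eq_getElem?_getD, h]

/-- Facets are numbered by their sign bits. The neighbours of facet `n` with smaller number are
obtained by clearing a set bit, so each hexagon is tested once, at its later facet, for agreement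
and for being blocked. -/
theorem IsRigidChoice.encodeChoice_mem {o : Fin 4 → (Fin 4 → Bool) → Bool} (ho : IsRigidChoice o)
    {n : ℕ} (hn : n ≤ 16) : encodeChoice o n ∈ partialChoices n := by
  induction n with
  | zero => simp [encodeChoice, partialChoices]
  | succ n ih =>
    rw [partialChoices, List.mem_flatMap]
    refine ⟨_, ih (by omega), List.mem_map.2 ⟨code fun m => o m (digits n),
      List.mem_filter.2 ⟨code_mem_goodCodes _ (ho.good _), ?_⟩, ?_⟩⟩
    · rw [fits, List.all_eq_true]
      intro l _
      cases hl : n.testBit l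
      · rfl
      · obtain ⟨h1, h2, h3⟩ := digits_xor n (by omega) l hl
        have hb : ∀ q (m : Fin 4), (code q).testBit m = q m := fun q m => congrFun (digits_code q) m
        rw [encodeChoice_getD o h1, hb, hb, digits_code_xor, digits_code_xor, h2, ho.hex]
        simp only [Bool.not_true, Bool.false_or, beq_self_eq_true, Bool.true_and, Bool.not_eq_true',
          Bool.and_eq_false_iff]
        obtain ⟨c, hc⟩ := ho.rigid l (digits n)
        cases c
        · exact Or.inr hc
        · left
          rwa [← h3] at hc
    · rw [encodeChoice, encodeChoice, List.range_succ, List.map_append]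
      rfl

theorem decodeChoice_encodeChoice (o : Fin 4 → (Fin 4 → Bool) → Bool) :
    decodeChoice (encodeChoice o 16) = o := by
  ext m s
  rw [decodeChoice, encodeChoice_getD o (code_lt s), digits_code]
  exact congrFun (digits_code fun m => o m s) m

/-- The search is sound: every list it produces passes a direct check of all three conditions. -/
theorem isRigidChoice_decodeChoice : ∀ L ∈ partialChoices 16, IsRigidChoice (decodeChoice L) := by
  have h1 : ∀ L ∈ partialChoices 16, ∀ l s b,
      decodeChoice L l (Function.update s l b) = decodeChoice L l s := by
    simp only [forall_pattern]
    decide +kernel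
  have h2 : ∀ L ∈ partialChoices 16, ∀ s, isGood (fun l => decodeChoice L l s) = true := by
    simp only [forall_pattern]
    decide +kernel
  have h3 : ∀ L ∈ partialChoices 16, ∀ l s, ∃ c, isGood (Function.update
      (fun m => decodeChoice L m (Function.update s l c)) l (!decodeChoice L l s)) = false := by
    simp only [forall_pattern]
    decide +kernel
  exact fun L hL => ⟨h1 L hL, h2 L hL, h3 L hL⟩

theorem encodeChoice_decodeChoice :
    ∀ L ∈ partialChoices 16, encodeChoice (decodeChoice L) 16 = L := by
  decide +kernel

theorem card_partialChoices : (partialChoices 16).toFinset.card = 8 := by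
  decide +kernel

theorem ncard_isRigidChoice : {o | IsRigidChoice o}.ncard = 8 := by
  have h : {o | IsRigidChoice o} = decodeChoice '' ((partialChoices 16).toFinset : Set (List ℕ)) := by
    ext o
    simp only [Set.mem_ofPred_eq, Set.mem_image, Finset.mem_coe, List.mem_toFinset]
    constructor
    · exact fun ho => ⟨_, ho.encodeChoice_mem le_rfl, decodeChoice_encodeChoice o⟩
    · rintro ⟨L, hL, rfl⟩
      exact isRigidChoice_decodeChoice L hL
  rw [h, Set.InjOn.ncard_image, Set.ncard_coe_finset, card_partialChoices]
  intro L hL L' hL' e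
  rw [← encodeChoice_decodeChoice L (by simpa using hL), e,
    encodeChoice_decodeChoice L' (by simpa using hL')]

theorem ncard_isRigidBoundary :
    {K : Finset (Finset (Fin 17)) | IsRigidBoundary (configA 0) K}.ncard = 8 := by
  have h : {K : Finset (Finset (Fin 17)) | IsRigidBoundary (configA 0) K} =
      boundaryCells '' {o | IsRigidChoice o} := by
    ext K
    simp only [Set.mem_ofPred_eq, Set.mem_image, isRigidBoundary_iff, eq_comm]
  rw [h, Set.InjOn.ncard_image, ncard_isRigidChoice]
  exact fun o ho o' _ e => boundaryCells_injective ho.hex ho.good e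

/-! ### Separating the components. -/

theorem IsRigidBoundary.induces_of_component_eq {ι E : Type*} [Fintype ι] [DecidableEq ι]
    [NormedAddCommGroup E] [NormedSpace ℝ E] {a : ι → E} {K : Finset (Finset ι)}
    (hK : IsRigidBoundary a K) {T T' : Triangulation a} (hT : Induces a T.1 K)
    (h : (flipGraph a).connectedComponentMk T = (flipGraph a).connectedComponentMk T') :
    Induces a T'.1 K := by
  obtain ⟨p⟩ := SimpleGraph.ConnectedComponent.exact h
  induction p with
  | nil => exact hT
  | cons hadj p ih => exact ih (hK.no_flip _ _ hT hadj) (SimpleGraph.ConnectedComponent.sound ⟨p⟩)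

theorem IsGenericLift.neg {ι E : Type*} [Fintype ι] [DecidableEq ι]
    [NormedAddCommGroup E] [NormedSpace ℝ E] {a : ι → E} {w : ι → ℝ} (hw : IsGenericLift a w) :
    IsGenericLift a (-w) := by
  intro ρ hρ k hk
  have h : excess a ρ k (-w) = -excess a ρ k w := by simp [excess]
  exact h ▸ neg_ne_zero.2 (hw ρ hρ k hk)

/-- The positive part of a dependence that is positive on the lifting is not a face of the regular
subdivision. -/
theorem not_subset_regularCells {ι E : Type*} [Fintype ι] [DecidableEq ι]
    [NormedAddCommGroup E] [NormedSpace ℝ E] {a : ι → E} {w d : ι → ℝ} (hd : IsDep a d)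
    (hpos : 0 < ∑ i, d i * w i) {σ : Finset ι} (hσ : σ ∈ regularCells a w) :
    ¬ ∀ i, 0 < d i → i ∈ σ := by
  intro h
  obtain ⟨-, g, hg, hgσ⟩ := hσ
  have h1 : ∑ i, d i * w i ≤ ∑ i, d i * g (a i) := by
    refine Finset.sum_le_sum fun i _ => ?_
    by_cases hi : 0 < d i
    · rw [(hgσ i).1 (h i hi)]
    · exact mul_le_mul_of_nonpos_left (hg i) (not_lt.1 hi)
  rw [hd.sum_affine g] at h1
  linarith

/-- A lifting that is positive on a hexagon dependence excludes the positive part as a face, so the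
other part is the one that occurs. -/
theorem choiceOf_of_regularCells {T : Finset (Finset (Fin 17))}
    (hT : IsTriangulation (configA 0) T) {w : Fin 17 → ℝ}
    (hw : (T : Set (Finset (Fin 17))) = regularCells (configA 0) w) {l : Fin 4} {s : Fin 4 → Bool}
    {b : Bool} (hpos : 0 < ∑ k, hexDep l s b k * w k) : choiceOf T l s = b := by
  by_contra hne
  obtain ⟨σ, hσ, hs⟩ := exists_hexTriple_subset hT l s
  have hb : (!choiceOf T l s) = b := by
    revert hne
    cases choiceOf T l s <;> cases b <;> simp
  rw [hb] at hs
  have hσ' : σ ∈ regularCells (configA 0) w := hw ▸ Finset.mem_coe.2 hσ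
  exact not_subset_regularCells (isDep_hexDep l s b) hpos hσ' fun k hk =>
    hs ((hexDep_pos_iff l s b k).1 hk)

theorem exists_regular_choiceOf_ne : ∃ T T' : Triangulation (configA 0),
    IsRegularTriangulation (configA 0) T.1 ∧ IsRegularTriangulation (configA 0) T'.1 ∧
      choiceOf T.1 ≠ choiceOf T'.1 := by
  set d := hexDep 0 (fun _ => true) true with hd
  have h0 : 0 < ∑ k, d k * d k := by
    refine (Finset.sum_nonneg fun k _ => mul_self_nonneg _).lt_of_ne' fun h => ?_
    apply hexDep_ne_zero 0 (fun _ => true) true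
    ext k
    exact mul_self_eq_zero.1 ((Finset.sum_eq_zero_iff_of_nonneg fun k _ => mul_self_nonneg _).1 h k
      (Finset.mem_univ k))
  have hc : Continuous fun w : Fin 17 → ℝ => ∑ k, d k * w k := by fun_prop
  -- A generic lifting near the dependence `d` itself is positive on `d`, and its negative is
  -- negative on `d`.
  obtain ⟨w, hw, hpos⟩ := ((frequently_isGenericLift (configA 0) d).and_eventually
    ((hc.tendsto d).eventually (lt_mem_nhds h0))).exists
  obtain ⟨T, hT⟩ := hw.exists_triangulation affineSpan_configA
  obtain ⟨T', hT'⟩ := hw.neg.exists_triangulation affineSpan_configA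
  refine ⟨T, T', ⟨w, hT⟩, ⟨-w, hT'⟩, fun h => ?_⟩
  have h1 := choiceOf_of_regularCells T.2 hT (l := 0) (s := fun _ => true) (b := true) hpos
  have h2 := choiceOf_of_regularCells T'.2 hT' (l := 0) (s := fun _ => true) (b := false) (by
    rw [← Bool.not_true, hexDep_not]
    simpa using hpos)
  rw [h, h2] at h1
  exact Bool.false_ne_true h1

theorem mainTheorem6 :
    {K : Finset (Finset (Fin 17)) | IsRigidBoundary (configA 0) K}.ncard = 8 ∧
    (∀ K K' : Finset (Finset (Fin 17)),
      IsRigidBoundary (configA 0) K → IsRigidBoundary (configA 0) K' → K ≠ K' →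
      ∀ T T' : Triangulation (configA 0),
        Induces (configA 0) T.1 K → Induces (configA 0) T'.1 K' →
        (flipGraph (configA 0)).connectedComponentMk T ≠
          (flipGraph (configA 0)).connectedComponentMk T') ∧
    (∃ c₀ : (flipGraph (configA 0)).ConnectedComponent,
      (∃ T : Triangulation (configA 0), IsRegularTriangulation (configA 0) T.1) ∧
      (∀ T : Triangulation (configA 0), IsRegularTriangulation (configA 0) T.1 →
        (flipGraph (configA 0)).connectedComponentMk T = c₀) ∧
      (∀ K : Finset (Finset (Fin 17)), IsRigidBoundary (configA 0) K →
        ∀ T : Triangulation (configA 0), Induces (configA 0) T.1 K →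
          (flipGraph (configA 0)).connectedComponentMk T ≠ c₀)) ∧
    9 ≤ Nat.card (flipGraph (configA 0)).ConnectedComponent := by
  have hdist : ∀ K K' : Finset (Finset (Fin 17)),
      IsRigidBoundary (configA 0) K → IsRigidBoundary (configA 0) K' → K ≠ K' →
      ∀ T T' : Triangulation (configA 0),
        Induces (configA 0) T.1 K → Induces (configA 0) T'.1 K' →
        (flipGraph (configA 0)).connectedComponentMk T ≠
          (flipGraph (configA 0)).connectedComponentMk T' :=
    fun K K' hK _ hne T T' hT hT' h => hne ((hK.induces_of_component_eq hT h).unique hT')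
  obtain ⟨T₁, T₂, h₁, h₂, hne⟩ := exists_regular_choiceOf_ne
  have hreg : ∀ T : Triangulation (configA 0), IsRegularTriangulation (configA 0) T.1 →
      (flipGraph (configA 0)).connectedComponentMk T =
        (flipGraph (configA 0)).connectedComponentMk T₁ :=
    fun T hT => component_eq_of_regular affineSpan_configA T T₁ hT h₁
  have hc₀ : ∀ K : Finset (Finset (Fin 17)), IsRigidBoundary (configA 0) K →
      ∀ T : Triangulation (configA 0), Induces (configA 0) T.1 K →
        (flipGraph (configA 0)).connectedComponentMk T ≠
          (flipGraph (configA 0)).connectedComponentMk T₁ := by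
    intro K hK T hT h
    -- A rigid boundary in the regular component would be shared by both regular triangulations,
    -- which differ in a choice.
    have k₁ := (induces_iff T₁.2).1 (hK.induces_of_component_eq hT h)
    have k₂ := (induces_iff T₂.2).1 (hK.induces_of_component_eq hT (h.trans (hreg T₂ h₂).symm))
    exact hne (boundaryCells_injective (isHexChoice_choiceOf _) (isGood_choiceOf T₁.2)
      (k₁.symm.trans k₂))
  refine ⟨ncard_isRigidBoundary, hdist, ⟨_, ⟨T₁, h₁⟩, hreg, hc₀⟩, ?_⟩
  choose F hF using fun K : {K // IsRigidBoundary (configA 0) K} => K.2.extends_inside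
  let f : {K // IsRigidBoundary (configA 0) K} → (flipGraph (configA 0)).ConnectedComponent :=
    fun K => (flipGraph (configA 0)).connectedComponentMk (F K)
  -- The regular component is adjoined as `none` to the eight rigid boundaries, which yields nine
  -- components.
  have hf : Function.Injective fun K : Option {K // IsRigidBoundary (configA 0) K} =>
      K.elim ((flipGraph (configA 0)).connectedComponentMk T₁) f := by
    rintro (_ | K) (_ | K') h
    · rfl
    · exact absurd h.symm (hc₀ K'.1 K'.2 _ (hF K'))
    · exact absurd h (hc₀ K.1 K.2 _ (hF K))
    · congr 1
      by_contra hKK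
      exact hdist K.1 K'.1 K.2 K'.2 (fun e => hKK (Subtype.ext e)) _ _ (hF K) (hF K') h
  have hfin : Finite (flipGraph (configA 0)).ConnectedComponent :=
    Finite.of_surjective (flipGraph (configA 0)).connectedComponentMk Quot.mk_surjective
  have := Nat.card_le_card_of_injective _ hf
  rw [Finite.card_option] at this
  exact le_trans (Nat.succ_le_succ ncard_isRigidBoundary.ge) this
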